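/- For $q\in\{2,3\}$, all matroids are finite, and if $M$ is a simple $GF(q)$-representable matroid and $k\ge r(M)$, the $(GF(q),k)$-complement of $M$ is the matroid $PG(k-1,q)\backslash T$, where $T$ is a set of points with $PG(k-1,q)|T\cong M$ (it is determined up to isomorphism); $M^c$ denotes the $(GF(q),r(M))$-complement. The class of ternary comatroids is the smallest class of matroids, closed under isomorphism, that contains the empty matroid $U_{0,0}$, is closed under direct sums, and contains, with each member $M$, its $(GF(3),t)$-complement for every $t\ge r(M)$. Theorem. Let $M$ be a simple $GF(3)$-representable matroid that is not a ternary comatroid, such that $M|F$ is a ternary comatroid for every proper flat $F$ of $M$ (that is, every flat $F\neq E(M)$). If $r(M)\ge 4$, then $M$ or $M^c$ has a cocircuit of size less than four. -/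

import Mathlib

open scoped LinearAlgebra.Projectivization Matroid

universe u

namespace Comatroid

/-- Two matroids, possibly on different types, are isomorphic: there is a bijection of their ground
sets under which the independent sets correspond. -/
def Iso {α β : Type*} (M : Matroid α) (N : Matroid β) : Prop :=
  ∃ e : M.E ≃ N.E, ∀ I : Set M.E,
    M.Indep (Subtype.val '' I) ↔ N.Indep (Subtype.val '' (e '' I))

/-- A matroid is simple: it has no loops (the case `e = f`) and no parallel pairs. -/
def IsSimple {α : Type*} (M : Matroid α) : Prop :=
  ∀ e ∈ M.E, ∀ f ∈ M.E, M.Indep {e, f}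

/-- `M` is `F`-representable: its elements can be labelled by vectors of a finite-dimensional
coordinate space over `F` so that independence in `M` is linear independence of the
labelled family. -/
def IsRepresentable (F : Type) [Field F] {α : Type*} (M : Matroid α) : Prop :=
  ∃ (n : ℕ) (v : α → Fin n → F), ∀ I ⊆ M.E, (M.Indep I ↔ LinearIndepOn F v I)

/-- Augmentation for independent sets of projective points. -/
theorem exists_augment {F V : Type*} [Field F] [AddCommGroup V] [Module F V]
    {I J : Set (ℙ F V)} (hI : LinearIndepOn F Projectivization.rep I)
    (hJ : LinearIndepOn F Projectivization.rep J) (hIf : I.Finite) (hJf : J.Finite)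
    (hlt : I.ncard < J.ncard) :
    ∃ e ∈ J, e ∉ I ∧ LinearIndepOn F Projectivization.rep (insert e I) := by
  classical
  by_contra hcon
  push Not at hcon
  have hsub : ∀ e ∈ J, Projectivization.rep e ∈
      Submodule.span F (Projectivization.rep '' I) := by
    intro e he
    by_cases heI : e ∈ I
    · exact Submodule.subset_span ⟨e, heI, rfl⟩
    · by_contra hns
      exact hcon e he heI (hI.insert hns)
  have : Fintype I := hIf.fintype
  have : Fintype J := hJf.fintype
  have hle : Submodule.span F (Set.range fun x : J => Projectivization.rep (x : ℙ F V)) ≤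
      Submodule.span F (Set.range fun x : I => Projectivization.rep (x : ℙ F V)) := by
    rw [Submodule.span_le]
    rintro _ ⟨x, rfl⟩
    have h := hsub x x.2
    rwa [Set.image_eq_range] at h
  have : FiniteDimensional F
      (Submodule.span F (Set.range fun x : I => Projectivization.rep (x : ℙ F V))) :=
    FiniteDimensional.span_of_finite F (Set.finite_range _)
  have h1 := finrank_span_eq_card (R := F) hI
  have h2 := finrank_span_eq_card (R := F) hJ
  have h3 := Submodule.finrank_mono hle
  rw [Set.ncard_eq_toFinset_card', Set.ncard_eq_toFinset_card', Set.toFinset_card,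
    Set.toFinset_card] at hlt
  omega

/-- The projective geometry `PG(n-1, F)` as a matroid: its elements are the points of the projective
space of `F ^ n`, and a set of points is independent if representing vectors are linearly
independent. For `n = 0` it is the empty matroid. -/
noncomputable def projGeom (F : Type) [Field F] [Finite F] (n : ℕ) :
    Matroid (ℙ F (Fin n → F)) :=
  (IndepMatroid.ofFinite (E := Set.univ) Set.finite_univ
    (fun I => LinearIndepOn F Projectivization.rep I)
    (linearIndepOn_empty F _)
    (fun _ _ hJ hIJ => hJ.mono hIJ)
    (fun _ _ hI hJ hlt =>
      exists_augment hI hJ (Set.toFinite _) (Set.toFinite _) hlt)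
    (fun _ _ => Set.subset_univ _)).matroid

/-- `N` is (up to isomorphism) the `(F, k)`-complement of `M`: for some set `T` of points of
`PG(k-1, F)`, `M` is isomorphic to the restriction to `T` and `N` is isomorphic to the matroid
obtained by deleting `T`. Such a `T` exists exactly if `M` is simple, `F`-representable and of
rank at most `k`. -/
def IsComplement (F : Type) [Field F] [Finite F] (k : ℕ) {α β : Type*}
    (M : Matroid α) (N : Matroid β) : Prop :=
  ∃ T : Set (ℙ F (Fin k → F)), Iso M (projGeom F k ↾ T) ∧ Iso N (projGeom F k ↾ Tᶜ)

/-- The class of `F`-comatroids (for `F = GF(2)` or `F = GF(3)`): the smallest class of matroids,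
considered up to isomorphism, that contains the empty matroid and is closed under direct sums and
under `(F, t)`-complements for all `t` at least the rank. -/
inductive IsComatroid (F : Type) [Field F] [Finite F] : ∀ {α : Type u}, Matroid α → Prop
  | empty {α : Type u} (M : Matroid α) (hM : M.E = ∅) : IsComatroid F M
  | sum {α β γ : Type u} (M₁ : Matroid α) (M₂ : Matroid β) (N : Matroid γ)
      (h₁ : IsComatroid F M₁) (h₂ : IsComatroid F M₂) (hN : Iso (M₁.sum M₂) N) : IsComatroid F N
  | compl {α β : Type u} (M : Matroid α) (N : Matroid β) (t : ℕ) (hM : IsComatroid F M)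
      (ht : M.eRank ≤ t) (hN : IsComplement F t M N) : IsComatroid F N

/-- Induced-restriction-minimal non-`F`-comatroids: the simple `F`-representable matroids that are
not `F`-comatroids although their restrictions to proper flats are. -/
structure IsMinimalNonComatroid (F : Type) [Field F] [Finite F] {α : Type u}
    (M : Matroid α) : Prop where
  simple : IsSimple M
  representable : IsRepresentable F M
  not_comatroid : ¬ IsComatroid F M
  flat_comatroid : ∀ X : Set α, M.IsFlat X → X ≠ M.E → IsComatroid F (M ↾ X)

end Comatroid

/-! Represent M by a point set T of PG(r-1,3) and colour the nonzero vectors of GF(3)^r by two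
colours, G for the points in T and R for the others. Call a subspace separated in a colour if its
vectors of that colour lie in two complementary nonzero subspaces of it, and connected otherwise.

For a comatroid every subspace of dimension at least two is separated in one of the colours
(`IsComatroid.sepClosed`). Direct sums keep this property, and complementation only exchanges the
colours. However, the complement may be given by a different representation, so unique
representability over GF(3) is needed to transfer separations
(`exists_linearMap_of_linearIndepOn_iff`, which rests on `exists_splitting`).

For a minimal non-comatroid each hyperplane is therefore separated in some colour. The whole space
is separated in neither, since a separation would make M or its complement a direct sum of
comatroids. Counting vectors shows that no subspace of dimension at least three is separated in both
colours (`not_sep_of_sep`), so each hyperplane is connected in exactly one colour. Suppose that in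
addition neither colour has a cocircuit with fewer than four points; these data form a `Coloring`.

An ear argument (`exists_connected_hyperplane`) shows that each colour has a connected hyperplane: a
maximal proper connected subspace of codimension at least two would force a cocircuit with at most
three points.

The contradiction is numerical. Let g and ρ count the nonzero functionals whose kernels are
connected in G and in R, so g + ρ + 1 = N = 3^r. If ker φ is connected in G, then all but at most 36
functionals ψ cut ker φ in a G-connected subspace of codimension two. Each pencil on such an axis
has a second G-connected hyperplane, as otherwise only three points of G would lie outside ker φ;
this gives N ≤ 3g + 30. Conversely, for a given G-separated hyperplane at most six functionals have
a G-connected kernel that meets it in a G-connected subspace of codimension two. Double counting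
gives gρ ≤ 6ρ + 33g, which is impossible for g ≤ ρ and N ≥ 81. The case ρ ≤ g follows by exchanging
the colours. -/

namespace Comatroid
open Module Submodule

/-! ### Separations of vector sets and the splitting lemma. -/

section Separation

set_option linter.unusedSectionVars false

variable {K V : Type*} [Field K] [AddCommGroup V] [Module K V]

/-- The part of `S` in the subspace `W` lies in the union of two nonzero complementary subspaces
of `W`. -/
def Sep (K : Type*) {V : Type*} [Field K] [AddCommGroup V] [Module K V] (S : Set V)
    (W : Submodule K V) : Prop :=
  ∃ A B : Submodule K V, A ≠ ⊥ ∧ B ≠ ⊥ ∧ A ⊔ B = W ∧ Disjoint A B ∧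
    ∀ v ∈ S, v ∈ W → v ∈ A ∨ v ∈ B

theorem Sep.congr {S T : Set V} {W : Submodule K V} (h : Sep K S W)
    (hST : ∀ v ∈ W, v ≠ 0 → v ∈ T → v ∈ S) : Sep K T W := by
  obtain ⟨A, B, hA, hB, hW, hd, hS⟩ := h
  refine ⟨A, B, hA, hB, hW, hd, fun v hv hvW => ?_⟩
  by_cases h0 : v = 0
  · left; rw [h0]; exact A.zero_mem
  · exact hS v (hST v hvW h0 hv) hvW

theorem eq_zero_of_disjoint {A B : Submodule K V} (h : Disjoint A B) {v : V} (hA : v ∈ A)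
    (hB : v ∈ B) : v = 0 :=
  Submodule.disjoint_def.1 h v hA hB

theorem span_inter_eq_left {A B : Submodule K V} (hd : Disjoint A B) {T : Set V}
    (hT : span K T = A ⊔ B) (hAB : ∀ t ∈ T, t ∈ A ∨ t ∈ B) :
    span K {t ∈ T | t ∈ A} = A := by
  have h1 : span K {t ∈ T | t ∈ A} ≤ A := span_le.2 fun t ht => ht.2
  refine le_antisymm h1 fun a ha => ?_
  have h2 : A ⊔ B ≤ span K {t ∈ T | t ∈ A} ⊔ B := by
    rw [← hT, span_le]
    intro t ht
    rcases hAB t ht with h | h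
    · exact mem_sup_left (subset_span ⟨ht, h⟩)
    · exact mem_sup_right h
  obtain ⟨x, hx, b, hb, rfl⟩ := mem_sup.1 (h2 (mem_sup_left ha))
  have : b ∈ A := by simpa using A.sub_mem ha (h1 hx)
  rw [eq_zero_of_disjoint hd this hb, add_zero]
  exact hx

theorem span_inter_eq_right {A B : Submodule K V} (hd : Disjoint A B) {T : Set V}
    (hT : span K T = A ⊔ B) (hAB : ∀ t ∈ T, t ∈ A ∨ t ∈ B) :
    span K {t ∈ T | t ∈ B} = B :=
  span_inter_eq_left hd.symm (by rw [hT, sup_comm]) fun t ht => (hAB t ht).symm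

variable [FiniteDimensional K V]

theorem finrank_sup_of_disjoint {A B : Submodule K V} (h : Disjoint A B) :
    finrank K ↥(A ⊔ B) = finrank K A + finrank K B := by
  have := Submodule.finrank_sup_add_finrank_inf_eq A B
  rw [h.eq_bot, finrank_bot] at this
  simpa using this

theorem disjoint_span_singleton_of_notMem {F : Submodule K V} {y : V} (h : y ∉ F) :
    Disjoint F (span K {y}) := by
  rw [Submodule.disjoint_def]
  intro v hv hv'
  obtain ⟨c, rfl⟩ := mem_span_singleton.1 hv'
  by_contra hne
  have hc : c ≠ 0 := fun h => hne (by rw [h, zero_smul])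
  exact h ((F.smul_mem_iff hc).1 hv)

theorem finrank_sup_span_singleton_of_notMem {F : Submodule K V} {y : V} (h : y ∉ F) :
    finrank K ↥(F ⊔ span K {y}) = finrank K F + 1 := by
  rw [finrank_sup_of_disjoint (disjoint_span_singleton_of_notMem h), finrank_span_singleton]
  rintro rfl
  exact h F.zero_mem

/-- If no subspace of codimension one of `U` spanned by elements of `T` avoids both an element of
`Y` and an element of `Z`, then some splitting of `T` separates `Y` from `Z`. -/
theorem exists_splitting (n : ℕ) : ∀ (U : Submodule K V) (T Y Z : Set V), finrank K U = n →
    span K T = U → Y ⊆ U → Z ⊆ U →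
    (∀ T₀ ⊆ T, finrank K (span K T₀) + 1 = finrank K U → ∀ y ∈ Y, ∀ z ∈ Z,
      y ∈ span K T₀ ∨ z ∈ span K T₀) →
    ∃ A B : Submodule K V, A ⊔ B = U ∧ Disjoint A B ∧ (∀ t ∈ T, t ∈ A ∨ t ∈ B) ∧
      Y ⊆ A ∧ Z ⊆ B := by
  induction n using Nat.strong_induction_on with
  | _ n ih =>
  intro U T Y Z hn hT hYU hZU hyp
  have hTU : ∀ t ∈ T, t ∈ U := fun t ht => hT ▸ subset_span ht
  by_cases hsep : Sep K T U
  · obtain ⟨C, D, hC, hD, hCD, hd, hS⟩ := hsep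
    have hS' : ∀ t ∈ T, t ∈ C ∨ t ∈ D := fun t ht => hS t ht (hTU t ht)
    have hfin := finrank_sup_of_disjoint hd
    rw [hCD, hn] at hfin
    have hCpos : 0 < finrank K C := by
      rw [Nat.pos_iff_ne_zero]; exact fun h => hC (finrank_eq_zero.1 h)
    have hDpos : 0 < finrank K D := by
      rw [Nat.pos_iff_ne_zero]; exact fun h => hD (finrank_eq_zero.1 h)
    have hTC := span_inter_eq_left hd (hT.trans hCD.symm) hS'
    have hTD := span_inter_eq_right hd (hT.trans hCD.symm) hS'
    -- A separation of `T` reduces the claim to `C` and `D`, with `Y` and `Z` replaced by their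
    -- projections. A hyperplane of `C` together with all of `D` is a hyperplane of `U`, so the
    -- hypothesis is inherited.
    obtain ⟨A₁, B₁, h1, h1d, h1T, h1Y, h1Z⟩ := ih (finrank K C) (by omega) C {t ∈ T | t ∈ C}
      {c | c ∈ C ∧ ∃ d ∈ D, c + d ∈ Y} {c | c ∈ C ∧ ∃ d ∈ D, c + d ∈ Z} rfl hTC
      (fun x hx => hx.1) (fun x hx => hx.1) (by
        rintro T₀ hT₀ hr y ⟨hyC, dy, hdy, hy⟩ z ⟨hzC, dz, hdz, hz⟩
        have hT₀C : span K T₀ ≤ C := span_le.2 fun t ht => (hT₀ ht).2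
        have hkey : ∀ x ∈ C, ∀ d ∈ D, x + d ∈ span K (T₀ ∪ {t ∈ T | t ∈ D}) →
            x ∈ span K T₀ := by
          intro x hx d hdD h
          rw [span_union, hTD] at h
          obtain ⟨s, hs, d', hd', he⟩ := mem_sup.1 h
          have h3 : x - s = d' - d := by rw [sub_eq_sub_iff_add_eq_add, ← he]; abel
          have h4 : x - s = 0 := eq_zero_of_disjoint hd (C.sub_mem hx (hT₀C hs))
            (h3 ▸ D.sub_mem hd' hdD)
          rw [sub_eq_zero.1 h4]; exact hs
        rcases hyp (T₀ ∪ {t ∈ T | t ∈ D}) (by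
          rintro t (ht | ht)
          · exact (hT₀ ht).1
          · exact ht.1) (by
          rw [span_union, hTD, finrank_sup_of_disjoint (hd.mono_left hT₀C)]; omega)
          _ hy _ hz with h | h
        · exact Or.inl (hkey _ hyC _ hdy h)
        · exact Or.inr (hkey _ hzC _ hdz h))
    obtain ⟨A₂, B₂, h2, h2d, h2T, h2Y, h2Z⟩ := ih (finrank K D) (by omega) D {t ∈ T | t ∈ D}
      {d | d ∈ D ∧ ∃ c ∈ C, c + d ∈ Y} {d | d ∈ D ∧ ∃ c ∈ C, c + d ∈ Z} rfl hTD
      (fun x hx => hx.1) (fun x hx => hx.1) (by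
        rintro T₀ hT₀ hr y ⟨hyD, cy, hcy, hy⟩ z ⟨hzD, cz, hcz, hz⟩
        have hT₀D : span K T₀ ≤ D := span_le.2 fun t ht => (hT₀ ht).2
        have hkey : ∀ x ∈ D, ∀ c ∈ C, c + x ∈ span K ({t ∈ T | t ∈ C} ∪ T₀) →
            x ∈ span K T₀ := by
          intro x hx c hcC h
          rw [span_union, hTC] at h
          obtain ⟨c', hc', s, hs, he⟩ := mem_sup.1 h
          have h3 : x - s = c' - c := by rw [sub_eq_sub_iff_add_eq_add, he]; abel
          have h4 : x - s = 0 := eq_zero_of_disjoint hd (h3 ▸ C.sub_mem hc' hcC)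
            (D.sub_mem hx (hT₀D hs))
          rw [sub_eq_zero.1 h4]; exact hs
        rcases hyp ({t ∈ T | t ∈ C} ∪ T₀) (by
          rintro t (ht | ht)
          · exact ht.1
          · exact (hT₀ ht).1) (by
          rw [span_union, hTC, finrank_sup_of_disjoint (hd.mono_right hT₀D)]; omega)
          _ hy _ hz with h | h
        · exact Or.inl (hkey _ hyD _ hcy h)
        · exact Or.inr (hkey _ hzD _ hcz h))
    refine ⟨A₁ ⊔ A₂, B₁ ⊔ B₂, ?_, ?_, ?_, ?_, ?_⟩
    · rw [sup_sup_sup_comm, h1, h2, hCD]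
    · rw [Submodule.disjoint_def]
      intro v hv hv'
      obtain ⟨a₁, ha₁, a₂, ha₂, rfl⟩ := mem_sup.1 hv
      obtain ⟨b₁, hb₁, b₂, hb₂, he⟩ := mem_sup.1 hv'
      have hA₁ : A₁ ≤ C := h1 ▸ le_sup_left
      have hB₁ : B₁ ≤ C := h1 ▸ le_sup_right
      have hA₂ : A₂ ≤ D := h2 ▸ le_sup_left
      have hB₂ : B₂ ≤ D := h2 ▸ le_sup_right
      have h3 : a₁ - b₁ = b₂ - a₂ := by rw [sub_eq_sub_iff_add_eq_add, ← he]; abel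
      have h4 : a₁ - b₁ = 0 := eq_zero_of_disjoint hd (C.sub_mem (hA₁ ha₁) (hB₁ hb₁))
        (h3 ▸ D.sub_mem (hB₂ hb₂) (hA₂ ha₂))
      have h5 : b₂ = a₂ := sub_eq_zero.1 (h3 ▸ h4)
      have h6 : a₁ = b₁ := sub_eq_zero.1 h4
      rw [eq_zero_of_disjoint h1d ha₁ (h6 ▸ hb₁), eq_zero_of_disjoint h2d ha₂ (h5 ▸ hb₂), add_zero]
    · intro t ht
      rcases hS' t ht with h | h
      · rcases h1T t ⟨ht, h⟩ with h | h
        · exact Or.inl (mem_sup_left h)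
        · exact Or.inr (mem_sup_left h)
      · rcases h2T t ⟨ht, h⟩ with h | h
        · exact Or.inl (mem_sup_right h)
        · exact Or.inr (mem_sup_right h)
    · intro y hy
      have hyU := hYU hy
      rw [← hCD] at hyU
      obtain ⟨c, hc, d, hd, rfl⟩ := mem_sup.1 hyU
      exact add_mem (mem_sup_left (h1Y ⟨hc, d, hd, hy⟩)) (mem_sup_right (h2Y ⟨hd, c, hc, hy⟩))
    · intro y hy
      have hyU := hZU hy
      rw [← hCD] at hyU
      obtain ⟨c, hc, d, hd, rfl⟩ := mem_sup.1 hyU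
      exact add_mem (mem_sup_left (h1Z ⟨hc, d, hd, hy⟩)) (mem_sup_right (h2Z ⟨hd, c, hc, hy⟩))
  -- Now `T` is not separated, so only the trivial splittings are available, and it must be shown
  -- that `Y` or `Z` consists of zero only.
  by_cases hY : ∀ y ∈ Y, y = 0
  · exact ⟨⊥, U, bot_sup_eq _, disjoint_bot_left, fun t ht => Or.inr (hTU t ht),
      fun y hy => by rw [hY y hy]; exact zero_mem _, hZU⟩
  by_cases hZ : ∀ y ∈ Z, y = 0
  · exact ⟨U, ⊥, sup_bot_eq _, disjoint_bot_right, fun t ht => Or.inl (hTU t ht), hYU,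
      fun y hy => by rw [hZ y hy]; exact zero_mem _⟩
  push Not at hY hZ
  obtain ⟨y, hyY, hy0⟩ := hY
  obtain ⟨z, hzZ, hz0⟩ := hZ
  exfalso
  -- `F` is a maximal subspace spanned by elements of `T` that avoids both `y` and `z`. It is not a
  -- hyperplane by hypothesis. By maximality each element of `T` outside `F` lies in `F + ⟨y⟩` or `F
  -- + ⟨z⟩`, which makes the codimension of `F` exactly two.
  obtain ⟨F, ⟨T₀, hT₀, hFT₀, hyF, hzF⟩, hmax⟩ := WellFounded.has_min
    (wellFounded_gt (α := Submodule K V)) {F | ∃ T₀ ⊆ T, span K T₀ = F ∧ y ∉ F ∧ z ∉ F}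
    ⟨⊥, ∅, Set.empty_subset _, span_empty, by simpa using hy0, by simpa using hz0⟩
  have hFU : F ≤ U := by rw [← hFT₀, ← hT]; exact span_mono hT₀
  have hcodim : finrank K F + 1 ≠ finrank K U := by
    intro h
    rw [← hFT₀] at h hyF hzF
    rcases hyp T₀ hT₀ h y hyY z hzZ with h | h
    · exact hyF h
    · exact hzF h
  have hcov : ∀ t ∈ T, t ∈ F ∨ t ∈ F ⊔ span K {y} ∨ t ∈ F ⊔ span K {z} := by
    intro t ht
    by_cases htF : t ∈ F
    · exact Or.inl htF
    right
    by_contra hcon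
    push Not at hcon
    refine hmax (span K (insert t T₀)) ⟨insert t T₀, Set.insert_subset ht hT₀, rfl, ?_, ?_⟩ ?_
    · intro h
      have := mem_span_insert_exchange h (hFT₀ ▸ hyF)
      rw [span_insert, hFT₀, sup_comm] at this
      exact hcon.1 this
    · intro h
      have := mem_span_insert_exchange h (hFT₀ ▸ hzF)
      rw [span_insert, hFT₀, sup_comm] at this
      exact hcon.2 this
    · refine lt_of_le_of_ne ?_ ?_
      · rw [← hFT₀]; exact span_mono (Set.subset_insert _ _)
      · rintro h
        exact htF (by rw [h]; exact subset_span (Set.mem_insert _ _))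
  have hUle : U = F ⊔ span K {y} ⊔ span K {z} := by
    refine le_antisymm ?_ ?_
    · rw [← hT, span_le]
      intro t ht
      rcases hcov t ht with h | h | h
      · exact mem_sup_left (mem_sup_left h)
      · exact mem_sup_left h
      · exact (sup_le_sup_right le_sup_left _ : F ⊔ span K {z} ≤ _) h
    · refine sup_le (sup_le hFU ?_) ?_
      · rw [span_singleton_le_iff_mem]; exact hYU hyY
      · rw [span_singleton_le_iff_mem]; exact hZU hzZ
  have hzFy : z ∉ F ⊔ span K {y} := by
    intro h
    rw [sup_eq_left.2 ((span_singleton_le_iff_mem _ _).2 h)] at hUle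
    apply hcodim
    rw [hUle, finrank_sup_span_singleton_of_notMem hyF]
  have hUF : finrank K U = finrank K F + 2 := by
    rw [hUle, finrank_sup_span_singleton_of_notMem hzFy, finrank_sup_span_singleton_of_notMem hyF]
  have hind : ∀ (a b : K), a • y + b • z ∈ F → a = 0 ∧ b = 0 := by
    intro a b h
    have hb : b = 0 := by
      by_contra hb
      apply hzFy
      rw [← Submodule.smul_mem_iff _ hb]
      have : b • z = (a • y + b • z) + (-a) • y := by rw [neg_smul]; abel
      rw [this]
      exact add_mem (mem_sup_left h) (mem_sup_right (smul_mem _ _ (mem_span_singleton_self _)))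
    refine ⟨?_, hb⟩
    by_contra ha
    apply hyF
    rw [← F.smul_mem_iff ha]
    simpa [hb] using h
  have hTF : span K {t ∈ T | t ∈ F} = F := by
    refine le_antisymm (span_le.2 fun t ht => ht.2) ?_
    conv_lhs => rw [← hFT₀]
    exact span_mono fun t ht => ⟨hT₀ ht, hFT₀ ▸ subset_span ht⟩
  -- The induction is applied to `F`, where the two sets record the offsets `f` for which `y + f`,
  -- respectively `z + f`, is up to a scalar in `T`. A splitting of `F` that puts these offsets into
  -- `A` and `B` extends to a separation of `T` into `A + ⟨y⟩` and `B + ⟨z⟩`, contrary to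
  -- assumption.
  obtain ⟨A, B, hAB, hd, hTAB, hYA, hZB⟩ := ih (finrank K F) (by omega) F {t ∈ T | t ∈ F}
    {f | f ∈ F ∧ ∃ c : K, c ≠ 0 ∧ c • (y + f) ∈ T} {f | f ∈ F ∧ ∃ c : K, c ≠ 0 ∧ c • (z + f) ∈ T}
    rfl hTF (fun x hx => hx.1) (fun x hx => hx.1) (by
      rintro T₁ hT₁ hr f₁ ⟨hf₁, c₁, hc₁, h1⟩ f₂ ⟨hf₂, c₂, hc₂, h2⟩
      have hT₁F : span K T₁ ≤ F := span_le.2 fun t ht => (hT₁ ht).2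
      have hmod : ∀ s ∈ span K T₁, ∀ a b p q : K,
          p • y + q • z = s + a • (y + f₁) + b • (z + f₂) → p = a ∧ q = b := by
        intro s hs a b p q h
        have := hind (p - a) (q - b) (by
          have h3 : (p - a) • y + (q - b) • z = s + a • f₁ + b • f₂ := by
            have : (p - a) • y + (q - b) • z = p • y + q • z - a • y - b • z := by
              rw [sub_smul, sub_smul]; abel
            rw [this, h, smul_add, smul_add]; abel
          rw [h3]
          exact add_mem (add_mem (hT₁F hs) (F.smul_mem _ hf₁)) (F.smul_mem _ hf₂))
        exact ⟨sub_eq_zero.1 this.1, sub_eq_zero.1 this.2⟩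
      -- A hyperplane of `F` spanned by `T₁` becomes a hyperplane of `U` when `y + f₁` and `z + f₂`
      -- are added. It contains `y` or `z`, and comparing coefficients modulo `F` then puts `f₁` or
      -- `f₂` into the span of `T₁`.
      have hspan : span K (insert (c₂ • (z + f₂)) (insert (c₁ • (y + f₁)) T₁)) =
          span K T₁ ⊔ span K {y + f₁} ⊔ span K {z + f₂} := by
        rw [span_insert, span_insert, span_singleton_smul_eq (IsUnit.mk0 _ hc₁),
          span_singleton_smul_eq (IsUnit.mk0 _ hc₂), sup_comm (span K {y + f₁}), sup_comm]
      have hn1 : y + f₁ ∉ span K T₁ := by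
        intro h
        have := F.sub_mem (hT₁F h) hf₁
        exact hyF (by simpa using this)
      have hn2 : z + f₂ ∉ span K T₁ ⊔ span K {y + f₁} := by
        intro h
        obtain ⟨s, hs, w, hw, he⟩ := mem_sup.1 h
        obtain ⟨a, rfl⟩ := mem_span_singleton.1 hw
        have := hind (-a) 1 (by
          have h3 : (-a) • y + (1 : K) • z = s + a • f₁ - f₂ := by
            rw [one_smul, eq_sub_iff_add_eq, add_assoc, ← he, smul_add, neg_smul]; abel
          rw [h3]
          exact F.sub_mem (add_mem (hT₁F hs) (F.smul_mem _ hf₁)) hf₂)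
        exact one_ne_zero this.2
      rcases hyp _ (Set.insert_subset h2 (Set.insert_subset h1 fun t ht => (hT₁ ht).1)) (by
        rw [hspan, finrank_sup_span_singleton_of_notMem hn2,
          finrank_sup_span_singleton_of_notMem hn1, hUF, hr]) y hyY z hzZ with h | h
      · left
        rw [hspan] at h
        obtain ⟨w, hw, v, hv, he⟩ := mem_sup.1 h
        obtain ⟨s, hs, u, hu, rfl⟩ := mem_sup.1 hw
        obtain ⟨a, rfl⟩ := mem_span_singleton.1 hu
        obtain ⟨b, rfl⟩ := mem_span_singleton.1 hv
        obtain ⟨ha, hb⟩ := hmod s hs a b 1 0 (by rw [he]; simp)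
        subst ha hb
        have : f₁ = -s := by
          rw [one_smul, zero_smul, add_zero] at he
          rw [eq_neg_iff_add_eq_zero]
          have h5 : s + f₁ + y = y := by rw [add_assoc, add_comm f₁ y]; exact he
          rw [add_comm]; simpa using h5
        rw [this]; exact neg_mem hs
      · right
        rw [hspan] at h
        obtain ⟨w, hw, v, hv, he⟩ := mem_sup.1 h
        obtain ⟨s, hs, u, hu, rfl⟩ := mem_sup.1 hw
        obtain ⟨a, rfl⟩ := mem_span_singleton.1 hu
        obtain ⟨b, rfl⟩ := mem_span_singleton.1 hv
        obtain ⟨ha, hb⟩ := hmod s hs a b 0 1 (by rw [he]; simp)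
        subst ha hb
        have : f₂ = -s := by
          rw [one_smul, zero_smul, add_zero] at he
          rw [eq_neg_iff_add_eq_zero]
          have h5 : s + f₂ + z = z := by rw [add_assoc, add_comm f₂ z]; exact he
          rw [add_comm]; simpa using h5
        rw [this]; exact neg_mem hs)
  have hsup : (A ⊔ span K {y}) ⊔ (B ⊔ span K {z}) = U := by
    rw [sup_sup_sup_comm, hAB, hUle, sup_assoc]
  have hAF : A ≤ F := hAB ▸ le_sup_left
  have hBF : B ≤ F := hAB ▸ le_sup_right
  refine hsep ⟨A ⊔ span K {y}, B ⊔ span K {z}, ?_, ?_, hsup, ?_, ?_⟩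
  · intro h
    have : y ∈ A ⊔ span K {y} := mem_sup_right (mem_span_singleton_self _)
    rw [h] at this
    exact hy0 (by simpa using this)
  · intro h
    have : z ∈ B ⊔ span K {z} := mem_sup_right (mem_span_singleton_self _)
    rw [h] at this
    exact hz0 (by simpa using this)
  · have h1 := Submodule.finrank_sup_add_finrank_inf_eq (A ⊔ span K {y}) (B ⊔ span K {z})
    have h2 := finrank_sup_of_disjoint hd
    rw [hsup, hUF, finrank_sup_span_singleton_of_notMem fun h => hyF (hAF h),
      finrank_sup_span_singleton_of_notMem fun h => hzF (hBF h)] at h1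
    rw [hAB] at h2
    rw [disjoint_iff, ← finrank_eq_zero (R := K)]
    omega
  · have hkey : ∀ x : V, ∀ t ∈ T, t ∉ F → t ∈ F ⊔ span K {x} →
        ∃ c : K, ∃ f ∈ F, c ≠ 0 ∧ t = c • (x + f) := by
      intro x t ht htF h
      obtain ⟨f, hf, v, hv, he⟩ := mem_sup.1 h
      obtain ⟨c, rfl⟩ := mem_span_singleton.1 hv
      have hc : c ≠ 0 := by
        rintro rfl
        exact htF (by rw [← he]; simpa using hf)
      refine ⟨c, c⁻¹ • f, F.smul_mem _ hf, hc, ?_⟩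
      rw [smul_add, smul_smul, mul_inv_cancel₀ hc, one_smul, ← he, add_comm]
    intro t ht _
    by_cases htF : t ∈ F
    · rcases hTAB t ⟨ht, htF⟩ with h | h
      · exact Or.inl (mem_sup_left h)
      · exact Or.inr (mem_sup_left h)
    rcases hcov t ht with h | h | h
    · exact absurd h htF
    · left
      obtain ⟨c, f, hf, hc, rfl⟩ := hkey y t ht htF h
      exact smul_mem _ _ (add_mem (mem_sup_right (mem_span_singleton_self _))
        (mem_sup_left (hYA ⟨hf, c, hc, ht⟩)))
    · right
      obtain ⟨c, f, hf, hc, rfl⟩ := hkey z t ht htF h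
      exact smul_mem _ _ (add_mem (mem_sup_right (mem_span_singleton_self _))
        (mem_sup_left (hZB ⟨hf, c, hc, ht⟩)))

end Separation

/-! ### Unique representability over the field with three elements. -/

section Uniqueness

theorem zmod_three_cases (c : ZMod 3) : c = 0 ∨ c = 1 ∨ c = -1 := by
  revert c; decide

variable {α V V' : Type*} [AddCommGroup V] [Module (ZMod 3) V] [AddCommGroup V']
  [Module (ZMod 3) V']

theorem smul_eq_or_eq_neg {c : ZMod 3} (hc : c ≠ 0) (v : V) : c • v = v ∨ c • v = -v := by
  rcases zmod_three_cases c with rfl | rfl | rfl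
  · exact absurd rfl hc
  · exact Or.inl (one_smul _ _)
  · right; rw [neg_smul, one_smul]

theorem three_add_eq_zero (v : V) : v + v + v = 0 := by
  have h : (3 : ZMod 3) • v = 0 := by
    rw [show (3 : ZMod 3) = 0 from rfl, zero_smul]
  rw [← h, show (3 : ZMod 3) = 1 + 1 + 1 from rfl, add_smul, add_smul, one_smul]

theorem span_image_eq_of_signs {f g : α → V} {X : Set α}
    (h : ∀ a ∈ X, f a = g a ∨ f a = -g a) :
    span (ZMod 3) (f '' X) = span (ZMod 3) (g '' X) := by
  apply le_antisymm
  · rw [span_le]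
    rintro _ ⟨a, ha, rfl⟩
    have hg : g a ∈ span (ZMod 3) (g '' X) := subset_span ⟨a, ha, rfl⟩
    rcases h a ha with h | h <;> simp only [SetLike.mem_coe, h]
    · exact hg
    · exact neg_mem hg
  · rw [span_le]
    rintro _ ⟨a, ha, rfl⟩
    have hf : f a ∈ span (ZMod 3) (f '' X) := subset_span ⟨a, ha, rfl⟩
    rcases h a ha with h | h
    · rw [h] at hf; exact hf
    · rw [h] at hf; exact neg_mem_iff.1 hf

theorem linearIndepOn_iff_of_signs {f g : α → V} {X : Set α}
    (h : ∀ a ∈ X, f a = g a ∨ f a = -g a) :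
    LinearIndepOn (ZMod 3) f X ↔ LinearIndepOn (ZMod 3) g X := by
  classical
  unfold LinearIndepOn
  rw [← LinearIndependent.units_smul_iff (fun a : X => g a)
    (fun a => if f a = g a then 1 else -1)]
  refine Iff.of_eq ?_
  congr 1
  funext a
  simp only [Pi.smul_apply']
  split_ifs with h1
  · rw [h1, one_smul]
  · rcases h a a.2 with h2 | h2
    · exact absurd h2 h1
    · rw [h2, Units.neg_smul, one_smul]

/-- Independence determines closure: if `f e` depends on a basis of `X`, then so does `f' e`, as
otherwise adding `e` to the basis would be independent for `f'` only. -/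
theorem mem_span_of_linearIndepOn_imp {f : α → V} {f' : α → V'} {E X : Set α} {e : α}
    (h : ∀ I ⊆ E, LinearIndepOn (ZMod 3) f I ↔ LinearIndepOn (ZMod 3) f' I) (hX : X ⊆ E)
    (he : e ∈ E) (hf : f e ∈ span (ZMod 3) (f '' X)) : f' e ∈ span (ZMod 3) (f' '' X) := by
  obtain ⟨I, hIX, -, hI, hli⟩ := exists_linearIndepOn_extension
    (linearIndepOn_empty (ZMod 3) f) (Set.empty_subset X)
  have hf' : f e ∈ span (ZMod 3) (f '' I) := by
    have : span (ZMod 3) (f '' X) ≤ span (ZMod 3) (f '' I) := span_le.2 hI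
    exact this hf
  refine span_mono (Set.image_mono hIX) ?_
  by_cases heI : e ∈ I
  · exact subset_span ⟨e, heI, rfl⟩
  by_contra hcon
  have h1 := (h I (hIX.trans hX)).1 hli
  have h2 := (linearIndepOn_insert heI).2 ⟨h1, hcon⟩
  rw [← h _ (Set.insert_subset he (hIX.trans hX)), linearIndepOn_insert heI] at h2
  exact h2.2 hf'

theorem mem_span_iff_of_linearIndepOn_iff {f : α → V} {f' : α → V'} {E X : Set α} {e : α}
    (h : ∀ I ⊆ E, LinearIndepOn (ZMod 3) f I ↔ LinearIndepOn (ZMod 3) f' I) (hX : X ⊆ E)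
    (he : e ∈ E) : f e ∈ span (ZMod 3) (f '' X) ↔ f' e ∈ span (ZMod 3) (f' '' X) :=
  ⟨mem_span_of_linearIndepOn_imp h hX he,
    mem_span_of_linearIndepOn_imp (fun I hI => (h I hI).symm) hX he⟩

/-- For disjoint subspaces there is an involution that fixes the first one pointwise and negates
the second one. -/
theorem exists_involution {A B : Submodule (ZMod 3) V} (hd : Disjoint A B) :
    ∃ h : V →ₗ[ZMod 3] V, Function.Injective h ∧ (∀ a ∈ A, h a = a) ∧ ∀ b ∈ B, h b = -b := by
  obtain ⟨A', hA', hc⟩ := hd.exists_isCompl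
  refine ⟨A'.projection B hc - B.projection A' hc.symm, ?_, ?_, ?_⟩
  · rw [injective_iff_map_eq_zero]
    intro v hv
    rw [LinearMap.sub_apply, sub_eq_zero] at hv
    have h1 := projection_apply_mem hc v
    have h2 := projection_apply_mem hc.symm v
    have h3 := eq_zero_of_disjoint hc.disjoint h1 (hv ▸ h2)
    rw [← projection_add_projection_eq_self hc v, ← hv, h3, add_zero]
  · intro a ha
    rw [LinearMap.sub_apply, projection_apply_of_mem_left hc (hA' ha),
      (projection_apply_eq_zero_iff hc.symm).2 (hA' ha), sub_zero]
  · intro b hb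
    rw [LinearMap.sub_apply, projection_apply_of_mem_left hc.symm hb,
      (projection_apply_eq_zero_iff hc).2 hb, zero_sub]

variable [FiniteDimensional (ZMod 3) V']

/-- Ternary matroids are uniquely representable: two families over the field with three elements
with the same independent sets agree up to signs and a linear map that is injective on the span. -/
theorem exists_linearMap_of_linearIndepOn_iff {f : α → V} {f' : α → V'} {E : Set α}
    (hE : E.Finite)
    (h : ∀ I ⊆ E, LinearIndepOn (ZMod 3) f I ↔ LinearIndepOn (ZMod 3) f' I) :
    ∃ g : V →ₗ[ZMod 3] V', Disjoint (span (ZMod 3) (f '' E)) (LinearMap.ker g) ∧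
      ∀ e ∈ E, g (f e) = f' e ∨ g (f e) = -f' e := by
  induction E, hE using Set.Finite.induction_on with
  | empty => exact ⟨0, by simp, by simp⟩
  | @insert a s has hs ih =>
  obtain ⟨g, hg, hgs⟩ := ih fun I hI => h I (hI.trans (Set.subset_insert _ _))
  have hsE : s ⊆ insert a s := Set.subset_insert _ _
  have haE : a ∈ insert a s := Set.mem_insert _ _
  have hmap : ∀ X ⊆ s, (span (ZMod 3) (f '' X)).map g = span (ZMod 3) (f' '' X) := by
    intro X hX
    rw [map_span, ← Set.image_comp]
    exact span_image_eq_of_signs fun e he => hgs e (hX he)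
  have hinj : ∀ v ∈ span (ZMod 3) (f '' s), g v = 0 → v = 0 := fun v hv h0 =>
    eq_zero_of_disjoint hg hv h0
  by_cases ha : f a ∈ span (ZMod 3) (f '' s)
  swap
  · have ha' : f' a ∉ span (ZMod 3) (f' '' s) := by
      rwa [← mem_span_iff_of_linearIndepOn_iff h hsE haE]
    obtain ⟨φ, hφ, hφk⟩ := exists_le_ker_of_notMem ha
    -- `φ` vanishes on the old span and not at `f a`, so this rank-one correction moves the image of
    -- `f a` to `f' a` and changes nothing else on the old span.
    let g' : V →ₗ[ZMod 3] V' := g + φ.smulRight ((φ (f a))⁻¹ • (f' a - g (f a)))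
    have hg's : ∀ v ∈ span (ZMod 3) (f '' s), g' v = g v := by
      intro v hv
      have : φ v = 0 := hφk hv
      simp [g', this]
    have hg'a : g' (f a) = f' a := by
      simp only [g', LinearMap.add_apply, LinearMap.smulRight_apply, smul_smul,
        mul_inv_cancel₀ hφ, one_smul]
      abel
    refine ⟨g', ?_, ?_⟩
    · rw [Submodule.disjoint_def]
      intro v hv hv0
      rw [Set.image_insert_eq, span_insert] at hv
      obtain ⟨x, hx, w, hw, rfl⟩ := mem_sup.1 hv
      obtain ⟨c, rfl⟩ := mem_span_singleton.1 hx
      rw [LinearMap.mem_ker, map_add, map_smul, hg'a, hg's w hw] at hv0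
      have hgw : g w ∈ span (ZMod 3) (f' '' s) := by
        rw [← hmap s subset_rfl]; exact mem_map_of_mem hw
      have hc : c = 0 := by
        by_contra hc
        apply ha'
        rw [← Submodule.smul_mem_iff _ hc, eq_neg_of_add_eq_zero_left hv0]
        exact neg_mem hgw
      subst hc
      rw [zero_smul, zero_add] at hv0 ⊢
      exact hinj w hw hv0
    · intro e he
      rcases Set.mem_insert_iff.1 he with rfl | he
      · exact Or.inl hg'a
      · rw [hg's _ (subset_span ⟨e, he, rfl⟩)]; exact hgs e he
  · have ha' : f' a ∈ span (ZMod 3) (f' '' s) := by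
      rwa [← mem_span_iff_of_linearIndepOn_iff h hsE haE]
    have hx : g (f a) ∈ span (ZMod 3) (f' '' s) := by
      rw [← hmap s subset_rfl]; exact mem_map_of_mem ha
    have hiff : ∀ X ⊆ s, g (f a) ∈ span (ZMod 3) (f' '' X) ↔
        f' a ∈ span (ZMod 3) (f' '' X) := by
      intro X hX
      rw [← mem_span_iff_of_linearIndepOn_iff h (hX.trans hsE) haE, ← hmap X hX]
      constructor
      · rintro ⟨w, hw, he⟩
        have hw' : w ∈ span (ZMod 3) (f '' s) := span_mono (Set.image_mono hX) hw
        have := hinj (w - f a) (sub_mem hw' ha) (by rw [map_sub, he, sub_self])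
        rw [← sub_eq_zero.1 this]; exact hw
      · exact fun hw => mem_map_of_mem hw
    -- With x = `g (f a)` and x' = `f' a`, a map is sought that sends x to x' and preserves the old
    -- vectors up to sign. If x + x' lies in `A` and x - x' in `B`, the involution that is 1 on `A`
    -- and -1 on `B` does this.
    obtain ⟨A, B, hAB, hd, hT, hY, hZ⟩ := exists_splitting _ (span (ZMod 3) (f' '' s)) (f' '' s)
      {g (f a) + f' a} {g (f a) - f' a} rfl rfl
      (Set.singleton_subset_iff.2 (add_mem hx ha')) (Set.singleton_subset_iff.2 (sub_mem hx ha'))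
      (by
        rintro T₀ hT₀ hr _ rfl _ rfl
        obtain ⟨X, hX, rfl⟩ := Set.subset_image_iff.1 hT₀
        by_cases hxX : g (f a) ∈ span (ZMod 3) (f' '' X)
        · exact Or.inl (add_mem hxX ((hiff X hX).1 hxX))
        have hle : span (ZMod 3) (f' '' X) ⊔ span (ZMod 3) {g (f a)} ≤
            span (ZMod 3) (f' '' s) :=
          sup_le (span_mono hT₀) ((span_singleton_le_iff_mem _ _).2 hx)
        have heq := eq_of_le_of_finrank_eq hle (by
          rw [finrank_sup_span_singleton_of_notMem hxX, hr])
        rw [← heq] at ha'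
        obtain ⟨w, hw, v, hv, he⟩ := mem_sup.1 ha'
        obtain ⟨c, rfl⟩ := mem_span_singleton.1 hv
        rcases zmod_three_cases c with rfl | rfl | rfl
        · rw [zero_smul, add_zero] at he
          exact absurd ((hiff X hX).2 (he ▸ hw)) hxX
        · right
          rw [one_smul] at he
          rw [← he]
          simpa using neg_mem hw
        · left
          rw [neg_smul, one_smul] at he
          rw [← he]
          simpa using hw)
    obtain ⟨k, hk, hkA, hkB⟩ := exists_involution hd
    refine ⟨k.comp g, ?_, ?_⟩
    · rw [Submodule.disjoint_def]
      intro v hv hv0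
      rw [Set.image_insert_eq, span_insert_eq_span ha] at hv
      rw [LinearMap.mem_ker, LinearMap.comp_apply, map_eq_zero_iff k hk] at hv0
      exact hinj v hv hv0
    · intro e he
      rw [LinearMap.comp_apply]
      rcases Set.mem_insert_iff.1 he with rfl | he
      · left
        have h1 := hkA _ (hY rfl)
        have h2 := hkB _ (hZ rfl)
        rw [map_add] at h1
        rw [map_sub] at h2
        have h3 := three_add_eq_zero (k (g (f e)))
        have h4 := three_add_eq_zero (f' e)
        have h5 : k (g (f e)) + k (g (f e)) = f' e + f' e := by
          have : k (g (f e)) + k (g (f e)) = (k (g (f e)) + k (f' e)) +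
            (k (g (f e)) - k (f' e)) := by abel
          rw [this, h1, h2]; abel
        rw [h5, ← h4] at h3
        exact add_left_cancel h3
      · have hk' : k (f' e) = f' e ∨ k (f' e) = -f' e := by
          rcases hT _ ⟨e, he, rfl⟩ with h | h
          · exact Or.inl (hkA _ h)
          · exact Or.inr (hkB _ h)
        rcases hgs e he with h | h <;> rcases hk' with h' | h' <;> simp [h, h']

end Uniqueness

/-! ### Representations, isomorphisms, sums and cocircuits in terms of vectors. -/

section Representations

set_option linter.unusedSectionVars false

variable {α β V V' : Type*} [AddCommGroup V] [Module (ZMod 3) V] [AddCommGroup V']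
  [Module (ZMod 3) V']

/-- The map `f` represents `M` over the field with three elements. -/
def Rep (M : Matroid α) (f : α → V) : Prop :=
  ∀ I ⊆ M.E, (M.Indep I ↔ LinearIndepOn (ZMod 3) f I)

/-- The vectors that are up to sign values of `f` on `E`. -/
def signedImage (f : α → V) (E : Set α) : Set V :=
  {v | ∃ e ∈ E, v = f e ∨ v = -f e}

theorem neg_mem_signedImage {f : α → V} {E : Set α} {v : V} (h : v ∈ signedImage f E) :
    -v ∈ signedImage f E := by
  obtain ⟨e, he, rfl | rfl⟩ := h
  · exact ⟨e, he, Or.inr rfl⟩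
  · exact ⟨e, he, Or.inl (neg_neg _)⟩

theorem mem_signedImage {f : α → V} {E : Set α} {e : α} (he : e ∈ E) : f e ∈ signedImage f E :=
  ⟨e, he, Or.inl rfl⟩

theorem span_signedImage (f : α → V) (E : Set α) :
    span (ZMod 3) (signedImage f E) = span (ZMod 3) (f '' E) := by
  apply le_antisymm
  · rw [span_le]
    rintro v ⟨e, he, rfl | rfl⟩
    · exact subset_span ⟨e, he, rfl⟩
    · exact neg_mem (subset_span ⟨e, he, rfl⟩)
  · apply span_mono
    rintro _ ⟨e, he, rfl⟩
    exact mem_signedImage he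

theorem linearIndepOn_image_iff_comp {ι : Type*} {f : α → V} {g : ι → α} {s : Set ι}
    (hg : Set.InjOn g s) :
    LinearIndepOn (ZMod 3) f (g '' s) ↔ LinearIndepOn (ZMod 3) (f ∘ g) s :=
  ⟨fun h => h.comp_of_image hg, fun h => h.image_of_comp⟩

theorem Rep.ne_zero {M : Matroid α} {f : α → V} (h : Rep M f) (hM : IsSimple M) {e : α}
    (he : e ∈ M.E) : f e ≠ 0 := by
  have h1 := (h {e, e} (by simp [he])).1 (hM e he e he)
  exact h1.ne_zero (by simp)

theorem Rep.eq_of_signs {M : Matroid α} {f : α → V} (h : Rep M f) (hM : IsSimple M) {e e' : α}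
    (he : e ∈ M.E) (he' : e' ∈ M.E) (hf : f e = f e' ∨ f e = -f e') : e = e' := by
  by_contra hne
  have h1 := (h {e, e'} (by simp [Set.insert_subset_iff, he, he'])).1 (hM e he e' he')
  rw [LinearIndepOn.pair_iff f hne] at h1
  rcases hf with hf | hf
  · have := h1 1 (-1) (by rw [hf]; simp)
    exact one_ne_zero this.1
  · have := h1 1 1 (by rw [hf]; simp)
    exact one_ne_zero this.1

theorem Rep.zero_notMem_signedImage {M : Matroid α} {f : α → V} (h : Rep M f) (hM : IsSimple M) :
    (0 : V) ∉ signedImage f M.E := by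
  rintro ⟨e, he, h0 | h0⟩
  · exact h.ne_zero hM he h0.symm
  · exact h.ne_zero hM he (neg_eq_zero.1 h0.symm)

theorem Iso.symm {M : Matroid α} {N : Matroid β} (h : Iso M N) : Iso N M := by
  obtain ⟨e, he⟩ := h
  refine ⟨e.symm, fun I => ?_⟩
  rw [he]
  congr!
  rw [← Set.image_comp]
  simp

theorem Iso.isSimple {M : Matroid α} {N : Matroid β} (h : Iso M N) (hN : IsSimple N) :
    IsSimple M := by
  obtain ⟨e, he⟩ := h
  intro x hx y hy
  have h1 := he {⟨x, hx⟩, ⟨y, hy⟩}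
  simp only [Set.image_insert_eq, Set.image_singleton] at h1
  exact h1.2 (hN _ (e ⟨x, hx⟩).2 _ (e ⟨y, hy⟩).2)

/-- An isomorphism allows a representation of `N` to be pulled back without changing its set of
vectors. Elements outside the ground set get the arbitrary value 0. -/
theorem Iso.exists_rep {M : Matroid α} {N : Matroid β} (h : Iso M N) {f : β → V} (hf : Rep N f) :
    ∃ f' : α → V, Rep M f' ∧ signedImage f' M.E = signedImage f N.E := by
  classical
  obtain ⟨e, he⟩ := h
  let f' : α → V := fun a => if h : a ∈ M.E then f (e ⟨a, h⟩) else 0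
  have hf' : ∀ a : M.E, f' a = f (e a) := fun a => by simp [f']
  refine ⟨f', ?_, ?_⟩
  · intro I hI
    obtain ⟨J, rfl⟩ : ∃ J : Set M.E, Subtype.val '' J = I :=
      ⟨Subtype.val ⁻¹' I, by rw [Subtype.image_preimage_coe]; exact Set.inter_eq_right.2 hI⟩
    rw [he, hf _ (by rintro _ ⟨x, -, rfl⟩; exact x.2),
      linearIndepOn_image_iff_comp Subtype.val_injective.injOn,
      linearIndepOn_image_iff_comp Subtype.val_injective.injOn,
      linearIndepOn_image_iff_comp e.injective.injOn]
    congr!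
    funext a
    exact (hf' a).symm
  · ext v
    constructor
    · rintro ⟨a, ha, hv⟩
      rw [hf' ⟨a, ha⟩] at hv
      exact ⟨_, (e ⟨a, ha⟩).2, hv⟩
    · rintro ⟨b, hb, hv⟩
      refine ⟨_, (e.symm ⟨b, hb⟩).2, ?_⟩
      rw [hf']
      simpa using hv

/-- In a simple matroid distinct elements are represented by vectors that are not equal up to sign,
so the set of signed vectors determines the matroid up to isomorphism. -/
theorem iso_of_rep {M : Matroid α} {N : Matroid β} {f : α → V} {f' : β → V'} (hf : Rep M f)
    (hf' : Rep N f') (hM : IsSimple M) (hN : IsSimple N) (g : V →ₗ[ZMod 3] V')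
    (hg : Function.Injective g) (hs : g '' signedImage f M.E = signedImage f' N.E) :
    Iso M N := by
  have h1 : ∀ a : M.E, ∃ b : N.E, g (f a) = f' b ∨ g (f a) = -f' b := by
    intro a
    have : g (f a) ∈ signedImage f' N.E := hs ▸ ⟨_, mem_signedImage a.2, rfl⟩
    obtain ⟨b, hb, h⟩ := this
    exact ⟨⟨b, hb⟩, h⟩
  choose φ hφ using h1
  have hinj : Function.Injective φ := by
    intro a b hab
    have h1 := hφ a
    have h2 := hφ b
    rw [hab] at h1
    apply Subtype.ext
    apply hf.eq_of_signs hM a.2 b.2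
    rw [← hg.eq_iff, ← hg.eq_iff (b := -f b), map_neg]
    rcases h1 with h1 | h1 <;> rcases h2 with h2 | h2 <;> simp [h1, h2]
  have hsurj : Function.Surjective φ := by
    intro b
    have : f' b ∈ g '' signedImage f M.E := hs ▸ mem_signedImage b.2
    obtain ⟨_, ⟨a, ha, h⟩, hv⟩ := this
    refine ⟨⟨a, ha⟩, ?_⟩
    have h1 := hφ ⟨a, ha⟩
    apply Subtype.ext
    apply hf'.eq_of_signs hN (φ _).2 b.2
    rw [← hv]
    rcases h with rfl | rfl <;> rcases h1 with h1 | h1 <;> simp [h1]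
  refine ⟨Equiv.ofBijective φ ⟨hinj, hsurj⟩, fun I => ?_⟩
  rw [hf _ (by rintro _ ⟨x, -, rfl⟩; exact x.2), hf' _ (by rintro _ ⟨x, -, rfl⟩; exact x.2),
      linearIndepOn_image_iff_comp Subtype.val_injective.injOn,
      linearIndepOn_image_iff_comp Subtype.val_injective.injOn,
      linearIndepOn_image_iff_comp (Equiv.injective _).injOn,
      ← LinearMap.linearIndepOn_iff_of_injOn g hg.injOn]
  exact linearIndepOn_iff_of_signs fun a _ => hφ a

theorem Rep.restrict {M : Matroid α} {f : α → V} (h : Rep M f) {X : Set α} (hX : X ⊆ M.E) :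
    Rep (M ↾ X) f := by
  intro I hI
  rw [Matroid.restrict_ground_eq] at hI
  rw [Matroid.restrict_indep_iff, h I (hI.trans hX)]
  exact ⟨fun h => h.1, fun h => ⟨h, hI⟩⟩

theorem isSimple_restrict {M : Matroid α} (h : IsSimple M) {X : Set α} (hX : X ⊆ M.E) :
    IsSimple (M ↾ X) := by
  intro e he e' he'
  rw [Matroid.restrict_ground_eq] at he he'
  rw [Matroid.restrict_indep_iff]
  exact ⟨h e (hX he) e' (hX he'), Set.insert_subset he (Set.singleton_subset_iff.2 he')⟩

theorem exists_basis_subset (f : α → V) (X : Set α) : ∃ I ⊆ X, LinearIndepOn (ZMod 3) f I ∧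
    span (ZMod 3) (f '' I) = span (ZMod 3) (f '' X) := by
  obtain ⟨I, hIX, -, hI, hli⟩ := exists_linearIndepOn_extension
    (linearIndepOn_empty (ZMod 3) f) (Set.empty_subset X)
  exact ⟨I, hIX, hli, le_antisymm (span_mono (Set.image_mono hIX)) (span_le.2 hI)⟩

theorem signedImage_sumElim (f : α → V) (f' : β → V) (E : Set α) (E' : Set β) :
    signedImage (Sum.elim f f') (Sum.inl '' E ∪ Sum.inr '' E') =
      signedImage f E ∪ signedImage f' E' := by
  ext v
  constructor
  · rintro ⟨_, ⟨e, he, rfl⟩ | ⟨e, he, rfl⟩, h⟩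
    · exact Or.inl ⟨e, he, h⟩
    · exact Or.inr ⟨e, he, h⟩
  · rintro (⟨e, he, h⟩ | ⟨e, he, h⟩)
    · exact ⟨Sum.inl e, Or.inl ⟨e, he, rfl⟩, h⟩
    · exact ⟨Sum.inr e, Or.inr ⟨e, he, rfl⟩, h⟩

theorem rep_sum {M : Matroid α} {N : Matroid β} {f : α → V} {f' : β → V} (hf : Rep M f)
    (hf' : Rep N f')
    (hd : Disjoint (span (ZMod 3) (f '' M.E)) (span (ZMod 3) (f' '' N.E))) :
    Rep (M.sum N) (Sum.elim f f') := by
  intro I hI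
  rw [Matroid.sum_ground] at hI
  have hl : Sum.inl ⁻¹' I ⊆ M.E := by
    intro a ha
    rcases hI ha with ⟨x, hx, hxa⟩ | ⟨x, hx, hxa⟩
    · rwa [← Sum.inl.inj hxa]
    · cases hxa
  have hr : Sum.inr ⁻¹' I ⊆ N.E := by
    intro a ha
    rcases hI ha with ⟨x, hx, hxa⟩ | ⟨x, hx, hxa⟩
    · cases hxa
    · rwa [← Sum.inr.inj hxa]
  have hl' : LinearIndepOn (ZMod 3) f (Sum.inl ⁻¹' I) ↔
      LinearIndepOn (ZMod 3) (Sum.elim f f') (Sum.inl '' (Sum.inl ⁻¹' I)) := by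
    rw [linearIndepOn_image_iff_comp Sum.inl_injective.injOn, Sum.elim_comp_inl]
  have hr' : LinearIndepOn (ZMod 3) f' (Sum.inr ⁻¹' I) ↔
      LinearIndepOn (ZMod 3) (Sum.elim f f') (Sum.inr '' (Sum.inr ⁻¹' I)) := by
    rw [linearIndepOn_image_iff_comp Sum.inr_injective.injOn, Sum.elim_comp_inr]
  have hI' : I = Sum.inl '' (Sum.inl ⁻¹' I) ∪ Sum.inr '' (Sum.inr ⁻¹' I) :=
    (Set.image_preimage_inl_union_image_preimage_inr I).symm
  rw [Matroid.sum_indep_iff, hf _ hl, hf' _ hr, hl', hr']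
  constructor
  · rintro ⟨h1, h2⟩
    rw [hI']
    refine h1.union h2 ?_
    rw [← Set.image_comp, ← Set.image_comp, Sum.elim_comp_inl, Sum.elim_comp_inr]
    exact hd.mono (span_mono (Set.image_mono hl)) (span_mono (Set.image_mono hr))
  · intro h
    exact ⟨h.mono (Set.image_preimage_subset _ _), h.mono (Set.image_preimage_subset _ _)⟩

theorem isSimple_sum {M : Matroid α} {N : Matroid β} (hM : IsSimple M) (hN : IsSimple N) :
    IsSimple (M.sum N) := by
  rintro _ he _ he'
  rw [Matroid.sum_ground] at he he'
  rw [Matroid.sum_indep_iff]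
  rcases he with ⟨x, hx, rfl⟩ | ⟨x, hx, rfl⟩ <;> rcases he' with ⟨y, hy, rfl⟩ | ⟨y, hy, rfl⟩
  · have h1 : Sum.inl ⁻¹' ({Sum.inl x, Sum.inl y} : Set (α ⊕ β)) = {x, y} := by ext; simp
    have h2 : Sum.inr ⁻¹' ({Sum.inl x, Sum.inl y} : Set (α ⊕ β)) = ∅ := by ext; simp
    rw [h1, h2]
    exact ⟨hM x hx y hy, N.empty_indep⟩
  · have h1 : Sum.inl ⁻¹' ({Sum.inl x, Sum.inr y} : Set (α ⊕ β)) = {x} := by ext; simp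
    have h2 : Sum.inr ⁻¹' ({Sum.inl x, Sum.inr y} : Set (α ⊕ β)) = {y} := by ext; simp
    rw [h1, h2]
    exact ⟨by simpa using hM x hx x hx, by simpa using hN y hy y hy⟩
  · have h1 : Sum.inl ⁻¹' ({Sum.inr x, Sum.inl y} : Set (α ⊕ β)) = {y} := by ext; simp
    have h2 : Sum.inr ⁻¹' ({Sum.inr x, Sum.inl y} : Set (α ⊕ β)) = {x} := by ext; simp
    rw [h1, h2]
    exact ⟨by simpa using hM y hy y hy, by simpa using hN x hx x hx⟩
  · have h1 : Sum.inl ⁻¹' ({Sum.inr x, Sum.inr y} : Set (α ⊕ β)) = ∅ := by ext; simp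
    have h2 : Sum.inr ⁻¹' ({Sum.inr x, Sum.inr y} : Set (α ⊕ β)) = {x, y} := by ext; simp
    rw [h1, h2]
    exact ⟨M.empty_indep, hN x hx y hy⟩

/-- Bases of the two summands together are independent in the sum, which forces the two spans to be
disjoint. -/
theorem Rep.of_sum {M : Matroid α} {N : Matroid β} {f : α ⊕ β → V} (hf : Rep (M.sum N) f) :
    Rep M (f ∘ Sum.inl) ∧ Rep N (f ∘ Sum.inr) ∧
      Disjoint (span (ZMod 3) (f ∘ Sum.inl '' M.E)) (span (ZMod 3) (f ∘ Sum.inr '' N.E)) := by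
  have hpre1 : ∀ I : Set α, Sum.inl ⁻¹' (Sum.inl '' I : Set (α ⊕ β)) = I := fun I =>
    Set.preimage_image_eq _ Sum.inl_injective
  have hpre2 : ∀ I : Set β, Sum.inr ⁻¹' (Sum.inr '' I : Set (α ⊕ β)) = I := fun I =>
    Set.preimage_image_eq _ Sum.inr_injective
  have h1 : Rep M (f ∘ Sum.inl) := by
    intro I hI
    rw [← linearIndepOn_image_iff_comp Sum.inl_injective.injOn, ← hf, Matroid.sum_indep_iff, hpre1,
      Set.preimage_inr_image_inl]
    · exact ⟨fun h => ⟨h, N.empty_indep⟩, fun h => h.1⟩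
    · rw [Matroid.sum_ground]
      exact (Set.image_mono hI).trans Set.subset_union_left
  have h2 : Rep N (f ∘ Sum.inr) := by
    intro I hI
    rw [← linearIndepOn_image_iff_comp Sum.inr_injective.injOn, ← hf, Matroid.sum_indep_iff, hpre2,
      Set.preimage_inl_image_inr]
    · exact ⟨fun h => ⟨M.empty_indep, h⟩, fun h => h.2⟩
    · rw [Matroid.sum_ground]
      exact (Set.image_mono hI).trans Set.subset_union_right
  refine ⟨h1, h2, ?_⟩
  obtain ⟨I, hI, hIl, hIs⟩ := exists_basis_subset (f ∘ Sum.inl) M.E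
  obtain ⟨J, hJ, hJl, hJs⟩ := exists_basis_subset (f ∘ Sum.inr) N.E
  rw [← hIs, ← hJs, Set.image_comp, Set.image_comp]
  have h3 : LinearIndepOn (ZMod 3) f (Sum.inl '' I ∪ Sum.inr '' J) := by
    rw [← hf, Matroid.sum_indep_iff, Set.preimage_union, Set.preimage_union, hpre1, hpre2,
      Set.preimage_inr_image_inl, Set.preimage_inl_image_inr, Set.union_empty, Set.empty_union]
    · exact ⟨(h1 I hI).2 hIl, (h2 J hJ).2 hJl⟩
    · rw [Matroid.sum_ground]
      exact Set.union_subset_union (Set.image_mono hI) (Set.image_mono hJ)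
  refine ((linearIndepOn_union_iff ?_).1 h3).2.2
  rw [Set.disjoint_left]
  rintro _ ⟨x, -, rfl⟩ ⟨y, -, h⟩
  cases h

theorem Rep.spanning_iff {M : Matroid α} {f : α → V} (h : Rep M f) {X : Set α} (hX : X ⊆ M.E) :
    M.Spanning X ↔ ∀ e ∈ M.E, f e ∈ span (ZMod 3) (f '' X) := by
  rw [Matroid.spanning_iff_exists_isBase_subset hX]
  constructor
  · rintro ⟨B, hB, hBX⟩ e he
    refine span_mono (Set.image_mono hBX) ?_
    by_cases heB : e ∈ B
    · exact subset_span ⟨e, heB, rfl⟩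
    by_contra hcon
    refine heB (hB.mem_of_insert_indep ?_)
    rw [h _ (Set.insert_subset he hB.subset_ground), linearIndepOn_insert heB,
      ← h _ hB.subset_ground]
    exact ⟨hB.indep, hcon⟩
  · intro hs
    obtain ⟨I, hIX, hI, hIs⟩ := exists_basis_subset f X
    refine ⟨I, ((h I (hIX.trans hX)).2 hI).isBase_of_maximal fun J hJ hIJ => ?_, hIX⟩
    refine hIJ.antisymm fun e he => ?_
    by_contra heI
    have h1 := hJ.subset (Set.insert_subset he hIJ)
    rw [h _ h1.subset_ground, linearIndepOn_insert heI, hIs] at h1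
    exact h1.2 (hs e (hJ.subset_ground he))

theorem Rep.isFlat {M : Matroid α} {f : α → V} (h : Rep M f) (U : Submodule (ZMod 3) V) :
    M.IsFlat {e ∈ M.E | f e ∈ U} := by
  refine ⟨fun I X hI hX x hx => ⟨hX.subset_ground hx, ?_⟩, fun e he => he.1⟩
  by_cases hxI : x ∈ I
  · exact (hI.subset hxI).2
  have h1 : span (ZMod 3) (f '' I) ≤ U := by
    rw [span_le]
    rintro _ ⟨a, ha, rfl⟩
    exact (hI.subset ha).2
  by_contra hcon
  refine hxI (hX.mem_of_insert_indep hx ?_)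
  rw [h _ (Set.insert_subset (hX.subset_ground hx) hX.indep.subset_ground),
    linearIndepOn_insert hxI, ← h _ hX.indep.subset_ground]
  exact ⟨hX.indep, fun h2 => hcon (h1 h2)⟩

/-- The cocircuits are the minimal sets with nonspanning complement. Removing fewer elements leaves
some vector outside `H` besides a spanning set of `H`, hence a spanning set of the coatom's proper
superspace, which is everything. -/
theorem Rep.isCocircuit {M : Matroid α} {f : α → V} (h : Rep M f) {H : Submodule (ZMod 3) V}
    (hH : IsCoatom H) (hf : span (ZMod 3) (f '' M.E) = ⊤)
    (hs : span (ZMod 3) (f '' {e ∈ M.E | f e ∈ H}) = H) :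
    M.IsCocircuit {e ∈ M.E | f e ∉ H} := by
  rw [Matroid.isCocircuit_iff_minimal_compl_nonspanning']
  have hcompl : M.E \ {e ∈ M.E | f e ∉ H} = {e ∈ M.E | f e ∈ H} := by
    ext e
    simp only [Set.mem_sdiff, Set.mem_ofPred_eq, not_and, not_not]
    exact ⟨fun h => ⟨h.1, h.2 h.1⟩, fun h => ⟨h.1, fun _ => h.2⟩⟩
  refine ⟨⟨?_, fun e he => he.1⟩, ?_⟩
  · rw [hcompl, h.spanning_iff (fun e he => he.1), hs]
    intro hall
    apply hH.1
    rw [eq_top_iff, ← hf, span_le]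
    rintro _ ⟨e, he, rfl⟩
    exact hall e he
  · rintro X ⟨hX, hXE⟩ hXC e he
    by_contra heX
    apply hX
    rw [h.spanning_iff Set.sdiff_subset]
    have h1 : span (ZMod 3) (f '' (M.E \ X)) = ⊤ := by
      apply hH.2
      refine lt_of_le_of_ne ?_ ?_
      · conv_lhs => rw [← hs]
        apply span_mono
        apply Set.image_mono
        rw [← hcompl]
        exact Set.sdiff_subset_sdiff_right hXC
      · intro h2
        apply he.2
        rw [h2]
        exact subset_span ⟨e, ⟨he.1, heX⟩, rfl⟩
    intro x _
    rw [h1]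
    trivial

theorem rep_projGeom_restrict {k : ℕ} (T : Set (ℙ (ZMod 3) (Fin k → ZMod 3))) :
    Rep (projGeom (ZMod 3) k ↾ T) Projectivization.rep := by
  intro I hI
  rw [Matroid.restrict_ground_eq] at hI
  rw [Matroid.restrict_indep_iff]
  exact ⟨fun h => h.1, fun h => ⟨h, hI⟩⟩

theorem isSimple_projGeom_restrict {k : ℕ} (T : Set (ℙ (ZMod 3) (Fin k → ZMod 3))) :
    IsSimple (projGeom (ZMod 3) k ↾ T) := by
  intro e he e' he'
  rw [rep_projGeom_restrict T _ (Set.insert_subset he (Set.singleton_subset_iff.2 he'))]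
  by_cases hne : e = e'
  · subst hne
    rw [Set.pair_eq_singleton]
    exact LinearIndepOn.singleton (Projectivization.rep_nonzero e)
  · rw [linearIndepOn_pair_iff _ hne (Projectivization.rep_nonzero e)]
    intro c hc
    apply hne
    rw [← Projectivization.mk_rep e, ← Projectivization.mk_rep e', eq_comm,
      Projectivization.mk_eq_mk_iff']
    exact ⟨c, hc⟩

theorem signedImage_rep_iff {k : ℕ} (T : Set (ℙ (ZMod 3) (Fin k → ZMod 3)))
    {v : Fin k → ZMod 3} (hv : v ≠ 0) :
    v ∈ signedImage Projectivization.rep T ↔ Projectivization.mk (ZMod 3) v hv ∈ T := by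
  constructor
  · rintro ⟨e, he, h⟩
    convert! he
    conv_rhs => rw [← Projectivization.mk_rep e]
    rw [Projectivization.mk_eq_mk_iff']
    rcases h with rfl | rfl
    · exact ⟨1, one_smul _ _⟩
    · exact ⟨-1, by rw [neg_smul, one_smul]⟩
  · intro h
    obtain ⟨a, ha⟩ := Projectivization.exists_smul_eq_mk_rep (ZMod 3) v hv
    refine ⟨_, h, ?_⟩
    rw [← ha, Units.smul_def]
    rcases smul_eq_or_eq_neg a.ne_zero v with h | h <;> rw [h] <;> simp

theorem mem_signedImage_rep_compl_iff {k : ℕ} (T : Set (ℙ (ZMod 3) (Fin k → ZMod 3)))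
    {v : Fin k → ZMod 3} (hv : v ≠ 0) :
    v ∈ signedImage Projectivization.rep Tᶜ ↔ v ∉ signedImage Projectivization.rep T := by
  rw [signedImage_rep_iff _ hv, signedImage_rep_iff _ hv, Set.mem_compl_iff]

end Representations

/-! ### Ternary comatroids are separated in some colour in every subspace of dimension at least two.
-/

section Comatroids

/-- The nonzero vectors outside `S`. -/
def opposite {V : Type*} [Zero V] (S : Set V) : Set V :=
  {v | v ≠ 0 ∧ v ∉ S}

section

variable {K V V' : Type*} [Field K] [AddCommGroup V] [Module K V] [AddCommGroup V'] [Module K V']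

theorem exists_compl_in {A U : Submodule K V} (h : A ≤ U) :
    ∃ B, A ⊔ B = U ∧ Disjoint A B := by
  obtain ⟨q, hq⟩ := A.exists_isCompl
  exact ⟨q ⊓ U, by rw [← sup_inf_assoc_of_le q h, hq.sup_eq_top, top_inf_eq],
    hq.disjoint.mono_right inf_le_left⟩

/-- The subspaces need not fill `U`: a complement of `A ⊔ B` in `U` is absorbed into `B`. -/
theorem sep_of_disjoint {S : Set V} {A B U : Submodule K V} (hA : A ≠ ⊥) (hB : B ≠ ⊥)
    (hAU : A ≤ U) (hBU : B ≤ U) (hd : Disjoint A B) (hS : ∀ v ∈ S, v ∈ U → v ∈ A ∨ v ∈ B) :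
    Sep K S U := by
  obtain ⟨C, hC, hCd⟩ := exists_compl_in (sup_le hAU hBU)
  refine ⟨A, B ⊔ C, hA, fun h => hB (sup_eq_bot_iff.1 h).1, by rw [← sup_assoc, hC],
    hd.disjoint_sup_right_of_disjoint_sup_left hCd, fun v hv hvU => ?_⟩
  exact (hS v hv hvU).imp_right fun h => mem_sup_left h

/-- A complement of `P` serves as the second part. If `P` is zero, any line and a complement of it
work, and this is why dimension two is required. -/
theorem sep_of_subset_proper [FiniteDimensional K V] {S : Set V} {P U : Submodule K V}
    (hU : 2 ≤ finrank K U) (hP : P < U) (hS : ∀ v ∈ S, v ∈ U → v ∈ P) : Sep K S U := by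
  by_cases hP0 : P = ⊥
  · subst hP0
    obtain ⟨u, huU, hu⟩ := SetLike.exists_of_lt hP
    have hu0 : u ≠ 0 := by simpa using hu
    have hle : span K {u} ≤ U := (span_singleton_le_iff_mem _ _).2 huU
    obtain ⟨B, hB, hd⟩ := exists_compl_in hle
    refine sep_of_disjoint (A := span K {u}) (B := B) ?_ ?_ hle (hB ▸ le_sup_right) hd ?_
    · simpa using hu0
    · rintro rfl
      rw [sup_bot_eq] at hB
      rw [← hB, finrank_span_singleton hu0] at hU
      omega
    · intro v hv hvU
      have := hS v hv hvU
      left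
      rw [(mem_bot K).1 this]
      exact zero_mem _
  · obtain ⟨B, hB, hd⟩ := exists_compl_in hP.le
    refine sep_of_disjoint (A := P) (B := B) hP0 ?_ hP.le (hB ▸ le_sup_right) hd
      fun v hv hvU => Or.inl (hS v hv hvU)
    rintro rfl
    rw [sup_bot_eq] at hB
    exact hP.ne hB

theorem span_inter_eq_of_not_sep [FiniteDimensional K V] {S : Set V} {U : Submodule K V}
    (hU : 2 ≤ finrank K U) (h : ¬ Sep K S U) : span K (S ∩ U) = U := by
  by_contra hne
  exact h (sep_of_subset_proper hU (lt_of_le_of_ne (span_le.2 Set.inter_subset_right) hne)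
    fun v hv hvU => subset_span ⟨hv, hvU⟩)

theorem Sep.map {S : Set V} {S' : Set V'} {U : Submodule K V} (h : Sep K S U) (g : V →ₗ[K] V')
    (hg : Disjoint U (LinearMap.ker g)) (hS : ∀ u ∈ U, u ≠ 0 → g u ∈ S' → u ∈ S) :
    Sep K S' (U.map g) := by
  have hinj : ∀ v ∈ U, g v = 0 → v = 0 := fun v hv h0 => eq_zero_of_disjoint hg hv h0
  obtain ⟨A, B, hA, hB, rfl, hd, hAB⟩ := h
  have hne : ∀ P ≤ A ⊔ B, P ≠ ⊥ → P.map g ≠ ⊥ := by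
    intro P hP hP0 h
    apply hP0
    rw [eq_bot_iff]
    intro v hv
    exact (mem_bot K).2 (hinj v (hP hv) ((mem_bot K).1 (h ▸ mem_map_of_mem hv)))
  refine ⟨A.map g, B.map g, hne A le_sup_left hA, hne B le_sup_right hB, (map_sup A B g).symm,
    ?_, ?_⟩
  · rw [Submodule.disjoint_def]
    rintro _ ⟨a, ha, rfl⟩ ⟨b, hb, hab⟩
    have h1 := hinj (b - a) (sub_mem (mem_sup_right hb) (mem_sup_left ha))
      (by rw [map_sub, hab, sub_self])
    rw [eq_zero_of_disjoint hd ha (sub_eq_zero.1 h1 ▸ hb), map_zero]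
  · rintro _ hv ⟨u, hu, rfl⟩
    by_cases hu0 : u = 0
    · left
      rw [hu0, map_zero]
      exact zero_mem _
    rcases hAB u (hS u hu hu0 hv) hu with h | h
    · exact Or.inl (mem_map_of_mem h)
    · exact Or.inr (mem_map_of_mem h)

end

/-- In each subspace of dimension at least two `S` or the opposite set is separated. -/
def SepClosed {V : Type*} [AddCommGroup V] [Module (ZMod 3) V] (S : Set V) : Prop :=
  ∀ U : Submodule (ZMod 3) V, 2 ≤ finrank (ZMod 3) U →
    Sep (ZMod 3) S U ∨ Sep (ZMod 3) (opposite S) U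

theorem iso_finite_ground {α β : Type*} {M : Matroid α} {N : Matroid β} (h : Iso M N)
    (hN : N.E.Finite) : M.E.Finite := by
  obtain ⟨e, -⟩ := h
  have := hN.to_subtype
  have : Finite M.E := Finite.of_equiv _ e.symm
  exact Set.toFinite _

/-- If both sets meet `U` in nonzero vectors, their traces span disjoint nonzero subspaces that
separate the union. If one trace is trivial, both colours look in `U` as they do for the other set
alone. -/
theorem sepClosed_union {V : Type*} [AddCommGroup V] [Module (ZMod 3) V] {S₁ S₂ : Set V}
    (hd : Disjoint (span (ZMod 3) S₁) (span (ZMod 3) S₂)) (h₁ : SepClosed S₁)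
    (h₂ : SepClosed S₂) : SepClosed (S₁ ∪ S₂) := by
  intro U hU
  by_cases h1 : ∀ v ∈ S₁, v ∈ U → v = 0
  · refine (h₂ U hU).imp (fun h => h.congr ?_) (fun h => h.congr ?_)
    · rintro v hvU hv0 (hv | hv)
      · exact absurd (h1 v hv hvU) hv0
      · exact hv
    · exact fun v hvU hv0 hv => ⟨hv0, fun h => hv.2 (Or.inr h)⟩
  by_cases h2 : ∀ v ∈ S₂, v ∈ U → v = 0
  · refine (h₁ U hU).imp (fun h => h.congr ?_) (fun h => h.congr ?_)
    · rintro v hvU hv0 (hv | hv)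
      · exact hv
      · exact absurd (h2 v hv hvU) hv0
    · exact fun v hvU hv0 hv => ⟨hv0, fun h => hv.2 (Or.inl h)⟩
  push Not at h1 h2
  obtain ⟨v₁, hv₁, hvU₁, hne₁⟩ := h1
  obtain ⟨v₂, hv₂, hvU₂, hne₂⟩ := h2
  left
  refine sep_of_disjoint (A := span (ZMod 3) (S₁ ∩ U)) (B := span (ZMod 3) (S₂ ∩ U)) ?_ ?_
    (span_le.2 Set.inter_subset_right) (span_le.2 Set.inter_subset_right)
    (hd.mono (span_mono Set.inter_subset_left) (span_mono Set.inter_subset_left)) ?_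
  · intro h
    exact hne₁ ((mem_bot (ZMod 3)).1 (h ▸ subset_span ⟨hv₁, hvU₁⟩))
  · intro h
    exact hne₂ ((mem_bot (ZMod 3)).1 (h ▸ subset_span ⟨hv₂, hvU₂⟩))
  · rintro v (hv | hv) hvU
    · exact Or.inl (subset_span ⟨hv, hvU⟩)
    · exact Or.inr (subset_span ⟨hv, hvU⟩)

/-- The property to be separated in some colour passes to the opposite colour class, also when this
class is represented in another space. -/
theorem sepClosed_of_opposite {V V' β : Type*} [AddCommGroup V] [Module (ZMod 3) V]
    [AddCommGroup V'] [Module (ZMod 3) V'] [FiniteDimensional (ZMod 3) V]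
    [FiniteDimensional (ZMod 3) V'] {S : Set V} (hS : SepClosed S) {f : β → V} {f' : β → V'}
    {E : Set β} (hE : E.Finite)
    (h : ∀ I ⊆ E, LinearIndepOn (ZMod 3) f I ↔ LinearIndepOn (ZMod 3) f' I)
    (hf : signedImage f E = opposite S) : SepClosed (signedImage f' E) := by
  obtain ⟨g, hg, hgE⟩ := exists_linearMap_of_linearIndepOn_iff hE h
  intro U hU
  by_cases hsp : Sep (ZMod 3) (signedImage f' E) U
  · exact Or.inl hsp
  -- An unseparated `U` is spanned by represented vectors, so it lies in the image of `g` and lifts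
  -- to a subspace of the original space on which `g` is injective. The separation of `S` or of its
  -- opposite there is carried over to `U`.
  have hUspan := span_inter_eq_of_not_sep hU hsp
  have hmap : (span (ZMod 3) (f '' E)).map g = span (ZMod 3) (f' '' E) := by
    rw [map_span, ← Set.image_comp]
    exact span_image_eq_of_signs hgE
  have hU₀ : (span (ZMod 3) (f '' E) ⊓ U.comap g).map g = U := by
    apply le_antisymm
    · rintro _ ⟨u, hu, rfl⟩
      exact hu.2
    · intro u hu
      have : u ∈ (span (ZMod 3) (f '' E)).map g := by
        rw [hmap, ← span_signedImage]
        rw [← hUspan] at hu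
        exact span_mono Set.inter_subset_left hu
      obtain ⟨w, hw, rfl⟩ := this
      exact ⟨w, ⟨hw, hu⟩, rfl⟩
  have hd : Disjoint (span (ZMod 3) (f '' E) ⊓ U.comap g) (LinearMap.ker g) :=
    hg.mono_left inf_le_left
  have hrank : 2 ≤ finrank (ZMod 3) ↥(span (ZMod 3) (f '' E) ⊓ U.comap g) := by
    refine hU.trans ?_
    conv_lhs => rw [← hU₀]
    exact finrank_map_le _ _
  rw [← hU₀]
  rcases hS _ hrank with h1 | h1
  · right
    refine h1.map g hd fun u hu hu0 hgu => ?_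
    by_contra huS
    apply hgu.2
    have : u ∈ signedImage f E := hf ▸ ⟨hu0, huS⟩
    obtain ⟨e, he, h2⟩ := this
    refine ⟨e, he, ?_⟩
    rcases h2 with rfl | rfl <;> rcases hgE e he with h3 | h3 <;> simp [h3]
  · left
    refine h1.map g hd fun u hu hu0 hgu => ?_
    rw [← hf]
    obtain ⟨e, he, h2⟩ := hgu
    have hfe : f e ∈ span (ZMod 3) (f '' E) := subset_span ⟨e, he, rfl⟩
    have h4 : g u = g (f e) ∨ g u = g (-f e) := by
      rw [map_neg]
      rcases hgE e he with h3 | h3 <;> rcases h2 with h2 | h2 <;> simp [h2, h3]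
    refine ⟨e, he, h4.imp (fun h => ?_) (fun h => ?_)⟩
    · exact sub_eq_zero.1 (eq_zero_of_disjoint hg (sub_mem hu.1 hfe)
        (by rw [LinearMap.mem_ker, map_sub, h, sub_self]))
    · exact sub_eq_zero.1 (eq_zero_of_disjoint hg (sub_mem hu.1 (neg_mem hfe))
        (by rw [LinearMap.mem_ker, map_sub, h, sub_self]))

theorem signedImage_rep_compl {k : ℕ} (T : Set (ℙ (ZMod 3) (Fin k → ZMod 3))) :
    signedImage Projectivization.rep Tᶜ = opposite (signedImage Projectivization.rep T) := by
  ext v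
  by_cases hv : v = 0
  · subst hv
    refine iff_of_false ?_ fun h => h.1 rfl
    exact (rep_projGeom_restrict Tᶜ).zero_notMem_signedImage (isSimple_projGeom_restrict Tᶜ)
  · rw [mem_signedImage_rep_compl_iff T hv]
    exact ⟨fun h => ⟨hv, h⟩, fun h => h.2⟩

/-- In each subspace of dimension at least two, a represented ternary comatroid or its complement
is separated. -/
theorem IsComatroid.sepClosed {α : Type u} {M : Matroid α} (hM : IsComatroid (ZMod 3) M) :
    ∀ {V : Type} [AddCommGroup V] [Module (ZMod 3) V] [FiniteDimensional (ZMod 3) V] (f : α → V),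
      Rep M f → SepClosed (signedImage f M.E) := by
  induction hM with
  | empty M hM =>
    intro V _ _ _ f hf U hU
    left
    refine sep_of_subset_proper (P := ⊥) hU (bot_lt_iff_ne_bot.2 ?_) ?_
    · rintro rfl
      rw [finrank_bot] at hU
      omega
    · rintro v ⟨e, he, -⟩
      rw [hM] at he
      exact absurd he (Set.notMem_empty e)
  | sum M₁ M₂ N h₁ h₂ hN ih₁ ih₂ =>
    intro V _ _ _ f hf
    obtain ⟨f', hf', hs⟩ := hN.exists_rep hf
    obtain ⟨hr₁, hr₂, hd⟩ := hf'.of_sum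
    rw [← hs, Matroid.sum_ground, ← Sum.elim_comp_inl_inr f', signedImage_sumElim]
    refine sepClosed_union ?_ (ih₁ _ hr₁) (ih₂ _ hr₂)
    rwa [span_signedImage, span_signedImage]
  | compl M N t hM ht hN ih =>
    intro V _ _ _ f hf
    obtain ⟨T, hMT, hNT⟩ := hN
    obtain ⟨f₁, hf₁, hs₁⟩ := hMT.exists_rep (rep_projGeom_restrict T)
    obtain ⟨f₂, hf₂, hs₂⟩ := hNT.exists_rep (rep_projGeom_restrict Tᶜ)
    have h1 := ih f₁ hf₁
    rw [hs₁] at h1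
    refine sepClosed_of_opposite h1 (iso_finite_ground hNT (Set.toFinite _))
      (fun I hI => (hf₂ I hI).symm.trans (hf I hI)) ?_
    rw [hs₂, Matroid.restrict_ground_eq, Matroid.restrict_ground_eq, signedImage_rep_compl]

end Comatroids

/-! ### Consequences of minimality: separated hyperplanes, unseparated whole space, and cocircuits
as vector sets. -/

section Minimal

set_option linter.unusedSectionVars false

variable {α V V' : Type*} [AddCommGroup V] [Module (ZMod 3) V] [AddCommGroup V']
  [Module (ZMod 3) V']

theorem Iso.refl (M : Matroid α) : Iso M M :=
  ⟨Equiv.refl _, fun I => by simp⟩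

theorem Rep.map {M : Matroid α} {f : α → V} (h : Rep M f) (g : V →ₗ[ZMod 3] V')
    (hg : Function.Injective g) : Rep M (g ∘ f) := fun I hI => by
  rw [h I hI, LinearMap.linearIndepOn_iff_of_injOn g hg.injOn]

theorem signedImage_map (f : α → V) (g : V →ₗ[ZMod 3] V') (E : Set α) :
    signedImage (g ∘ f) E = g '' signedImage f E := by
  ext v
  constructor
  · rintro ⟨e, he, rfl | rfl⟩
    · exact ⟨_, mem_signedImage he, rfl⟩
    · exact ⟨_, neg_mem_signedImage (mem_signedImage he), map_neg _ _⟩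
  · rintro ⟨_, ⟨e, he, rfl | rfl⟩, rfl⟩
    · exact ⟨e, he, Or.inl rfl⟩
    · exact ⟨e, he, Or.inr (map_neg _ _)⟩

theorem Rep.comap {β : Type*} {M : Matroid α} {f : α → V} (h : Rep M f) {k : β → α}
    (hk : Function.Injective k) : Rep (M.comap k) (f ∘ k) := by
  intro I hI
  rw [Matroid.comap_indep_iff, h _ (Set.image_subset_iff.2 hI),
    linearIndepOn_image_iff_comp hk.injOn]
  exact ⟨fun h => h.1, fun h => ⟨h, hk.injOn⟩⟩

theorem isSimple_comap {β : Type*} {M : Matroid α} (h : IsSimple M) {k : β → α}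
    (hk : Function.Injective k) : IsSimple (M.comap k) := by
  intro e he e' he'
  rw [Matroid.comap_indep_iff, Set.image_pair]
  exact ⟨h _ he _ he', hk.injOn⟩

theorem signedImage_comp_surjective {β : Type*} (f : α → V) {k : β → α}
    (hk : Function.Surjective k) (E : Set α) :
    signedImage (f ∘ k) (k ⁻¹' E) = signedImage f E := by
  ext v
  constructor
  · rintro ⟨e, he, h⟩
    exact ⟨k e, he, h⟩
  · rintro ⟨e, he, h⟩
    obtain ⟨b, rfl⟩ := hk e
    exact ⟨b, he, h⟩

/-- A base is an independent family in `A`. Elements outside the ground set are sent to 0 only to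
make the corestriction to `A` total. -/
theorem Rep.eRank_le [FiniteDimensional (ZMod 3) V] {M : Matroid α} {f : α → V} (h : Rep M f)
    {A : Submodule (ZMod 3) V} (hA : ∀ e ∈ M.E, f e ∈ A) :
    M.eRank ≤ finrank (ZMod 3) A := by
  obtain ⟨B, hB⟩ := M.exists_isBase
  have hli := (h B hB.subset_ground).1 hB.indep
  let f' : α → A := fun e => by
    classical
    exact if he : e ∈ M.E then ⟨f e, hA e he⟩ else 0
  have hli' : LinearIndepOn (ZMod 3) f' B := by
    rw [← LinearMap.linearIndepOn_iff_of_injOn A.subtype A.injective_subtype.injOn]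
    unfold LinearIndepOn at hli ⊢
    convert hli using 2 with e
    simp [f', hB.subset_ground e.2]
  have := hli'.encard_le_toENat_rank
  rwa [← finrank_eq_rank, hB.encard_eq_eRank, Cardinal.toENat_nat] at this

theorem Rep.span_eq_top [FiniteDimensional (ZMod 3) V] {M : Matroid α} {f : α → V} (h : Rep M f)
    (hr : M.eRank = finrank (ZMod 3) V) : span (ZMod 3) (f '' M.E) = ⊤ := by
  have h1 := h.eRank_le (A := span (ZMod 3) (f '' M.E)) fun e he => subset_span ⟨e, he, rfl⟩
  rw [hr] at h1
  exact eq_top_of_finrank_eq (le_antisymm (finrank_le _) (by exact_mod_cast h1))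

/-- The complement, inside a subspace `A`, of a restriction that is a comatroid is represented by a
comatroid. -/
theorem exists_comatroid_complement {α : Type u} {r : ℕ} {M : Matroid α}
    {f : α → Fin r → ZMod 3} (hf : Rep M f) (hs : IsSimple M)
    (A : Submodule (ZMod 3) (Fin r → ZMod 3))
    (hA : IsComatroid (ZMod 3) (M ↾ {e ∈ M.E | f e ∈ A})) :
    ∃ (γ : Type u) (N : Matroid γ) (k : γ → Fin r → ZMod 3), IsComatroid (ZMod 3) N ∧ IsSimple N ∧
      Rep N k ∧ signedImage k N.E = {v | v ∈ A ∧ v ∈ opposite (signedImage f M.E)} := by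
  have hX : {e ∈ M.E | f e ∈ A} ⊆ M.E := fun e he => he.1
  let L : (Fin (finrank (ZMod 3) A) → ZMod 3) ≃ₗ[ZMod 3] A :=
    LinearEquiv.ofFinrankEq _ _ (by simp)
  let g : (Fin (finrank (ZMod 3) A) → ZMod 3) →ₗ[ZMod 3] (Fin r → ZMod 3) :=
    A.subtype.comp L.toLinearMap
  have hg : Function.Injective g := A.injective_subtype.comp L.injective
  have hgA : ∀ v, g v ∈ A := fun v => (L v).2
  have hgs : ∀ v ∈ A, ∃ w, g w = v := fun v hv => ⟨L.symm ⟨v, hv⟩, by simp [g]⟩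
  -- `A` is identified with a coordinate space of its own dimension, so that the complement within
  -- `A` becomes a complement in a projective geometry of the right rank.
  let T : Set (ℙ (ZMod 3) (Fin (finrank (ZMod 3) A) → ZMod 3)) :=
    {p | g p.rep ∈ signedImage f M.E}
  have hT : ∀ w, w ≠ 0 → (w ∈ signedImage Projectivization.rep T ↔
      g w ∈ signedImage f M.E) := by
    intro w hw
    rw [signedImage_rep_iff T hw]
    obtain ⟨a, ha⟩ := Projectivization.exists_smul_eq_mk_rep (ZMod 3) w hw
    change g _ ∈ signedImage f M.E ↔ _
    rw [← ha, Units.smul_def]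
    rcases smul_eq_or_eq_neg a.ne_zero w with h | h <;> rw [h]
    rw [map_neg]
    exact ⟨fun h => by simpa using neg_mem_signedImage h, neg_mem_signedImage⟩
  have hzero := hf.zero_notMem_signedImage hs
  have hiso : Iso (M ↾ {e ∈ M.E | f e ∈ A}) (projGeom (ZMod 3) _ ↾ T) := by
    refine (iso_of_rep (rep_projGeom_restrict T) (hf.restrict hX) (isSimple_projGeom_restrict T)
      (isSimple_restrict hs hX) g hg ?_).symm
    rw [Matroid.restrict_ground_eq, Matroid.restrict_ground_eq]
    ext v
    constructor
    · rintro ⟨w, hw, rfl⟩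
      have hw0 : w ≠ 0 := by
        rintro rfl
        exact (rep_projGeom_restrict T).zero_notMem_signedImage (isSimple_projGeom_restrict T) hw
      obtain ⟨e, he, h⟩ := (hT w hw0).1 hw
      refine ⟨e, ⟨he, ?_⟩, h⟩
      have := hgA w
      rcases h with h | h
      · rwa [h] at this
      · rw [h] at this
        exact neg_mem_iff.1 this
    · rintro ⟨e, ⟨he, heA⟩, h⟩
      have hvA : v ∈ A := by
        rcases h with rfl | rfl
        · exact heA
        · exact neg_mem heA
      obtain ⟨w, rfl⟩ := hgs v hvA
      refine ⟨w, ?_, rfl⟩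
      have hgw : g w ∈ signedImage f M.E := ⟨e, he, h⟩
      refine (hT w ?_).2 hgw
      rintro rfl
      rw [map_zero] at hgw
      exact hzero hgw
  -- The points of the geometry live in universe 0 and have to be lifted, because the comatroids are
  -- defined in the universe of `M`.
  refine ⟨ULift.{u} (ℙ (ZMod 3) (Fin (finrank (ZMod 3) A) → ZMod 3)),
    (projGeom (ZMod 3) _ ↾ Tᶜ).comap ULift.down,
    (g ∘ Projectivization.rep) ∘ ULift.down, ?_,
    isSimple_comap (isSimple_projGeom_restrict _) ULift.down_injective,
    ((rep_projGeom_restrict Tᶜ).map g hg).comap ULift.down_injective, ?_⟩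
  · refine IsComatroid.compl _ _ (finrank (ZMod 3) A) hA
      ((hf.restrict hX).eRank_le fun e he => he.2) ⟨T, hiso, ?_⟩
    refine iso_of_rep ((rep_projGeom_restrict Tᶜ).comap ULift.down_injective)
      (rep_projGeom_restrict Tᶜ) (isSimple_comap (isSimple_projGeom_restrict _)
      ULift.down_injective) (isSimple_projGeom_restrict _) LinearMap.id Function.injective_id ?_
    rw [Matroid.comap_ground_eq, signedImage_comp_surjective _ ULift.down_surjective]
    simp
  · rw [Matroid.comap_ground_eq, signedImage_comp_surjective _ ULift.down_surjective,
      Matroid.restrict_ground_eq, signedImage_map, signedImage_rep_compl]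
    ext v
    constructor
    · rintro ⟨w, ⟨hw0, hw⟩, rfl⟩
      refine ⟨hgA w, fun h => hw0 (hg (h.trans (map_zero g).symm)), fun h => hw ((hT w hw0).2 h)⟩
    · rintro ⟨hvA, hv0, hv⟩
      obtain ⟨w, rfl⟩ := hgs v hvA
      have hw0 : w ≠ 0 := by
        rintro rfl
        exact hv0 (map_zero g)
      exact ⟨w, ⟨hw0, fun h => hv ((hT w hw0).1 h)⟩, rfl⟩

variable {α : Type u} {M : Matroid α} {r : ℕ} {f : α → Fin r → ZMod 3}

theorem flat_ne_ground (hspan : span (ZMod 3) (f '' M.E) = ⊤)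
    {H : Submodule (ZMod 3) (Fin r → ZMod 3)} (hH : H ≠ ⊤) : {e ∈ M.E | f e ∈ H} ≠ M.E := by
  intro h
  apply hH
  rw [eq_top_iff, ← hspan, span_le]
  rintro _ ⟨e, he, rfl⟩
  rw [← h] at he
  exact he.2

theorem mem_signedImage_flat {H : Submodule (ZMod 3) (Fin r → ZMod 3)} {v : Fin r → ZMod 3}
    (hv : v ∈ H) :
    v ∈ signedImage f {e ∈ M.E | f e ∈ H} ↔ v ∈ signedImage f M.E := by
  constructor
  · rintro ⟨e, he, h⟩
    exact ⟨e, he.1, h⟩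
  · rintro ⟨e, he, h⟩
    refine ⟨e, ⟨he, ?_⟩, h⟩
    rcases h with rfl | rfl
    · exact hv
    · exact neg_mem_iff.1 hv

theorem IsMinimalNonComatroid.sep_of_ne_top (hM : IsMinimalNonComatroid (ZMod 3) M)
    (hf : Rep M f) (hspan : span (ZMod 3) (f '' M.E) = ⊤)
    {H : Submodule (ZMod 3) (Fin r → ZMod 3)} (hH : H ≠ ⊤) (h2 : 2 ≤ finrank (ZMod 3) H) :
    Sep (ZMod 3) (signedImage f M.E) H ∨ Sep (ZMod 3) (opposite (signedImage f M.E)) H := by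
  have h1 := hM.flat_comatroid _ (hf.isFlat H) (flat_ne_ground hspan hH)
  have h3 := h1.sepClosed f (hf.restrict fun e he => he.1) H h2
  rw [Matroid.restrict_ground_eq] at h3
  refine h3.imp (fun h => h.congr fun v hv _ hvs => (mem_signedImage_flat hv).2 hvs)
    fun h => h.congr fun v hv _ hvs => ⟨hvs.1, fun h4 => hvs.2 ((mem_signedImage_flat hv).1 h4)⟩

/-- A separation would make `M` the direct sum of its restrictions to two proper flats, which are
comatroids by minimality. -/
theorem IsMinimalNonComatroid.not_sep (hM : IsMinimalNonComatroid (ZMod 3) M)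
    (hf : Rep M f) (hspan : span (ZMod 3) (f '' M.E) = ⊤) :
    ¬ Sep (ZMod 3) (signedImage f M.E) ⊤ := by
  rintro ⟨A, B, hA, hB, hAB, hd, hS⟩
  have hc : IsCompl A B := ⟨hd, codisjoint_iff.2 hAB⟩
  have hA' : A ≠ ⊤ := fun h => hB (by rw [← hc.inf_eq_bot, h, top_inf_eq])
  have hB' : B ≠ ⊤ := fun h => hA (by rw [← hc.inf_eq_bot, h, inf_top_eq])
  apply hM.not_comatroid
  have hXA : {e ∈ M.E | f e ∈ A} ⊆ M.E := fun e he => he.1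
  have hXB : {e ∈ M.E | f e ∈ B} ⊆ M.E := fun e he => he.1
  have hle : ∀ C : Submodule (ZMod 3) (Fin r → ZMod 3),
      span (ZMod 3) (f '' {e ∈ M.E | f e ∈ C}) ≤ C := by
    intro C
    rw [span_le]
    rintro _ ⟨e, he, rfl⟩
    exact he.2
  refine IsComatroid.sum _ _ M
    (hM.flat_comatroid _ (hf.isFlat A) (flat_ne_ground hspan hA'))
    (hM.flat_comatroid _ (hf.isFlat B) (flat_ne_ground hspan hB')) ?_
  refine iso_of_rep (rep_sum (hf.restrict hXA) (hf.restrict hXB) ?_) hf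
    (isSimple_sum (isSimple_restrict hM.simple hXA) (isSimple_restrict hM.simple hXB))
    hM.simple LinearMap.id Function.injective_id ?_
  · exact hd.mono (hle A) (hle B)
  · rw [Matroid.sum_ground, signedImage_sumElim, Matroid.restrict_ground_eq,
      Matroid.restrict_ground_eq, LinearMap.id_coe, Set.image_id]
    ext v
    constructor
    · rintro (⟨e, he, h⟩ | ⟨e, he, h⟩)
      · exact ⟨e, he.1, h⟩
      · exact ⟨e, he.1, h⟩
    · rintro ⟨e, he, h⟩
      rcases hS (f e) (mem_signedImage he) mem_top with h' | h'
      · exact Or.inl ⟨e, ⟨he, h'⟩, h⟩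
      · exact Or.inr ⟨e, ⟨he, h'⟩, h⟩

/-- If the opposite colour splits along `A` and `B`, the complement of `M` is the direct sum of the
complements of `M` inside `A` and inside `B`. These are comatroids, so `M`, as the complement of
their sum, would be one too. -/
theorem IsMinimalNonComatroid.not_sep_opposite (hM : IsMinimalNonComatroid (ZMod 3) M)
    (hf : Rep M f) (hspan : span (ZMod 3) (f '' M.E) = ⊤)
    {T : Set (ℙ (ZMod 3) (Fin r → ZMod 3))} (hT : Iso M (projGeom (ZMod 3) r ↾ T))
    (hfT : signedImage f M.E = signedImage Projectivization.rep T) :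
    ¬ Sep (ZMod 3) (opposite (signedImage f M.E)) ⊤ := by
  rintro ⟨A, B, hA, hB, hAB, hd, hS⟩
  have hc : IsCompl A B := ⟨hd, codisjoint_iff.2 hAB⟩
  have hA' : A ≠ ⊤ := fun h => hB (by rw [← hc.inf_eq_bot, h, top_inf_eq])
  have hB' : B ≠ ⊤ := fun h => hA (by rw [← hc.inf_eq_bot, h, inf_top_eq])
  apply hM.not_comatroid
  obtain ⟨γ, N, k, hN, hNs, hk, hkA⟩ := exists_comatroid_complement hf hM.simple A
    (hM.flat_comatroid _ (hf.isFlat A) (flat_ne_ground hspan hA'))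
  obtain ⟨γ', N', k', hN', hNs', hk', hkB⟩ := exists_comatroid_complement hf hM.simple B
    (hM.flat_comatroid _ (hf.isFlat B) (flat_ne_ground hspan hB'))
  have hrep : Rep (N.sum N') (Sum.elim k k') := by
    refine rep_sum hk hk' ?_
    rw [← span_signedImage, ← span_signedImage, hkA, hkB]
    exact hd.mono (span_le.2 fun v hv => hv.1) (span_le.2 fun v hv => hv.1)
  refine IsComatroid.compl (N.sum N') M r (IsComatroid.sum N N' _ hN hN' (Iso.refl _)) ?_
    ⟨Tᶜ, ?_, by rwa [compl_compl]⟩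
  · have := hrep.eRank_le (A := ⊤) fun e _ => mem_top
    rw [finrank_top, finrank_fintype_fun_eq_card, Fintype.card_fin] at this
    exact this
  · refine iso_of_rep hrep (rep_projGeom_restrict Tᶜ) (isSimple_sum hNs hNs')
      (isSimple_projGeom_restrict _) LinearMap.id Function.injective_id ?_
    rw [Matroid.sum_ground, signedImage_sumElim, hkA, hkB, Matroid.restrict_ground_eq,
      signedImage_rep_compl, LinearMap.id_coe, Set.image_id, hfT]
    ext v
    constructor
    · rintro (h | h)
      · exact h.2
      · exact h.2
    · intro h
      rw [← hfT] at h ⊢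
      exact (hS v h mem_top).imp (fun h' => ⟨h', h⟩) fun h' => ⟨h', h⟩

/-- A set of vectors without small cocircuits: outside each hyperplane that is spanned by the set
there are more than three points. -/
def NoSmallCocircuit (S : Set V) : Prop :=
  ∀ H : Submodule (ZMod 3) V, IsCoatom H → span (ZMod 3) (S ∩ H) = H → ∀ a b c : V,
    ∃ v ∈ S, v ∉ H ∧ v ≠ a ∧ v ≠ -a ∧ v ≠ b ∧ v ≠ -b ∧ v ≠ c ∧ v ≠ -c

/-- If every vector outside a spanned hyperplane were one of `a`, `b`, `c` up to sign, simplicity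
would leave at most one element for each of them, hence a cocircuit with at most three elements. -/
theorem Rep.noSmallCocircuit {α : Type*} {M : Matroid α} {f : α → V} (hf : Rep M f)
    (hM : IsSimple M) (hspan : span (ZMod 3) (signedImage f M.E) = ⊤)
    (hC : ¬ ∃ C, M.IsCocircuit C ∧ C.encard < 4) : NoSmallCocircuit (signedImage f M.E) := by
  intro H hH hs a b c
  by_contra hcon
  push Not at hcon
  apply hC
  refine ⟨_, hf.isCocircuit hH (by rwa [← span_signedImage]) ?_, ?_⟩
  · apply le_antisymm
    · rw [span_le]
      rintro _ ⟨e, he, rfl⟩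
      exact he.2
    · conv_lhs => rw [← hs]
      rw [span_le]
      rintro v ⟨⟨e, he, rfl | rfl⟩, hv⟩
      · exact subset_span ⟨e, ⟨he, hv⟩, rfl⟩
      · exact neg_mem (subset_span ⟨e, ⟨he, neg_mem_iff.1 hv⟩, rfl⟩)
  · have hone : ∀ x : V, {e ∈ M.E | f e = x ∨ f e = -x}.encard ≤ 1 := by
      intro x
      rw [Set.encard_le_one_iff]
      rintro e e' ⟨he, h⟩ ⟨he', h'⟩
      apply hf.eq_of_signs hM he he'
      rcases h with h | h <;> rcases h' with h' | h' <;> simp [h, h']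
    have hsub : {e ∈ M.E | f e ∉ H} ⊆ {e ∈ M.E | f e = a ∨ f e = -a} ∪
        {e ∈ M.E | f e = b ∨ f e = -b} ∪ {e ∈ M.E | f e = c ∨ f e = -c} := by
      rintro e ⟨he, heH⟩
      by_contra hne
      simp only [Set.mem_union, Set.mem_ofPred_eq, he, true_and, not_or] at hne
      obtain ⟨⟨⟨h1, h2⟩, h3, h4⟩, h5, h6⟩ := hne
      exact h6 (hcon (f e) (mem_signedImage he) heH h1 h2 h3 h4 h5)
    calc _ ≤ _ := Set.encard_le_encard hsub
      _ ≤ 1 + 1 + 1 := (Set.encard_union_le _ _).trans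
        (add_le_add ((Set.encard_union_le _ _).trans (add_le_add (hone a) (hone b))) (hone c))
      _ < 4 := by norm_num

end Minimal

/-! ### Ears: extending connected subspaces. -/

section ConnectedHyperplane

variable {V : Type*} [AddCommGroup V] [Module (ZMod 3) V]

/-- The vectors of `S` in `W` span `W` and are not separated there. -/
structure Conn (S : Set V) (W : Submodule (ZMod 3) V) : Prop where
  ne_bot : W ≠ ⊥
  span_eq : span (ZMod 3) (S ∩ W) = W
  not_sep : ¬ Sep (ZMod 3) S W

/-- A family of vectors of `S` whose sum is a nonzero vector of `W`, and all proper subfamilies of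
which are independent modulo `W`. -/
structure IsEar {ι : Type*} [Fintype ι] (S : Set V) (W : Submodule (ZMod 3) V) (d : ι → V) :
    Prop where
  mem : ∀ i, d i ∈ S
  sum_mem : ∑ i, d i ∈ W
  sum_ne : ∑ i, d i ≠ 0
  indep : ∀ c : ι → ZMod 3, ∑ i, c i • d i ∈ W → ∀ i₀, c i₀ = 0 → ∀ i, c i = 0

/-- Otherwise the separation would cut `W` into two nonzero parts. -/
theorem Conn.le_or_le {S : Set V} {W A B : Submodule (ZMod 3) V} (hW : Conn S W)
    (hWU : W ≤ A ⊔ B) (hd : Disjoint A B) (hS : ∀ v ∈ S, v ∈ A ⊔ B → v ∈ A ∨ v ∈ B) :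
    W ≤ A ∨ W ≤ B := by
  by_contra hcon
  push Not at hcon
  have hsup : (A ⊓ W) ⊔ (B ⊓ W) = W := by
    refine le_antisymm (sup_le inf_le_right inf_le_right) ?_
    conv_lhs => rw [← hW.span_eq]
    rw [span_le]
    rintro v ⟨hv, hvW⟩
    rcases hS v hv (hWU hvW) with h | h
    · exact mem_sup_left ⟨h, hvW⟩
    · exact mem_sup_right ⟨h, hvW⟩
  refine hW.not_sep ⟨A ⊓ W, B ⊓ W, ?_, ?_, hsup, hd.mono inf_le_left inf_le_left, ?_⟩
  · intro h
    rw [h, bot_sup_eq] at hsup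
    exact hcon.2 (hsup ▸ inf_le_left)
  · intro h
    rw [h, sup_bot_eq] at hsup
    exact hcon.1 (hsup ▸ inf_le_left)
  · intro v hv hvW
    exact (hS v hv (hWU hvW)).imp (fun h => ⟨h, hvW⟩) fun h => ⟨h, hvW⟩

theorem sum_subtype_smul {ι : Type*} [Fintype ι] (p : ι → Prop) [DecidablePred p]
    (a : {i // p i} → ZMod 3) (g : ι → V) :
    ∑ x : {i // p i}, a x • g x = ∑ i, (if h : p i then a ⟨i, h⟩ else 0) • g i := by
  rw [← Finset.sum_filter_of_ne (p := p), Finset.sum_subtype (Finset.univ.filter p) (p := p)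
    (by simp)]
  · exact Finset.sum_congr rfl fun x _ => by rw [dif_pos x.2]
  · intro i _ hi
    by_contra hp
    rw [dif_neg hp, zero_smul] at hi
    exact hi rfl

namespace IsEar

variable {ι : Type*} [Fintype ι] {S : Set V} {W : Submodule (ZMod 3) V} {d : ι → V}

/-- Modulo `W` the ear is a circuit whose only relation, up to a factor, is that the sum of its
members vanishes. -/
theorem eq_of_sum_mem (h : IsEar S W d) {b : ι → ZMod 3} (hb : ∑ i, b i • d i ∈ W) (i j : ι) :
    b i = b j := by
  have h1 : ∑ i, (b i - b j) • d i ∈ W := by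
    simp only [sub_smul, Finset.sum_sub_distrib, ← Finset.smul_sum]
    exact W.sub_mem hb (W.smul_mem _ h.sum_mem)
  exact sub_eq_zero.1 (h.indep _ h1 j (sub_self _) i)

theorem eq_of_sub_mem (h : IsEar S W d) {b c : ι → ZMod 3}
    (hb : ∑ i, b i • d i - ∑ i, c i • d i ∈ W) (i j : ι) : b i - c i = b j - c j := by
  refine h.eq_of_sum_mem (b := fun i => b i - c i) ?_ i j
  simpa only [sub_smul, Finset.sum_sub_distrib] using hb

/-- `W` lies on one side, say in `A`, of any separation. The members of the ear outside `A` have a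
sum in both `A` and `B`, so this sum is zero. By the two conditions on ears there are no such
members, and `B` is zero. -/
theorem conn (h : IsEar S W d) (hW : Conn S W) : Conn S (W ⊔ span (ZMod 3) (Set.range d)) := by
  classical
  refine ⟨fun h0 => hW.ne_bot (sup_eq_bot_iff.1 h0).1, ?_, ?_⟩
  · refine le_antisymm (span_le.2 Set.inter_subset_right) (sup_le ?_ ?_)
    · conv_lhs => rw [← hW.span_eq]
      exact span_mono (Set.inter_subset_inter_right _ (le_sup_left (a := W)))
    · rw [span_le]
      rintro _ ⟨i, rfl⟩
      exact subset_span ⟨h.mem i, mem_sup_right (subset_span ⟨i, rfl⟩)⟩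
  · have key : ∀ A B : Submodule (ZMod 3) V, B ≠ ⊥ →
        A ⊔ B = W ⊔ span (ZMod 3) (Set.range d) → Disjoint A B →
        (∀ v ∈ S, v ∈ W ⊔ span (ZMod 3) (Set.range d) → v ∈ A ∨ v ∈ B) → ¬ W ≤ A := by
      intro A B hB hAB hd hS hWA
      have hdAB : ∀ i, d i ∈ A ∨ d i ∈ B := fun i =>
        hS _ (h.mem i) (mem_sup_right (subset_span ⟨i, rfl⟩))
      have hz : ∑ i, (if d i ∈ A then (0 : ZMod 3) else 1) • d i = 0 := by
        apply eq_zero_of_disjoint hd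
        · have : ∑ i, (if d i ∈ A then (0 : ZMod 3) else 1) • d i =
              ∑ i, d i - ∑ i, (if d i ∈ A then (1 : ZMod 3) else 0) • d i := by
            rw [← Finset.sum_sub_distrib]
            refine Finset.sum_congr rfl fun i _ => ?_
            split_ifs <;> simp
          rw [this]
          refine A.sub_mem (hWA h.sum_mem) (Submodule.sum_mem _ fun i _ => ?_)
          split_ifs with hi
          · exact A.smul_mem _ hi
          · simp
        · refine Submodule.sum_mem _ fun i _ => ?_
          split_ifs with hi
          · simp
          · exact B.smul_mem _ ((hdAB i).resolve_left hi)
      by_cases hall : ∀ i, d i ∉ A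
      · apply h.sum_ne
        rw [← hz]
        refine Finset.sum_congr rfl fun i _ => ?_
        rw [if_neg (hall i), one_smul]
      push Not at hall
      obtain ⟨i₀, hi₀⟩ := hall
      have hA : ∀ i, d i ∈ A := by
        intro i
        have := h.indep _ (hz ▸ W.zero_mem) i₀ (if_pos hi₀) i
        by_contra hi
        rw [if_neg hi] at this
        exact one_ne_zero this
      have hle : A ⊔ B ≤ A := by
        rw [hAB]
        refine sup_le hWA (span_le.2 ?_)
        rintro _ ⟨i, rfl⟩
        exact hA i
      apply hB
      rw [eq_bot_iff]
      exact disjoint_iff_inf_le.1 hd |> le_trans (le_inf (le_sup_right.trans hle) le_rfl)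
    rintro ⟨A, B, hA, hB, hAB, hd, hS⟩
    rcases hW.le_or_le (A := A) (B := B) (hAB ▸ le_sup_left) hd (hAB ▸ hS) with h1 | h1
    · exact key A B hB hAB hd hS h1
    · exact key B A hA (by rw [sup_comm, hAB]) hd.symm (fun v hv hvU => (hS v hv hvU).symm) h1

end IsEar

/-- Since `S` is not separated, the vectors of `S` outside `W` span a subspace that meets `W`
nontrivially. A combination of these vectors with a nonzero value in `W` and with smallest support
is an ear. -/
theorem exists_ear [FiniteDimensional (ZMod 3) V] {S : Set V} {W : Submodule (ZMod 3) V}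
    (hneg : ∀ v ∈ S, -v ∈ S) (hV : 2 ≤ finrank (ZMod 3) V) (hS : ¬ Sep (ZMod 3) S ⊤)
    (hW : Conn S W) (hWt : W ≠ ⊤) :
    ∃ (ι : Type) (_ : Fintype ι) (d : ι → V), IsEar S W d ∧ ∀ i, d i ∉ W := by
  classical
  have hspan : span (ZMod 3) S = ⊤ := by
    have := span_inter_eq_of_not_sep (by rwa [finrank_top]) hS
    simpa using this
  have hnd : ¬ Disjoint W (span (ZMod 3) (S \ W)) := by
    intro hd
    refine hS ⟨W, _, hW.ne_bot, ?_, ?_, hd, ?_⟩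
    · intro h
      apply hWt
      rw [eq_top_iff, ← hspan, span_le]
      intro v hv
      by_contra hvW
      have : v ∈ span (ZMod 3) (S \ W) := subset_span ⟨hv, hvW⟩
      rw [h] at this
      exact hvW ((mem_bot (ZMod 3)).1 this ▸ W.zero_mem)
    · rw [eq_top_iff, ← hspan, span_le]
      intro v hv
      by_cases hvW : v ∈ W
      · exact mem_sup_left hvW
      · exact mem_sup_right (subset_span ⟨hv, hvW⟩)
    · intro v hv _
      by_cases hvW : v ∈ W
      · exact Or.inl hvW
      · exact Or.inr (subset_span ⟨hv, hvW⟩)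
  rw [Submodule.disjoint_def] at hnd
  push Not at hnd
  obtain ⟨w, hwW, hw, hw0⟩ := hnd
  let P : ℕ → Prop := fun k => ∃ (ι : Type) (_ : Fintype ι) (d : ι → V) (c : ι → ZMod 3),
    (∀ i, d i ∈ S ∧ d i ∉ W) ∧ ∑ i, c i • d i ∈ W ∧ ∑ i, c i • d i ≠ 0 ∧
      (Finset.univ.filter fun i => c i ≠ 0).card = k
  have hP : ∃ k, P k := by
    obtain ⟨n, c, d, h⟩ := mem_span_set'.1 hw
    exact ⟨_, Fin n, inferInstance, fun i => (d i : V), c, fun i => (d i).2, h ▸ hwW, h ▸ hw0, rfl⟩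
  obtain ⟨ι, _, d, c, hd, hsW, hs0, hcard⟩ := Nat.find_spec hP
  have hmin : ∀ (a : ι → ZMod 3), ∑ i, a i • d i ∈ W → ∑ i, a i • d i ≠ 0 →
      (Finset.univ.filter fun i => c i ≠ 0).card ≤ (Finset.univ.filter fun i => a i ≠ 0).card := by
    intro a h1 h2
    rw [hcard]
    exact Nat.find_min' hP ⟨ι, inferInstance, d, a, hd, h1, h2, rfl⟩
  have hsum : ∀ a : {i // c i ≠ 0} → ZMod 3, ∑ x : {i // c i ≠ 0}, a x • (c x • d x) =
      ∑ i, ((if h : c i ≠ 0 then a ⟨i, h⟩ else 0) * c i) • d i := by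
    intro a
    rw [sum_subtype_smul (fun i => c i ≠ 0) a (fun i => c i • d i)]
    simp only [smul_smul]
  have hsum1 : ∑ x : {i // c i ≠ 0}, c x • d x = ∑ i, c i • d i := by
    have := hsum fun _ => 1
    simp only [one_smul] at this
    rw [this]
    refine Finset.sum_congr rfl fun i _ => ?_
    split_ifs with h
    · rw [one_mul]
    · rw [not_not.1 h]; simp
  refine ⟨{i // c i ≠ 0}, inferInstance, fun x => c x • d x, ⟨?_, ?_, ?_, ?_⟩, ?_⟩
  · intro x
    rcases smul_eq_or_eq_neg x.2 (d x) with h | h <;> rw [h]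
    · exact (hd x).1
    · exact hneg _ (hd x).1
  · rwa [hsum1]
  · rwa [hsum1]
  · intro a haW x₀ hx₀ x
    rw [hsum] at haW
    by_contra hx
    have hlt : ∀ b : ι → ZMod 3, (∀ i, b i ≠ 0 → c i ≠ 0) → (∃ i, b i = 0 ∧ c i ≠ 0) →
        (Finset.univ.filter fun i => b i ≠ 0).card <
          (Finset.univ.filter fun i => c i ≠ 0).card := by
      rintro b hb ⟨i, hi, hci⟩
      apply Finset.card_lt_card
      refine ⟨fun j hj => ?_, fun hsub => ?_⟩
      · simp only [Finset.mem_filter, Finset.mem_univ, true_and] at hj ⊢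
        exact hb j hj
      · have := hsub (by simpa using hci : i ∈ _)
        simp only [Finset.mem_filter, Finset.mem_univ, true_and] at this
        exact this hi
    let a' : ι → ZMod 3 := fun i => (if h : c i ≠ 0 then a ⟨i, h⟩ else 0) * c i
    -- If the smaller combination vanishes, a multiple of it is subtracted from `c` to remove `x`
    -- from the support without changing the sum; otherwise it misses `x₀` and contradicts
    -- minimality itself.
    by_cases h0 : ∑ i, a' i • d i = 0
    · have hax : a' x = a x * c x := by simp [a', x.2]
      have h1 : ∑ i, (c i - (a x)⁻¹ * a' i) • d i = ∑ i, c i • d i := by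
        simp only [sub_smul, Finset.sum_sub_distrib, mul_smul, ← Finset.smul_sum, h0, smul_zero,
          sub_zero]
      refine absurd (hmin (fun i => c i - (a x)⁻¹ * a' i) (by rwa [h1]) (by rwa [h1]))
        (not_le.2 (hlt _ (fun i hi hci => hi ?_) ⟨x, ?_, x.2⟩))
      · simp [a', hci]
      · rw [hax, inv_mul_cancel_left₀ hx, sub_self]
    · refine absurd (hmin a' haW h0) (not_le.2 (hlt _ (fun i hi hci => hi ?_) ⟨x₀, ?_, x₀.2⟩))
      · simp [a', hci]
      · simp [a', hx₀]
  · intro x hx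
    exact (hd x).2 ((W.smul_mem_iff x.2).1 hx)

end ConnectedHyperplane

/-! ### The structure of the vectors outside a maximal connected subspace. -/

section ConnectedHyperplane

variable {V : Type*} [AddCommGroup V] [Module (ZMod 3) V]

/-- A proper connected subspace of codimension at least two that is maximal among the proper
connected subspaces. -/
structure IsMaxConn (S : Set V) (W : Submodule (ZMod 3) V) : Prop where
  neg_closed : ∀ v ∈ S, -v ∈ S
  conn : Conn S W
  eq_top : ∀ U, W < U → Conn S U → U = ⊤
  codim : finrank (ZMod 3) W + 2 ≤ finrank (ZMod 3) V

namespace IsMaxConn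

variable {ι : Type*} [Fintype ι] {S : Set V} {W : Submodule (ZMod 3) V} {d : ι → V}

theorem sup_eq_top (hW : IsMaxConn S W) (hd : IsEar S W d) {i : ι} (hi : d i ∉ W) :
    W ⊔ span (ZMod 3) (Set.range d) = ⊤ := by
  refine hW.eq_top _ (lt_of_le_of_ne le_sup_left fun h => hi ?_) (hd.conn hW.conn)
  rw [h]
  exact mem_sup_right (subset_span ⟨i, rfl⟩)

theorem exists_eq_add (hW : IsMaxConn S W) (hd : IsEar S W d) {i : ι} (hi : d i ∉ W) (v : V) :
    ∃ c : ι → ZMod 3, ∃ u ∈ W, v = ∑ i, c i • d i + u := by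
  have hv : v ∈ W ⊔ span (ZMod 3) (Set.range d) := by rw [hW.sup_eq_top hd hi]; trivial
  obtain ⟨u, hu, x, hx, rfl⟩ := mem_sup.1 hv
  obtain ⟨c, rfl⟩ := (mem_span_range_iff_exists_fun (ZMod 3)).1 hx
  exact ⟨c, u, hu, add_comm _ _⟩

/-- Two different vectors congruent modulo `W` would give the ear `g`, `-g'`. It raises the
dimension by one only, whereas every ear that leaves `W` must generate the whole space over `W`. -/
theorem eq_of_sub_mem [FiniteDimensional (ZMod 3) V] (hW : IsMaxConn S W) {g g' : V} (hg : g ∈ S)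
    (hg' : g' ∈ S) (hgW : g ∉ W) (hsub : g - g' ∈ W) : g = g' := by
  by_contra hne
  have hg'W : g' ∉ W := fun h => hgW (by simpa using W.add_mem hsub h)
  have hear : IsEar S W ![g, -g'] := by
    refine ⟨fun i => ?_, ?_, ?_, fun c hc i₀ hi₀ i => ?_⟩
    · fin_cases i
      · exact hg
      · exact hW.neg_closed _ hg'
    · simpa [Fin.sum_univ_two, ← sub_eq_add_neg] using hsub
    · simpa [Fin.sum_univ_two, ← sub_eq_add_neg, sub_eq_zero] using hne
    · have h0 : c 0 = 0 ↔ c 1 = 0 := by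
        simp only [Fin.sum_univ_two, Matrix.cons_val_zero, Matrix.cons_val_one, smul_neg] at hc
        constructor
        · intro h
          by_contra h1
          rw [h, zero_smul, zero_add, neg_mem_iff, W.smul_mem_iff h1] at hc
          exact hg'W hc
        · intro h
          by_contra h1
          rw [h, zero_smul, neg_zero, add_zero, W.smul_mem_iff h1] at hc
          exact hgW hc
      have h1 : c 0 = 0 := by
        fin_cases i₀
        · exact hi₀
        · exact h0.2 hi₀
      fin_cases i
      · exact h1
      · exact h0.1 h1
  have htop := hW.sup_eq_top hear (i := 0) hgW
  have hle : (⊤ : Submodule (ZMod 3) V) ≤ W ⊔ span (ZMod 3) {g} := by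
    rw [← htop]
    refine sup_le le_sup_left (span_le.2 ?_)
    have hgm : g ∈ W ⊔ span (ZMod 3) {g} := mem_sup_right (mem_span_singleton_self _)
    rintro _ ⟨i, rfl⟩
    fin_cases i
    · exact hgm
    · have : g' = g - (g - g') := by abel
      change -g' ∈ W ⊔ span (ZMod 3) {g}
      rw [this]
      exact neg_mem (sub_mem hgm (mem_sup_left hsub))
  have h1 := finrank_sup_span_singleton_of_notMem hgW
  rw [top_le_iff.1 hle, finrank_top] at h1
  have := hW.codim
  omega

theorem three_le_card [FiniteDimensional (ZMod 3) V] (hW : IsMaxConn S W) (hd : IsEar S W d)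
    (hdW : ∀ i, d i ∉ W) : 3 ≤ Fintype.card ι := by
  classical
  by_contra hlt
  have hsum := hd.sum_mem
  have hne := hd.sum_ne
  have hcases : Fintype.card ι = 0 ∨ Fintype.card ι = 1 ∨ Fintype.card ι = 2 := by omega
  rw [← Finset.card_univ] at hcases
  rcases hcases with h | h | h
  · rw [Finset.card_eq_zero] at h
    rw [h, Finset.sum_empty] at hne
    exact hne rfl
  · obtain ⟨x, hx⟩ := Finset.card_eq_one.1 h
    rw [hx, Finset.sum_singleton] at hsum
    exact hdW x hsum
  · obtain ⟨x, y, hxy, hu⟩ := Finset.card_eq_two.1 h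
    rw [hu, Finset.sum_pair hxy] at hsum hne
    have := hW.eq_of_sub_mem (hd.mem x) (hW.neg_closed _ (hd.mem y)) (hdW x) (by simpa using hsum)
    rw [this] at hne
    simp at hne

/-- A coefficient of a vector of `S` outside `W` is attained once, unless the corresponding
relation holds exactly. -/
theorem eq_of_coeff_eq (hW : IsMaxConn S W) (hd : IsEar S W d) {e u : V}
    {c : ι → ZMod 3} (he : e ∈ S) (heW : e ∉ W) (hu : u ∈ W) (hec : e = ∑ i, c i • d i + u)
    {s : ZMod 3} (hs : u ≠ s • ∑ i, d i) {i j : ι} (hi : c i + s = 0) (hj : c j + s = 0) :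
    i = j := by
  classical
  by_contra hij
  let p : ι → Prop := fun i => -(c i + s) ≠ 0
  -- The sum of `e` and all `-(c k + s) • d k` is `u - s • ∑ d`, a nonzero vector of `W`. Dropping
  -- the zero terms yields a new ear, in which the members `i` and `j` are missing.
  let d' : Option {i // p i} → V := fun x => x.elim e fun y => -(c y + s) • d y
  have hcomb : ∀ a : Option {i // p i} → ZMod 3, ∑ x, a x • d' x =
      ∑ k, (a none * c k - (if h : p k then a (some ⟨k, h⟩) else 0) * (c k + s)) • d k +
        a none • u := by
    intro a
    have h1 : ∑ x : {i // p i}, a (some x) • d' (some x) =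
        ∑ k, (if h : p k then a (some ⟨k, h⟩) else 0) • (-(c k + s) • d k) :=
      sum_subtype_smul p (fun x => a (some x)) fun k => -(c k + s) • d k
    rw [Fintype.sum_option, h1]
    change a none • e + _ = _
    rw [hec, smul_add, Finset.smul_sum, add_right_comm, ← Finset.sum_add_distrib]
    congr 1
    refine Finset.sum_congr rfl fun k _ => ?_
    rw [smul_smul, smul_smul, ← add_smul]
    congr 1
    ring
  have hear : IsEar S W d' := by
    have hsum : ∑ x, d' x = u - s • ∑ i, d i := by
      have h1 := hcomb fun _ => 1
      simp only [one_smul, one_mul] at h1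
      rw [h1, add_comm, sub_eq_add_neg, ← neg_smul, Finset.smul_sum]
      congr 1
      refine Finset.sum_congr rfl fun k _ => ?_
      congr 1
      split_ifs with h
      · ring
      · rw [eq_neg_of_add_eq_zero_left (neg_eq_zero.1 (not_not.1 h))]
        ring
    refine ⟨?_, ?_, ?_, ?_⟩
    · rintro (_ | x)
      · exact he
      · change -(c x + s) • d x ∈ S
        rcases smul_eq_or_eq_neg x.2 (d x) with h | h <;> rw [h]
        · exact hd.mem x
        · exact hW.neg_closed _ (hd.mem x)
    · rw [hsum]
      exact W.sub_mem hu (W.smul_mem _ hd.sum_mem)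
    · rw [hsum]
      exact sub_ne_zero.2 hs
    · intro a ha
      rw [hcomb, Submodule.add_mem_iff_left _ (W.smul_mem _ hu)] at ha
      have hconst : ∀ k : {i // p i}, a (some k) = a none := by
        intro k
        have h1 := hd.eq_of_sum_mem ha k i
        have hk : c k + s ≠ 0 := fun h => k.2 (by rw [h, neg_zero])
        have hpi : ¬ p i := fun h => h (by rw [hi, neg_zero])
        rw [dif_pos k.2, dif_neg hpi, zero_mul, sub_zero] at h1
        have h2 : (a none - a (some k)) * (c k + s) = 0 := by
          have hci : c i = -s := eq_neg_of_add_eq_zero_left hi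
          rw [hci] at h1
          linear_combination h1
        rcases mul_eq_zero.1 h2 with h | h
        · exact (sub_eq_zero.1 h).symm
        · exact absurd h hk
      have hall : ∀ x y, a x = a y := by
        have : ∀ x, a x = a none := by
          rintro (_ | k)
          · rfl
          · exact hconst k
        intro x y
        rw [this, this y]
      intro x₀ hx₀ x
      rw [hall x x₀, hx₀]
  -- The new ear must generate `d i` modulo `W`, but all its combinations have equal coefficients at
  -- `i` and `j`.
  obtain ⟨a, v, hv, h1⟩ := hW.exists_eq_add hear (i := none) heW (d i)
  rw [hcomb] at h1
  have h2 := hd.eq_of_sub_mem (b := Pi.single i 1)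
    (c := fun k => a none * c k - (if h : p k then a (some ⟨k, h⟩) else 0) * (c k + s))
    (by
      have : ∑ k, (Pi.single i (1 : ZMod 3) : ι → ZMod 3) k • d k = d i := by
        simp [Pi.single_apply, ite_smul]
      rw [this, h1, add_assoc, add_sub_cancel_left]
      exact W.add_mem (W.smul_mem _ hu) hv) i j
  have hci : c i = c j := by rw [eq_neg_of_add_eq_zero_left hi, eq_neg_of_add_eq_zero_left hj]
  rw [Pi.single_eq_same, Pi.single_eq_of_ne (Ne.symm hij), mul_eq_zero_of_right _ hi,
    mul_eq_zero_of_right _ hj, hci] at h2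
  simp at h2

/-- By `eq_of_coeff_eq`, either `u` is a multiple of `∑ d` and can be absorbed into the
coefficients, after which 1 and -1 occur at most once each, or all coefficients of `e` are distinct.
In the second case the ear has at most three members, so `u` is zero for larger ears. -/
theorem eq_or_eq_sub [FiniteDimensional (ZMod 3) V] (hW : IsMaxConn S W) (hd : IsEar S W d)
    (hdW : ∀ i, d i ∉ W) {e : V} (he : e ∈ S) (heW : e ∉ W) :
    (∃ i, e = d i ∨ e = -d i) ∨
      ∃ i j, i ≠ j ∧ ∃ u ∈ W, e = d i - d j + u ∧ (4 ≤ Fintype.card ι → u = 0) := by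
  classical
  have h3 := hW.three_le_card hd hdW
  obtain ⟨i₀⟩ : Nonempty ι := Fintype.card_pos_iff.1 (by omega)
  obtain ⟨c, u, hu, hec, hone, hone', hu0⟩ : ∃ c : ι → ZMod 3, ∃ u ∈ W,
      e = ∑ i, c i • d i + u ∧ (∀ i j, c i = 1 → c j = 1 → i = j) ∧
      (∀ i j, c i = -1 → c j = -1 → i = j) ∧ (4 ≤ Fintype.card ι → u = 0) := by
    obtain ⟨c, u, hu, hec⟩ := hW.exists_eq_add hd (hdW i₀) e
    by_cases hex : ∃ s : ZMod 3, u = s • ∑ i, d i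
    · obtain ⟨s, rfl⟩ := hex
      have hne : ∀ t : ZMod 3, t ≠ s → s • ∑ i, d i ≠ t • ∑ i, d i := by
        intro t hts h
        rw [← sub_eq_zero, ← sub_smul] at h
        rcases smul_eq_zero.1 h with h | h
        · exact hts (sub_eq_zero.1 h).symm
        · exact hd.sum_ne h
      refine ⟨fun i => c i + s, 0, W.zero_mem, ?_, ?_, ?_, fun _ => rfl⟩
      · rw [hec, add_zero, Finset.smul_sum, ← Finset.sum_add_distrib]
        exact Finset.sum_congr rfl fun i _ => (add_smul _ _ _).symm
      · intro i j hi hj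
        refine hW.eq_of_coeff_eq hd he heW hu hec (hne (s - 1) (by simp)) (i := i) (j := j) ?_ ?_
        · linear_combination hi
        · linear_combination hj
      · intro i j hi hj
        refine hW.eq_of_coeff_eq hd he heW hu hec (hne (s + 1) (by simp)) (i := i) (j := j) ?_ ?_
        · linear_combination hi
        · linear_combination hj
    · push Not at hex
      have hinj : ∀ i j, c i = c j → i = j := fun i j hij =>
        hW.eq_of_coeff_eq hd he heW hu hec (hex (-c i)) (by ring) (by rw [hij]; ring)
      refine ⟨c, u, hu, hec, fun i j hi hj => hinj i j (hi.trans hj.symm),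
        fun i j hi hj => hinj i j (hi.trans hj.symm), fun h4 => ?_⟩
      have := Fintype.card_le_of_injective c fun i j => hinj i j
      rw [ZMod.card] at this
      omega
  have hsub : ∀ b : ι → ZMod 3, (∀ i, c i = b i) → e = ∑ i, b i • d i + u := by
    intro b hb
    rw [hec, funext hb]
  have hsingle : ∀ i, ∑ k, (Pi.single i (1 : ZMod 3) : ι → ZMod 3) k • d k = d i := by
    intro i
    simp [Pi.single_apply, ite_smul]
  by_cases hp : ∃ i, c i = 1
  · obtain ⟨i, hi⟩ := hp
    by_cases hm : ∃ j, c j = -1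
    · obtain ⟨j, hj⟩ := hm
      have hij : i ≠ j := by
        rintro rfl
        rw [hi] at hj
        exact absurd hj (by decide)
      right
      refine ⟨i, j, hij, u, hu, ?_, hu0⟩
      rw [hsub (fun k => (Pi.single i (1 : ZMod 3) : ι → ZMod 3) k -
        (Pi.single j (1 : ZMod 3) : ι → ZMod 3) k)]
      · simp only [sub_smul, Finset.sum_sub_distrib, hsingle]
      · intro k
        rcases zmod_three_cases (c k) with h | h | h
        · have hki : k ≠ i := by rintro rfl; rw [h] at hi; exact zero_ne_one hi
          have hkj : k ≠ j := by rintro rfl; rw [h] at hj; exact absurd hj (by decide)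
          rw [h, Pi.single_eq_of_ne hki, Pi.single_eq_of_ne hkj, sub_zero]
        · rw [h, hone k i h hi, Pi.single_eq_same, Pi.single_eq_of_ne hij, sub_zero]
        · rw [h, hone' k j h hj, Pi.single_eq_same, Pi.single_eq_of_ne hij.symm, zero_sub]
    · push Not at hm
      left
      refine ⟨i, Or.inl (hW.eq_of_sub_mem he (hd.mem i) heW ?_)⟩
      rw [hsub (Pi.single i 1), hsingle, add_sub_cancel_left]
      · exact hu
      · intro k
        rcases zmod_three_cases (c k) with h | h | h
        · have hki : k ≠ i := by rintro rfl; rw [h] at hi; exact zero_ne_one hi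
          rw [h, Pi.single_eq_of_ne hki]
        · rw [h, hone k i h hi, Pi.single_eq_same]
        · exact absurd h (hm k)
  · push Not at hp
    by_cases hm : ∃ j, c j = -1
    · obtain ⟨j, hj⟩ := hm
      left
      refine ⟨j, Or.inr (hW.eq_of_sub_mem he (hW.neg_closed _ (hd.mem j)) heW ?_)⟩
      rw [hsub (fun k => -(Pi.single j (1 : ZMod 3) : ι → ZMod 3) k)]
      · simp only [neg_smul, Finset.sum_neg_distrib, hsingle]
        simpa using hu
      · intro k
        rcases zmod_three_cases (c k) with h | h | h
        · have hkj : k ≠ j := by rintro rfl; rw [h] at hj; exact absurd hj (by decide)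
          rw [h, Pi.single_eq_of_ne hkj, neg_zero]
        · exact absurd h (hp k)
        · rw [h, hone' k j h hj, Pi.single_eq_same]
    · push Not at hm
      exfalso
      apply heW
      rw [hsub (fun _ => 0)]
      · simpa using hu
      · intro k
        rcases zmod_three_cases (c k) with h | h | h
        · exact h
        · exact absurd h (hp k)
        · exact absurd h (hm k)

/-- Two differences that share their first index are not both in `S`. -/
theorem not_mem_of_sub_mem (hW : IsMaxConn S W) (hd : IsEar S W d) {i j k : ι}
    (hij : i ≠ j) (hik : i ≠ k) (hjk : j ≠ k) (hj : d i - d j ∈ S) :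
    d i - d k ∉ S := by
  classical
  intro hk
  -- Taking `d i - d j`, `d i - d k` and the negatives of the remaining members other than `d i`
  -- gives vectors with sum `-∑ d`, because 2 = -1. This is an ear with one member fewer, too small
  -- to generate `d i` over `W`.
  let g : ι → V := fun l => (if l = j ∨ l = k then d i else 0) - d l
  have hcomb : ∀ a : {l // l ≠ i} → ZMod 3, ∑ x : {l // l ≠ i}, a x • g x =
      ∑ l, (if h : l ≠ i then -a ⟨l, h⟩ else a ⟨j, hij.symm⟩ + a ⟨k, hik.symm⟩) • d l := by
    intro a
    rw [sum_subtype_smul (fun l => l ≠ i) a g]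
    have h1 : ∀ l, (if h : l ≠ i then a ⟨l, h⟩ else 0) • g l =
        (if l = j then a ⟨j, hij.symm⟩ • d i else 0) + (if l = k then a ⟨k, hik.symm⟩ • d i else 0)
          + (if h : l ≠ i then -a ⟨l, h⟩ else 0) • d l := by
      intro l
      by_cases hli : l = i
      · subst hli
        simp [hij, hik]
      by_cases hlj : l = j
      · subst hlj
        simp [g, hjk, hli, sub_eq_add_neg]
      by_cases hlk : l = k
      · subst hlk
        simp [g, hlj, hli, sub_eq_add_neg]
      · simp [g, hlj, hlk, hli]
    have h2 : ∀ l, (if h : l ≠ i then -a ⟨l, h⟩ else a ⟨j, hij.symm⟩ + a ⟨k, hik.symm⟩) • d l =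
        (if l = i then (a ⟨j, hij.symm⟩ + a ⟨k, hik.symm⟩) • d i else 0) +
          (if h : l ≠ i then -a ⟨l, h⟩ else 0) • d l := by
      intro l
      by_cases hli : l = i
      · subst hli
        simp
      · simp [hli]
    simp only [h1, h2, Finset.sum_add_distrib, Finset.sum_ite_eq', Finset.mem_univ, if_true,
      add_smul]
  have hear : IsEar S W fun x : {l // l ≠ i} => g x := by
    have hsum : ∑ x : {l // l ≠ i}, g x = -∑ l, d l := by
      have h1 := hcomb fun _ => 1
      simp only [one_smul] at h1
      rw [h1, ← Finset.sum_neg_distrib]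
      refine Finset.sum_congr rfl fun l _ => ?_
      have : (1 + 1 : ZMod 3) = -1 := by decide
      split_ifs <;> simp [this]
    refine ⟨fun x => ?_, ?_, ?_, fun a ha x₀ hx₀ x => ?_⟩
    · by_cases hxj : (x : ι) = j
      · simpa [g, hxj] using hj
      by_cases hxk : (x : ι) = k
      · simpa [g, hxk] using hk
      · simpa [g, hxj, hxk] using hW.neg_closed _ (hd.mem x)
    · rw [hsum]
      exact neg_mem hd.sum_mem
    · rw [hsum]
      exact neg_ne_zero.2 hd.sum_ne
    · rw [hcomb] at ha
      have h1 := hd.eq_of_sum_mem ha x x₀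
      rw [dif_pos x.2, dif_pos x₀.2, neg_inj] at h1
      rw [← hx₀]
      exact h1
  have hgW : g j ∉ W := by
    intro h
    have h1 := hd.eq_of_sub_mem (b := Pi.single i 1) (c := Pi.single j 1) (by
      have hsingle : ∀ i, ∑ k, (Pi.single i (1 : ZMod 3) : ι → ZMod 3) k • d k = d i := by
        intro i
        simp [Pi.single_apply, ite_smul]
      rw [hsingle, hsingle]
      simpa [g] using h) i k
    rw [Pi.single_eq_same, Pi.single_eq_of_ne hij, Pi.single_eq_of_ne hik.symm,
      Pi.single_eq_of_ne hjk.symm] at h1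
    simp at h1
  obtain ⟨a, v, hv, h1⟩ := hW.exists_eq_add hear (i := ⟨j, hij.symm⟩) hgW (d i)
  rw [hcomb] at h1
  have h2 := hd.eq_of_sub_mem (b := Pi.single i 1)
    (c := fun l => if h : l ≠ i then -a ⟨l, h⟩ else a ⟨j, hij.symm⟩ + a ⟨k, hik.symm⟩) (by
      have hsingle : ∑ k, (Pi.single i (1 : ZMod 3) : ι → ZMod 3) k • d k = d i := by
        simp [Pi.single_apply, ite_smul]
      rw [hsingle]
      exact sub_eq_iff_eq_add'.2 h1 ▸ hv)
  have hj' := h2 i j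
  have hk' := h2 i k
  rw [Pi.single_eq_same, Pi.single_eq_of_ne hij.symm, dif_neg (by simp), dif_pos hij.symm] at hj'
  rw [Pi.single_eq_same, Pi.single_eq_of_ne hik.symm, dif_neg (by simp), dif_pos hik.symm] at hk'
  generalize a ⟨j, hij.symm⟩ = x at hj' hk'
  generalize a ⟨k, hik.symm⟩ = y at hj' hk'
  revert x y
  decide

end IsMaxConn

end ConnectedHyperplane

/-! ### Small cocircuits and the existence of a connected hyperplane. -/

section ConnectedHyperplane

set_option linter.unusedSectionVars false

variable {V : Type*} [AddCommGroup V] [Module (ZMod 3) V] [FiniteDimensional (ZMod 3) V]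

theorem isCoatom_of_finrank {H : Submodule (ZMod 3) V}
    (h : finrank (ZMod 3) H + 1 = finrank (ZMod 3) V) : IsCoatom H := by
  refine ⟨?_, fun U hU => ?_⟩
  · rintro rfl
    rw [finrank_top] at h
    omega
  · have := finrank_lt_finrank_of_lt hU
    have := finrank_le U
    exact eq_top_of_finrank_eq (by omega)

namespace IsMaxConn

variable {ι : Type*} [Fintype ι] {S : Set V} {W : Submodule (ZMod 3) V} {d : ι → V}

theorem isCoatom_sup_span (hW : IsMaxConn S W) (hd : IsEar S W d) (hdW : ∀ i, d i ∉ W) {i j : ι}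
    (hij : i ≠ j) : IsCoatom (W ⊔ span (ZMod 3) (d '' {k | k ≠ i ∧ k ≠ j})) := by
  classical
  have hsingle : ∑ k, (Pi.single i (1 : ZMod 3) : ι → ZMod 3) k • d k = d i := by
    simp [Pi.single_apply, ite_smul]
  have hi : d i ∉ W ⊔ span (ZMod 3) (d '' {k | k ≠ i ∧ k ≠ j}) := by
    intro h
    have h1 : ∀ v ∈ span (ZMod 3) (d '' {k | k ≠ i ∧ k ≠ j}), ∃ c : ι → ZMod 3,
        c i = 0 ∧ c j = 0 ∧ v = ∑ k, c k • d k := by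
      intro v hv
      induction hv using span_induction with
      | mem v hv =>
        obtain ⟨k, hk, rfl⟩ := hv
        refine ⟨Pi.single k 1, Pi.single_eq_of_ne hk.1.symm _, Pi.single_eq_of_ne hk.2.symm _, ?_⟩
        simp [Pi.single_apply, ite_smul]
      | zero => exact ⟨0, rfl, rfl, by simp⟩
      | add v w _ _ hv hw =>
        obtain ⟨a, ha, ha', rfl⟩ := hv
        obtain ⟨b, hb, hb', rfl⟩ := hw
        exact ⟨a + b, by simp [ha, hb], by simp [ha', hb'],
          by simp [add_smul, Finset.sum_add_distrib]⟩
      | smul x v _ hv =>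
        obtain ⟨a, ha, ha', rfl⟩ := hv
        exact ⟨x • a, by simp [ha], by simp [ha'], by simp [mul_smul, Finset.smul_sum]⟩
    obtain ⟨u, hu, v, hv, huv⟩ := mem_sup.1 h
    obtain ⟨c, hci, hcj, rfl⟩ := h1 v hv
    have h2 := hd.eq_of_sub_mem (b := Pi.single i 1) (c := c)
      (by rw [hsingle, ← huv, add_sub_cancel_right]; exact hu) i j
    rw [Pi.single_eq_same, Pi.single_eq_of_ne hij.symm, hci, hcj] at h2
    simp at h2
  rw [← covBy_top_iff]
  have htop : span (ZMod 3) {d i} ⊔ (W ⊔ span (ZMod 3) (d '' {k | k ≠ i ∧ k ≠ j})) = ⊤ := by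
    have hne : ∀ k, k ≠ j →
        d k ∈ span (ZMod 3) {d i} ⊔ (W ⊔ span (ZMod 3) (d '' {k | k ≠ i ∧ k ≠ j})) := by
      intro k hkj
      by_cases hki : k = i
      · rw [hki]
        exact mem_sup_left (mem_span_singleton_self _)
      · exact mem_sup_right (mem_sup_right (subset_span ⟨k, ⟨hki, hkj⟩, rfl⟩))
    rw [eq_top_iff, ← hW.sup_eq_top hd (hdW i)]
    refine sup_le (le_sup_left.trans le_sup_right) (span_le.2 ?_)
    rintro _ ⟨k, rfl⟩
    by_cases hk : k = j
    · subst hk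
      have : d k = ∑ l, d l - ∑ l ∈ Finset.univ.erase k, d l := by
        rw [← Finset.add_sum_erase _ _ (Finset.mem_univ k), add_sub_cancel_right]
      rw [SetLike.mem_coe, this]
      exact Submodule.sub_mem _ (mem_sup_right (mem_sup_left hd.sum_mem))
        (Submodule.sum_mem _ fun l hl => hne l (Finset.ne_of_mem_erase hl))
    · exact hne k hk
  rw [← htop]
  exact covBy_span_singleton_sup hi

/-- The hyperplane generated by `W` and all members of the ear but two misses `±d i` and `±d j`. Any
other vector of `S` that it misses is of the difference type of `eq_or_eq_sub`, and there is at most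
one suitable pair of these up to sign. -/
theorem exists_small (hW : IsMaxConn S W) (hd : IsEar S W d) (hdW : ∀ i, d i ∉ W) :
    ¬ NoSmallCocircuit S := by
  classical
  intro hS
  have h3 := hW.three_le_card hd hdW
  have key : ∀ i j, i ≠ j → ∀ e₀ : V,
      ∃ p q u, p ≠ q ∧ u ∈ W ∧ d p - d q + u ∈ S ∧ d p - d q + u ∉ W ∧
        (4 ≤ Fintype.card ι → u = 0) ∧
        (¬ ∃ i, d p - d q + u = d i ∨ d p - d q + u = -d i) ∧
        d p - d q + u ∉ W ⊔ span (ZMod 3) (d '' {k | k ≠ i ∧ k ≠ j}) ∧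
        d p - d q + u ≠ e₀ ∧ d p - d q + u ≠ -e₀ := by
    intro i j hij e₀
    have hle : W ⊔ span (ZMod 3) (d '' {k | k ≠ i ∧ k ≠ j}) ≤
        span (ZMod 3) (S ∩ (W ⊔ span (ZMod 3) (d '' {k | k ≠ i ∧ k ≠ j}) :
          Submodule (ZMod 3) V)) := by
      refine sup_le ?_ (span_le.2 ?_)
      · conv_lhs => rw [← hW.conn.span_eq]
        exact span_mono (Set.inter_subset_inter_right _ (le_sup_left (a := W)))
      · rintro _ ⟨k, hk, rfl⟩
        exact subset_span ⟨hd.mem k, mem_sup_right (subset_span ⟨k, hk, rfl⟩)⟩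
    obtain ⟨v, hv, hvH, h1, h2, h3, h4, h5, h6⟩ := hS _ (hW.isCoatom_sup_span hd hdW hij)
      (le_antisymm (span_le.2 Set.inter_subset_right) hle) (d i) (d j) e₀
    have hvW : v ∉ W := fun h => hvH (mem_sup_left h)
    have hnd : ¬ ∃ i, v = d i ∨ v = -d i := by
      rintro ⟨k, hk⟩
      by_cases hki : k = i
      · subst hki
        exact hk.elim h1 h2
      by_cases hkj : k = j
      · subst hkj
        exact hk.elim h3 h4
      have hkH : d k ∈ W ⊔ span (ZMod 3) (d '' {k | k ≠ i ∧ k ≠ j}) :=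
        mem_sup_right (subset_span ⟨k, ⟨hki, hkj⟩, rfl⟩)
      rcases hk with rfl | rfl
      · exact hvH hkH
      · exact hvH (neg_mem_iff.2 hkH)
    rcases hW.eq_or_eq_sub hd hdW hv hvW with h | ⟨p, q, hpq, u, hu, rfl, hu0⟩
    · exact absurd h hnd
    · exact ⟨p, q, u, hpq, hu, hv, hvW, hu0, hnd, hvH, h5, h6⟩
  rcases h3.eq_or_lt with hcard | hcard
  · rw [eq_comm, ← Finset.card_univ] at hcard
    obtain ⟨i, j, k, hij, hik, hjk, huniv⟩ := Finset.card_eq_three.1 hcard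
    have hcov : ∀ l, l = i ∨ l = j ∨ l = k := by
      intro l
      have := Finset.mem_univ l
      rw [huniv] at this
      simpa using this
    have hsum : d i + d j + d k ∈ W := by
      have := hd.sum_mem
      rw [huniv, Finset.sum_insert (by simp [hij, hik]), Finset.sum_pair hjk, ← add_assoc] at this
      exact this
    -- For a three-member ear the sum vanishes modulo `W`, so in characteristic three all
    -- differences agree up to sign modulo `W`, and `eq_of_sub_mem` leaves only one point of this
    -- type.
    have hdiff : ∀ p q, p ≠ q → d p - d q - (d i - d j) ∈ W ∨ d p - d q + (d i - d j) ∈ W := by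
      have h1 : ∀ x : V, x = -(x + x) := fun x =>
        eq_neg_of_add_eq_zero_left (by rw [← add_assoc]; exact three_add_eq_zero x)
      have hjk' : d j - d k - (d i - d j) ∈ W := by
        have : d j - d k - (d i - d j) = -(d i + d j + d k) := by
          have := three_add_eq_zero (d j)
          rw [← sub_eq_zero]
          rw [← this]
          abel
        rw [this]
        exact neg_mem_iff.2 hsum
      have hik' : d i - d k + (d i - d j) ∈ W := by
        have : d i - d k + (d i - d j) = -(d i + d j + d k) := by
          have := three_add_eq_zero (d i)
          rw [← sub_eq_zero]
          rw [← this]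
          abel
        rw [this]
        exact neg_mem_iff.2 hsum
      intro p q hpq
      rcases hcov p with rfl | rfl | rfl <;> rcases hcov q with rfl | rfl | rfl
      · exact absurd rfl hpq
      · left; simp
      · exact Or.inr hik'
      · right; simp
      · exact absurd rfl hpq
      · exact Or.inl hjk'
      · left
        rw [← neg_mem_iff]
        convert! hik' using 1
        abel
      · right
        rw [← neg_mem_iff]
        convert! hjk' using 1
        abel
      · exact absurd rfl hpq
    obtain ⟨p, q, u, hpq, hu, hS₀, hW₀, -, -, -, -, -⟩ := key i j hij 0
    obtain ⟨p', q', u', hpq', hu', hS₁, hW₁, -, -, -, hne, hne'⟩ := key i j hij (d p - d q + u)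
    have hcases : (d p' - d q' + u') - (d p - d q + u) ∈ W ∨
        (d p' - d q' + u') - (-(d p - d q + u)) ∈ W := by
      rcases hdiff p q hpq with h | h <;> rcases hdiff p' q' hpq' with h' | h'
      · left
        convert! W.add_mem (W.sub_mem h' h) (W.sub_mem hu' hu) using 1
        abel
      · right
        convert! W.add_mem (W.add_mem h' h) (W.add_mem hu' hu) using 1
        abel
      · right
        convert! W.add_mem (W.add_mem h' h) (W.add_mem hu' hu) using 1
        abel
      · left
        convert! W.add_mem (W.sub_mem h' h) (W.sub_mem hu' hu) using 1
        abel
    rcases hcases with h | h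
    · exact hne (hW.eq_of_sub_mem hS₁ hS₀ hW₁ h)
    · exact hne' (hW.eq_of_sub_mem hS₁ (hW.neg_closed _ hS₀) hW₁ h)
  · obtain ⟨i, j, k, hij, -, -⟩ := Fintype.two_lt_card_iff.1 (by omega : 2 < Fintype.card ι)
    have hneg : ∀ a b, d a - d b ∈ S → d b - d a ∈ S := fun a b h => by
      rw [← neg_sub]
      exact hW.neg_closed _ h
    -- One difference `d p - d q` in `S` is found first. The hyperplane that omits exactly `p` and
    -- `q` then yields a second difference, which must involve `p` or `q`; `not_mem_of_sub_mem`
    -- excludes this.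
    obtain ⟨p, q, u, hpq, -, hS₀, -, hu0, -⟩ := key i j hij 0
    rw [hu0 hcard, add_zero] at hS₀
    obtain ⟨p', q', u', hpq', -, hS₁, -, hu0', -, hH, hne, hne'⟩ := key p q hpq (d p - d q)
    rw [hu0' hcard, add_zero] at hS₁ hne hne' hH
    have hmem : ∀ l, l ≠ p → l ≠ q →
        d l ∈ W ⊔ span (ZMod 3) (d '' {k | k ≠ p ∧ k ≠ q}) := fun l h h' =>
      mem_sup_right (subset_span ⟨l, ⟨h, h'⟩, rfl⟩)
    by_cases h1 : p' = p
    · subst h1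
      by_cases h2 : q' = q
      · exact hne (by rw [h2])
      · exact hW.not_mem_of_sub_mem hd hpq hpq' (Ne.symm h2) hS₀ hS₁
    by_cases h2 : p' = q
    · subst h2
      by_cases h3 : q' = p
      · exact hne' (by rw [h3, neg_sub])
      · exact hW.not_mem_of_sub_mem hd hpq.symm hpq' (Ne.symm h3) (hneg _ _ hS₀) hS₁
    by_cases h3 : q' = p
    · subst h3
      exact hW.not_mem_of_sub_mem hd hpq (Ne.symm h1) (Ne.symm h2) hS₀ (hneg _ _ hS₁)
    by_cases h4 : q' = q
    · subst h4
      exact hW.not_mem_of_sub_mem hd hpq.symm (Ne.symm h2) (Ne.symm h1) (hneg _ _ hS₀)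
        (hneg _ _ hS₁)
    · exact hH (Submodule.sub_mem _ (hmem _ h1 h2) (hmem _ h3 h4))

end IsMaxConn

/-- A connected set of vectors without small cocircuits has a connected hyperplane. -/
theorem exists_connected_hyperplane {S : Set V} (h0 : (0 : V) ∉ S) (hneg : ∀ v ∈ S, -v ∈ S)
    (hV : 2 ≤ finrank (ZMod 3) V) (hS : ¬ Sep (ZMod 3) S ⊤) (hc : NoSmallCocircuit S) :
    ∃ H : Submodule (ZMod 3) V, IsCoatom H ∧ ¬ Sep (ZMod 3) S H := by
  have hspan : span (ZMod 3) S = ⊤ := by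
    have := span_inter_eq_of_not_sep (by rwa [finrank_top]) hS
    simpa using this
  have hne : S.Nonempty := by
    by_contra h
    rw [Set.not_nonempty_iff_eq_empty.1 h, span_empty] at hspan
    have := finrank_top (ZMod 3) V
    rw [← hspan, finrank_bot] at this
    omega
  obtain ⟨s, hs⟩ := hne
  have hs0 : s ≠ 0 := fun h => h0 (h ▸ hs)
  have hconn : Conn S (span (ZMod 3) {s}) := by
    refine ⟨by simpa using hs0, le_antisymm (span_le.2 Set.inter_subset_right) ?_, ?_⟩
    · exact span_mono (Set.singleton_subset_iff.2 ⟨hs, mem_span_singleton_self _⟩)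
    · rintro ⟨A, B, hA, hB, hAB, hd, -⟩
      have h1 := finrank_sup_of_disjoint hd
      rw [hAB, finrank_span_singleton hs0] at h1
      have hA' : finrank (ZMod 3) A ≠ 0 := fun h => hA (finrank_eq_zero.1 h)
      have hB' : finrank (ZMod 3) B ≠ 0 := fun h => hB (finrank_eq_zero.1 h)
      omega
  have hproper : span (ZMod 3) {s} ≠ ⊤ := by
    intro h
    have := finrank_top (ZMod 3) V
    rw [← h, finrank_span_singleton hs0] at this
    omega
  obtain ⟨W, ⟨hW, hWt⟩, hmax⟩ := WellFounded.has_min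
    (wellFounded_gt (α := Submodule (ZMod 3) V)) {W | Conn S W ∧ W ≠ ⊤} ⟨_, hconn, hproper⟩
  have hlt := finrank_lt hWt
  by_cases hcod : finrank (ZMod 3) W + 1 = finrank (ZMod 3) V
  · exact ⟨W, isCoatom_of_finrank hcod, hW.not_sep⟩
  have hM : IsMaxConn S W := by
    refine ⟨hneg, hW, fun U hU hUc => ?_, by omega⟩
    by_contra hne
    exact hmax U ⟨hUc, hne⟩ hU
  obtain ⟨ι, _, d, hd, hdW⟩ := exists_ear hneg hV hS hW hWt
  exact absurd hc (hM.exists_small hd hdW)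

end ConnectedHyperplane

/-! ### Counting separated and connected hyperplanes. -/

section Counting

set_option linter.unusedSectionVars false

variable {V : Type*} [AddCommGroup V] [Module (ZMod 3) V] [FiniteDimensional (ZMod 3) V]

theorem natCard_submodule (U : Submodule (ZMod 3) V) :
    Nat.card U = 3 ^ finrank (ZMod 3) U := by
  rw [natCard_eq_pow_finrank (K := ZMod 3), Nat.card_zmod]

theorem three_mul_card_add_card_le {A B W : Submodule (ZMod 3) V} (hd : Disjoint A B) (hA : A < W)
    (hB : B < W) : 3 * (Nat.card A + Nat.card B) ≤ Nat.card W + 9 := by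
  have hsum := finrank_sup_of_disjoint hd
  have hle := finrank_mono (sup_le hA.le hB.le)
  have ha := finrank_lt_finrank_of_lt hA
  have hb := finrank_lt_finrank_of_lt hB
  rw [hsum] at hle
  rw [natCard_submodule, natCard_submodule, natCard_submodule]
  generalize finrank (ZMod 3) A = a at *
  generalize finrank (ZMod 3) B = b at *
  generalize finrank (ZMod 3) W = w at *
  have h1 : 3 * 3 ^ a ≤ 3 ^ w := by
    rw [← pow_succ']; exact Nat.pow_le_pow_right (by norm_num) ha
  have h2 : 3 * 3 ^ b ≤ 3 ^ w := by
    rw [← pow_succ']; exact Nat.pow_le_pow_right (by norm_num) hb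
  have h3 : 3 ^ a * 3 ^ b ≤ 3 ^ w := by
    rw [← pow_add]; exact Nat.pow_le_pow_right (by norm_num) hle
  rcases Nat.eq_zero_or_pos a with rfl | ha0
  · rw [pow_zero]; omega
  rcases Nat.eq_zero_or_pos b with rfl | hb0
  · rw [pow_zero]; omega
  have h4 : 3 ≤ 3 ^ a := by simpa using Nat.pow_le_pow_right (n := 3) (by norm_num) ha0
  have h5 : 3 ≤ 3 ^ b := by simpa using Nat.pow_le_pow_right (n := 3) (by norm_num) hb0
  -- With a, b ≥ 1 the bound is the inequality (3^a - 3)(3^b - 3) ≥ 0 together with 3^a · 3^b ≤ 3^w.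
  nlinarith

/-- The nonzero vectors of `W` are covered by the two parts of the separation for `G` and by `C` and
`D`; the first two account for at most about a third of `W`. -/
theorem two_mul_card_le {G R : Set V} (hcov : ∀ v ≠ 0, v ∈ G ∨ v ∈ R)
    {W C D : Submodule (ZMod 3) V} (hG : Sep (ZMod 3) G W)
    (hR : ∀ v ∈ R, v ∈ W → v ∈ C ∨ v ∈ D) :
    2 * Nat.card W ≤ 3 * (Nat.card C + Nat.card D) := by
  have hfin : Finite V := Module.finite_of_finite (ZMod 3)
  obtain ⟨A, B, hA, hB, hAB, hd, hS⟩ := hG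
  have hAW : A < W := by
    refine lt_of_le_of_ne (hAB ▸ le_sup_left) ?_
    rintro rfl
    exact hB (hd.eq_bot_of_ge (hAB ▸ le_sup_right))
  have hBW : B < W := by
    refine lt_of_le_of_ne (hAB ▸ le_sup_right) ?_
    rintro rfl
    exact hA (hd.symm.eq_bot_of_ge (hAB ▸ le_sup_left))
  have h1 := three_mul_card_add_card_le hd hAW hBW
  have hsub : (W : Set V) \ {0} ⊆ (((A : Set V) \ {0}) ∪ ((B : Set V) \ {0})) ∪
      (((C : Set V) \ {0}) ∪ ((D : Set V) \ {0})) := by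
    rintro v ⟨hv, hv0⟩
    rcases hcov v hv0 with h | h
    · left
      exact (hS v h hv).imp (fun h => ⟨h, hv0⟩) fun h => ⟨h, hv0⟩
    · right
      exact (hR v h hv).imp (fun h => ⟨h, hv0⟩) fun h => ⟨h, hv0⟩
  have hcard : ∀ U : Submodule (ZMod 3) V, ((U : Set V) \ {0}).ncard + 1 = Nat.card U := by
    intro U
    exact Set.ncard_sdiff_singleton_add_one U.zero_mem
  have h2 := (Set.ncard_le_ncard hsub).trans ((Set.ncard_union_le _ _).trans
    (add_le_add (Set.ncard_union_le _ _) (Set.ncard_union_le _ _)))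
  have hA' := hcard A
  have hB' := hcard B
  have hC' := hcard C
  have hD' := hcard D
  have hW' := hcard W
  omega

/-- Two separations would give 2|W| ≤ |W| + 9, but |W| is at least 27. -/
theorem not_sep_of_sep {G R : Set V} (hcov : ∀ v ≠ 0, v ∈ G ∨ v ∈ R)
    {W : Submodule (ZMod 3) V} (hW : 3 ≤ finrank (ZMod 3) W) (hG : Sep (ZMod 3) G W) :
    ¬ Sep (ZMod 3) R W := by
  rintro ⟨A, B, hA, hB, hAB, hd, hS⟩
  have h1 := two_mul_card_le hcov hG hS
  have hAW : A < W := by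
    refine lt_of_le_of_ne (hAB ▸ le_sup_left) ?_
    rintro rfl
    exact hB (hd.eq_bot_of_ge (hAB ▸ le_sup_right))
  have hBW : B < W := by
    refine lt_of_le_of_ne (hAB ▸ le_sup_right) ?_
    rintro rfl
    exact hA (hd.symm.eq_bot_of_ge (hAB ▸ le_sup_left))
  have h2 := three_mul_card_add_card_le hd hAW hBW
  have h3 : 3 ^ 3 ≤ Nat.card W := by
    rw [natCard_submodule]; exact Nat.pow_le_pow_right (by norm_num) hW
  omega

/-- A colouring of the nonzero vectors in two colours such that each hyperplane is separated in
some colour, while no colour is separated in the whole space and no colour has a small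
cocircuit. -/
structure Coloring (G R : Set V) : Prop where
  zero_left : (0 : V) ∉ G
  zero_right : (0 : V) ∉ R
  neg_left : ∀ v ∈ G, -v ∈ G
  neg_right : ∀ v ∈ R, -v ∈ R
  cover : ∀ v ≠ 0, v ∈ G ∨ v ∈ R
  sep : ∀ H : Submodule (ZMod 3) V, IsCoatom H → Sep (ZMod 3) G H ∨ Sep (ZMod 3) R H
  not_sep_left : ¬ Sep (ZMod 3) G ⊤
  not_sep_right : ¬ Sep (ZMod 3) R ⊤
  noSmall_left : NoSmallCocircuit G
  noSmall_right : NoSmallCocircuit R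
  four_le : 4 ≤ finrank (ZMod 3) V

theorem Coloring.symm {G R : Set V} (h : Coloring G R) : Coloring R G :=
  ⟨h.zero_right, h.zero_left, h.neg_right, h.neg_left, fun v hv => (h.cover v hv).symm,
    fun H hH => (h.sep H hH).symm, h.not_sep_right, h.not_sep_left, h.noSmall_right,
    h.noSmall_left, h.four_le⟩

theorem finrank_ker {φ : Dual (ZMod 3) V} (h : φ ≠ 0) :
    finrank (ZMod 3) (LinearMap.ker φ) + 1 = finrank (ZMod 3) V :=
  Dual.finrank_ker_add_one_of_ne_zero h

theorem isCoatom_ker {φ : Dual (ZMod 3) V} (h : φ ≠ 0) : IsCoatom (LinearMap.ker φ) :=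
  isCoatom_of_finrank (finrank_ker h)

theorem mem_span_singleton_iff_signs {φ ψ : Dual (ZMod 3) V} :
    ψ ∈ span (ZMod 3) {φ} ↔ ψ = 0 ∨ ψ = φ ∨ ψ = -φ := by
  rw [mem_span_singleton]
  constructor
  · rintro ⟨c, rfl⟩
    rcases zmod_three_cases c with rfl | rfl | rfl <;> simp
  · rintro (rfl | rfl | rfl)
    · exact ⟨0, by simp⟩
    · exact ⟨1, by simp⟩
    · exact ⟨-1, by simp⟩

theorem finrank_ker_inf_ker {φ ψ : Dual (ZMod 3) V} (hφ : φ ≠ 0) (h : ψ ∉ span (ZMod 3) {φ}) :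
    finrank (ZMod 3) ↥(LinearMap.ker φ ⊓ LinearMap.ker ψ) + 2 = finrank (ZMod 3) V := by
  have hψ : ψ ≠ 0 := fun h0 => h (h0 ▸ zero_mem _)
  have hne : LinearMap.ker φ ≠ LinearMap.ker ψ := by
    intro heq
    apply h
    have := mem_span_of_iInf_ker_le_ker (L := fun _ : Unit => φ) (K := ψ) (by simp [heq])
    simpa using this
  have hsup : LinearMap.ker φ ⊔ LinearMap.ker ψ = ⊤ :=
    (isCoatom_ker hφ).sup_eq_top_of_ne (isCoatom_ker hψ) hne
  have h1 := finrank_sup_add_finrank_inf_eq (LinearMap.ker φ) (LinearMap.ker ψ)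
  rw [hsup, finrank_top] at h1
  have h2 := finrank_ker hφ
  have h3 := finrank_ker hψ
  omega

namespace Coloring

variable {G R : Set V}

theorem conn_of_not_sep {S : Set V} {W : Submodule (ZMod 3) V} (hW : 2 ≤ finrank (ZMod 3) W)
    (hS : ¬ Sep (ZMod 3) S W) : Conn S W := by
  refine ⟨?_, span_inter_eq_of_not_sep hW hS, hS⟩
  rintro rfl
  rw [finrank_bot] at hW
  omega

theorem sep_iff (h : Coloring G R) {φ : Dual (ZMod 3) V} (hφ : φ ≠ 0) :
    Sep (ZMod 3) R (LinearMap.ker φ) ↔ ¬ Sep (ZMod 3) G (LinearMap.ker φ) := by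
  have h1 := finrank_ker hφ
  have h4 := h.four_le
  constructor
  · intro h2 h3
    exact not_sep_of_sep h.cover (by omega) h3 h2
  · exact (h.sep _ (isCoatom_ker hφ)).resolve_left

/-- A hyperplane of `A ⊔ B` that is not separated is one of the parts of a separation. -/
theorem eq_or_eq_of_not_sep {S : Set V} {W A B : Submodule (ZMod 3) V} (hA : A ≠ ⊥) (hB : B ≠ ⊥)
    (hd : Disjoint A B) (hWH : W ≤ A ⊔ B) (hW : 2 ≤ finrank (ZMod 3) W)
    (hcod : finrank (ZMod 3) W + 1 = finrank (ZMod 3) ↥(A ⊔ B))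
    (hS : ∀ v ∈ S, v ∈ A ⊔ B → v ∈ A ∨ v ∈ B) (hns : ¬ Sep (ZMod 3) S W) :
    (W = A ∧ finrank (ZMod 3) B = 1) ∨ (W = B ∧ finrank (ZMod 3) A = 1) := by
  have h1 := finrank_sup_of_disjoint hd
  have hA' : finrank (ZMod 3) A ≠ 0 := fun h => hA (finrank_eq_zero.1 h)
  have hB' : finrank (ZMod 3) B ≠ 0 := fun h => hB (finrank_eq_zero.1 h)
  rcases (conn_of_not_sep hW hns).le_or_le hWH hd hS with h | h
  · have := finrank_mono h
    exact Or.inl ⟨eq_of_le_of_finrank_eq h (by omega), by omega⟩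
  · have := finrank_mono h
    exact Or.inr ⟨eq_of_le_of_finrank_eq h (by omega), by omega⟩

/-- If a hyperplane is separated for `G` while a subspace of codimension two in it is not, then
outside this subspace there is only one point of `G` in the hyperplane. -/
theorem exists_point (h : Coloring G R) {φ ψ : Dual (ZMod 3) V} (hφ : φ ≠ 0)
    (hψ : ψ ∉ span (ZMod 3) {φ})
    (hW : ¬ Sep (ZMod 3) G (LinearMap.ker φ ⊓ LinearMap.ker ψ))
    (hG : Sep (ZMod 3) G (LinearMap.ker ψ)) :
    ∃ b : V, ∀ v ∈ G, v ∈ LinearMap.ker ψ → v ∈ LinearMap.ker φ ∨ v = b ∨ v = -b := by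
  obtain ⟨A, B, hA, hB, hAB, hd, hS⟩ := hG
  have h1 := finrank_ker_inf_ker hφ hψ
  have hψ0 : ψ ≠ 0 := fun h0 => hψ (h0 ▸ zero_mem _)
  have h2 := finrank_ker hψ0
  have h4 := h.four_le
  have hone : ∀ C : Submodule (ZMod 3) V, finrank (ZMod 3) C = 1 →
      ∃ b : V, ∀ v ∈ G, v ∈ C → v = b ∨ v = -b := by
    intro C hC
    obtain ⟨⟨b, hb⟩, -, hbC⟩ := finrank_eq_one_iff'.1 hC
    refine ⟨b, fun v hv hvC => ?_⟩
    obtain ⟨c, hc⟩ := hbC ⟨v, hvC⟩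
    have hc' : c • b = v := congrArg Subtype.val hc
    have hc0 : c ≠ 0 := by
      rintro rfl
      rw [zero_smul] at hc'
      exact h.zero_left (hc' ▸ hv)
    rw [← hc']
    exact smul_eq_or_eq_neg hc0 b
  rcases eq_or_eq_of_not_sep hA hB hd (hAB ▸ inf_le_right) (by omega) (by rw [hAB]; omega)
    (hAB ▸ hS) hW with ⟨hWA, hB1⟩ | ⟨hWB, hA1⟩
  · obtain ⟨b, hb⟩ := hone B hB1
    refine ⟨b, fun v hv hvψ => (hS v hv hvψ).imp (fun h => ?_) (hb v hv)⟩
    rw [← hWA] at h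
    exact h.1
  · obtain ⟨b, hb⟩ := hone A hA1
    refine ⟨b, fun v hv hvψ => (hS v hv hvψ).symm.imp (fun h => ?_) (hb v hv)⟩
    rw [← hWB] at h
    exact h.1

theorem ker_inf_ker_add (φ ψ : Dual (ZMod 3) V) (c : ZMod 3) :
    LinearMap.ker φ ⊓ LinearMap.ker (ψ + c • φ) = LinearMap.ker φ ⊓ LinearMap.ker ψ := by
  ext v
  simp only [Submodule.mem_inf, LinearMap.mem_ker, LinearMap.add_apply, LinearMap.smul_apply]
  constructor
  · rintro ⟨h1, h2⟩
    rw [h1, smul_zero, add_zero] at h2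
    exact ⟨h1, h2⟩
  · rintro ⟨h1, h2⟩
    rw [h1, h2, smul_zero, add_zero]
    exact ⟨rfl, rfl⟩

theorem add_smul_notMem {φ ψ : Dual (ZMod 3) V} (h : ψ ∉ span (ZMod 3) {φ}) (c : ZMod 3) :
    ψ + c • φ ∉ span (ZMod 3) {φ} := by
  rwa [Submodule.add_mem_iff_left _ (smul_mem _ _ (mem_span_singleton_self _))]

/-- A pencil of hyperplanes through a connected axis contains at least two connected hyperplanes if
it contains one. -/
theorem exists_not_sep (h : Coloring G R) {φ ψ : Dual (ZMod 3) V} (hφ : φ ≠ 0)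
    (hφG : ¬ Sep (ZMod 3) G (LinearMap.ker φ)) (hψ : ψ ∉ span (ZMod 3) {φ})
    (hW : ¬ Sep (ZMod 3) G (LinearMap.ker φ ⊓ LinearMap.ker ψ)) :
    ∃ c : ZMod 3, ¬ Sep (ZMod 3) G (LinearMap.ker (ψ + c • φ)) := by
  by_contra hcon
  push Not at hcon
  have h1 : ∀ c : ZMod 3, ∃ b : V, ∀ v ∈ G, v ∈ LinearMap.ker (ψ + c • φ) →
      v ∈ LinearMap.ker φ ∨ v = b ∨ v = -b := fun c =>
    h.exists_point hφ (add_smul_notMem hψ c) (by rwa [ker_inf_ker_add]) (hcon c)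
  choose b hb using h1
  have h2 := finrank_ker hφ
  have h4 := h.four_le
  obtain ⟨v, hv, hvφ, h5, h6, h7, h8, h9, h10⟩ := h.noSmall_left _ (isCoatom_ker hφ)
    (span_inter_eq_of_not_sep (by omega) hφG) (b 0) (b 1) (b (-1))
  -- Each vector outside ker φ lies in exactly one of the three other hyperplanes of the pencil. If
  -- these are all separated, each contributes only one point of `G`, so the fourth point found
  -- outside ker φ is a contradiction.
  have hvφ' : φ v ≠ 0 := hvφ
  have h11 : ∃ c : ZMod 3, ψ v + c * φ v = 0 :=
    ⟨-(ψ v * (φ v)⁻¹), by field_simp; ring⟩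
  obtain ⟨c, hc⟩ := h11
  have h12 := hb c v hv hc
  rcases zmod_three_cases c with rfl | rfl | rfl
  · exact h12.elim hvφ fun h => h.elim h5 h6
  · exact h12.elim hvφ fun h => h.elim h7 h8
  · exact h12.elim hvφ fun h => h.elim h9 h10

theorem natCard_dualAnnihilator (A : Submodule (ZMod 3) V) {k : ℕ}
    (hA : finrank (ZMod 3) A + k = finrank (ZMod 3) V) : Nat.card A.dualAnnihilator = 3 ^ k := by
  rw [natCard_eq_pow_finrank (K := ZMod 3), Nat.card_zmod]
  have := Subspace.finrank_add_finrank_dualAnnihilator_eq A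
  congr 1
  omega

theorem mem_dualAnnihilator_iff_le {A : Submodule (ZMod 3) V} {φ : Dual (ZMod 3) V} :
    φ ∈ A.dualAnnihilator ↔ A ≤ LinearMap.ker φ :=
  mem_dualAnnihilator φ

theorem span_le_dualAnnihilator {A : Submodule (ZMod 3) V} {φ : Dual (ZMod 3) V}
    (h : A ≤ LinearMap.ker φ) : span (ZMod 3) {φ} ≤ A.dualAnnihilator :=
  (span_singleton_le_iff_mem _ _).2 (mem_dualAnnihilator_iff_le.2 h)

/-- Few hyperplanes meet a connected one in a separated subspace. -/
theorem ncard_sep_le (h : Coloring G R) {φ : Dual (ZMod 3) V} (hφ : φ ≠ 0)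
    (hφG : ¬ Sep (ZMod 3) G (LinearMap.ker φ)) :
    {ψ : Dual (ZMod 3) V | ψ ∈ span (ZMod 3) {φ} ∨
      Sep (ZMod 3) G (LinearMap.ker φ ⊓ LinearMap.ker ψ)}.ncard ≤ 36 := by
  have hfin : Finite (Dual (ZMod 3) V) := Module.finite_of_finite (ZMod 3)
  obtain ⟨A, B, hA, hB, hAB, hd, hS⟩ := (h.sep_iff hφ).2 hφG
  have h2 := finrank_ker hφ
  have h4 := h.four_le
  have hsum := finrank_sup_of_disjoint hd
  rw [hAB] at hsum
  have hA' : finrank (ZMod 3) A ≠ 0 := fun h => hA (finrank_eq_zero.1 h)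
  have hB' : finrank (ZMod 3) B ≠ 0 := fun h => hB (finrank_eq_zero.1 h)
  have hAφ : A ≤ LinearMap.ker φ := hAB ▸ le_sup_left
  have hBφ : B ≤ LinearMap.ker φ := hAB ▸ le_sup_right
  -- `R` is separated in ker φ by `A` and `B`. If the axis is in neither of them, counting vectors
  -- of the axis forces dimension two, hence rank four, and then `A` or `B` lies in ker ψ.
  have key : ∀ ψ, ψ ∉ span (ZMod 3) {φ} → Sep (ZMod 3) G (LinearMap.ker φ ⊓ LinearMap.ker ψ) →
      (finrank (ZMod 3) A + 2 = finrank (ZMod 3) V ∧ A ≤ LinearMap.ker ψ) ∨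
      (finrank (ZMod 3) B + 2 = finrank (ZMod 3) V ∧ B ≤ LinearMap.ker ψ) ∨
      (finrank (ZMod 3) V = 4 ∧ (A ≤ LinearMap.ker ψ ∨ B ≤ LinearMap.ker ψ)) := by
    intro ψ hψ hsep
    have hW := finrank_ker_inf_ker hφ hψ
    set W := LinearMap.ker φ ⊓ LinearMap.ker ψ with hWdef
    by_cases hWA : W ≤ A
    · have := finrank_mono hWA
      exact Or.inl ⟨by omega, eq_of_le_of_finrank_eq hWA (by omega) ▸ inf_le_right⟩
    by_cases hWB : W ≤ B
    · have := finrank_mono hWB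
      exact Or.inr (Or.inl ⟨by omega, eq_of_le_of_finrank_eq hWB (by omega) ▸ inf_le_right⟩)
    right; right
    have hlA : A ⊓ W < W := lt_of_le_of_ne inf_le_right fun h => hWA (h ▸ inf_le_left)
    have hlB : B ⊓ W < W := lt_of_le_of_ne inf_le_right fun h => hWB (h ▸ inf_le_left)
    have hdW : Disjoint (A ⊓ W) (B ⊓ W) := hd.mono inf_le_left inf_le_left
    have hc1 := two_mul_card_le h.cover hsep (C := A ⊓ W) (D := B ⊓ W) fun v hv hvW =>
      (hS v hv hvW.1).imp (fun h => ⟨h, hvW⟩) fun h => ⟨h, hvW⟩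
    have hc2 := three_mul_card_add_card_le hdW hlA hlB
    have hw2 : finrank (ZMod 3) W ≤ 2 := by
      by_contra hw
      have h3 : 3 ^ 3 ≤ Nat.card W := by
        rw [natCard_submodule]; exact Nat.pow_le_pow_right (by norm_num) (by omega)
      omega
    have hr : finrank (ZMod 3) V = 4 := by omega
    refine ⟨hr, ?_⟩
    by_contra hcon
    push Not at hcon
    have hlA' : A ⊓ W < A := lt_of_le_of_ne inf_le_left fun h =>
      hcon.1 ((inf_eq_left.1 h).trans inf_le_right)
    have hlB' : B ⊓ W < B := lt_of_le_of_ne inf_le_left fun h =>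
      hcon.2 ((inf_eq_left.1 h).trans inf_le_right)
    have f1 := finrank_lt_finrank_of_lt hlA'
    have f2 := finrank_lt_finrank_of_lt hlB'
    have f3 : finrank (ZMod 3) W = 2 := by omega
    have f4 : finrank (ZMod 3) ↥(A ⊓ W) + finrank (ZMod 3) ↥(B ⊓ W) ≤ 1 := by omega
    rw [natCard_submodule, natCard_submodule, natCard_submodule, f3] at hc1
    have f5 : (finrank (ZMod 3) ↥(A ⊓ W) = 0 ∧ finrank (ZMod 3) ↥(B ⊓ W) ≤ 1) ∨
        (finrank (ZMod 3) ↥(A ⊓ W) ≤ 1 ∧ finrank (ZMod 3) ↥(B ⊓ W) = 0) := by omega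
    have f6 : ∀ k ≤ 1, 3 ^ k ≤ 3 := fun k hk => by
      simpa using Nat.pow_le_pow_right (n := 3) (by norm_num) hk
    rcases f5 with ⟨f5, f7⟩ | ⟨f7, f5⟩ <;>
    · have := f6 _ f7
      rw [f5] at hc1
      omega
  by_cases hr : finrank (ZMod 3) V = 4
  · have hsub : {ψ : Dual (ZMod 3) V | ψ ∈ span (ZMod 3) {φ} ∨
        Sep (ZMod 3) G (LinearMap.ker φ ⊓ LinearMap.ker ψ)} ⊆
        (A.dualAnnihilator : Set (Dual (ZMod 3) V)) ∪ B.dualAnnihilator := by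
      intro ψ hψ
      by_cases hψφ : ψ ∈ span (ZMod 3) {φ}
      · exact Or.inl (span_le_dualAnnihilator hAφ hψφ)
      rcases key ψ hψφ (hψ.resolve_left hψφ) with h | h | ⟨-, h | h⟩
      · exact Or.inl (mem_dualAnnihilator_iff_le.2 h.2)
      · exact Or.inr (mem_dualAnnihilator_iff_le.2 h.2)
      · exact Or.inl (mem_dualAnnihilator_iff_le.2 h)
      · exact Or.inr (mem_dualAnnihilator_iff_le.2 h)
    refine (Set.ncard_le_ncard hsub).trans ((Set.ncard_union_le _ _).trans ?_)
    rw [← Nat.card_coe_set_eq, ← Nat.card_coe_set_eq]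
    -- In rank four the parts have dimensions 1 and 2, so their annihilators have 27 and 9 elements;
    -- this is the origin of 36.
    have hcases : (finrank (ZMod 3) A = 1 ∧ finrank (ZMod 3) B = 2) ∨
        (finrank (ZMod 3) A = 2 ∧ finrank (ZMod 3) B = 1) := by omega
    rcases hcases with ⟨ha, hb⟩ | ⟨ha, hb⟩
    · have h1 := natCard_dualAnnihilator A (k := 3) (by omega)
      have h2 := natCard_dualAnnihilator B (k := 2) (by omega)
      exact (Nat.add_le_add h1.le h2.le).trans (by norm_num)
    · have h1 := natCard_dualAnnihilator A (k := 2) (by omega)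
      have h2 := natCard_dualAnnihilator B (k := 3) (by omega)
      exact (Nat.add_le_add h1.le h2.le).trans (by norm_num)
  have hle : ∀ C : Submodule (ZMod 3) V, finrank (ZMod 3) C + 2 = finrank (ZMod 3) V →
      {ψ : Dual (ZMod 3) V | ψ ∈ span (ZMod 3) {φ} ∨
        Sep (ZMod 3) G (LinearMap.ker φ ⊓ LinearMap.ker ψ)} ⊆ C.dualAnnihilator →
      {ψ : Dual (ZMod 3) V | ψ ∈ span (ZMod 3) {φ} ∨
        Sep (ZMod 3) G (LinearMap.ker φ ⊓ LinearMap.ker ψ)}.ncard ≤ 36 := by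
    intro C hC hsub
    refine (Set.ncard_le_ncard hsub).trans ?_
    rw [← Nat.card_coe_set_eq]
    exact (natCard_dualAnnihilator C hC).le.trans (by norm_num)
  by_cases hbA : finrank (ZMod 3) A + 2 = finrank (ZMod 3) V
  · refine hle A hbA fun ψ hψ => ?_
    by_cases hψφ : ψ ∈ span (ZMod 3) {φ}
    · exact span_le_dualAnnihilator hAφ hψφ
    rcases key ψ hψφ (hψ.resolve_left hψφ) with h | h | h
    · exact mem_dualAnnihilator_iff_le.2 h.2
    · omega
    · exact absurd h.1 hr
  by_cases hbB : finrank (ZMod 3) B + 2 = finrank (ZMod 3) V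
  · refine hle B hbB fun ψ hψ => ?_
    by_cases hψφ : ψ ∈ span (ZMod 3) {φ}
    · exact span_le_dualAnnihilator hBφ hψφ
    rcases key ψ hψφ (hψ.resolve_left hψφ) with h | h | h
    · omega
    · exact mem_dualAnnihilator_iff_le.2 h.2
    · exact absurd h.1 hr
  · have hsub : {ψ : Dual (ZMod 3) V | ψ ∈ span (ZMod 3) {φ} ∨
        Sep (ZMod 3) G (LinearMap.ker φ ⊓ LinearMap.ker ψ)} ⊆ span (ZMod 3) {φ} := by
      intro ψ hψ
      by_contra hψφ
      rcases key ψ hψφ (hψ.resolve_left hψφ) with h | h | h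
      · exact hbA h.1
      · exact hbB h.1
      · exact hr h.1
    refine (Set.ncard_le_ncard hsub).trans ?_
    rw [← Nat.card_coe_set_eq]
    have : Nat.card (span (ZMod 3) {φ}) = 3 ^ 1 := by
      rw [natCard_submodule, finrank_span_singleton hφ]
    exact this.le.trans (by norm_num)

/-- Few connected hyperplanes meet a separated one in a connected subspace. -/
theorem ncard_not_sep_le (h : Coloring G R) {ψ : Dual (ZMod 3) V} (hψ : ψ ≠ 0)
    (hψG : Sep (ZMod 3) G (LinearMap.ker ψ)) :
    {φ : Dual (ZMod 3) V | φ ≠ 0 ∧ ψ ∉ span (ZMod 3) {φ} ∧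
      ¬ Sep (ZMod 3) G (LinearMap.ker φ ⊓ LinearMap.ker ψ)}.ncard ≤ 6 := by
  have hfin : Finite (Dual (ZMod 3) V) := Module.finite_of_finite (ZMod 3)
  set Y := {φ : Dual (ZMod 3) V | φ ≠ 0 ∧ ψ ∉ span (ZMod 3) {φ} ∧
      ¬ Sep (ZMod 3) G (LinearMap.ker φ ⊓ LinearMap.ker ψ)} with hY
  rcases Y.eq_empty_or_nonempty with h0 | ⟨φ₀, hφ₀⟩
  · rw [h0, Set.ncard_empty]
    omega
  obtain ⟨A, B, hA, hB, hAB, hd, hS⟩ := hψG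
  have h2 := finrank_ker hψ
  have h4 := h.four_le
  have hsum := finrank_sup_of_disjoint hd
  rw [hAB] at hsum
  -- A connected axis in ker ψ must equal the larger part of the separation, so it is unique. Its
  -- annihilator has nine elements, three of which are the multiples of ψ; six remain.
  have key : ∀ φ ∈ Y, LinearMap.ker φ ⊓ LinearMap.ker ψ = LinearMap.ker φ₀ ⊓ LinearMap.ker ψ := by
    have h5 : ∀ φ ∈ Y, (LinearMap.ker φ ⊓ LinearMap.ker ψ = A ∧ finrank (ZMod 3) B = 1) ∨
        (LinearMap.ker φ ⊓ LinearMap.ker ψ = B ∧ finrank (ZMod 3) A = 1) := by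
      rintro φ ⟨hφ, hψφ, hW⟩
      have h1 := finrank_ker_inf_ker hφ hψφ
      exact eq_or_eq_of_not_sep hA hB hd (hAB ▸ inf_le_right) (by omega) (by rw [hAB]; omega)
        (hAB ▸ hS) hW
    intro φ hφ
    rcases h5 φ hφ with ⟨h6, h7⟩ | ⟨h6, h7⟩ <;> rcases h5 φ₀ hφ₀ with ⟨h8, h9⟩ | ⟨h8, h9⟩
    · rw [h6, h8]
    · omega
    · omega
    · rw [h6, h8]
  have hann := natCard_dualAnnihilator (LinearMap.ker φ₀ ⊓ LinearMap.ker ψ) (k := 2)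
    (finrank_ker_inf_ker hφ₀.1 hφ₀.2.1)
  have hsub : Y ∪ {0, ψ, -ψ} ⊆
      ((LinearMap.ker φ₀ ⊓ LinearMap.ker ψ).dualAnnihilator : Set (Dual (ZMod 3) V)) := by
    rintro φ (hφ | hφ)
    · exact mem_dualAnnihilator_iff_le.2 (key φ hφ ▸ inf_le_left)
    · refine span_le_dualAnnihilator (φ := ψ) inf_le_right ?_
      exact mem_span_singleton_iff_signs.2 hφ
  have hdisj : Disjoint Y {0, ψ, -ψ} := by
    rw [Set.disjoint_left]
    rintro φ ⟨hφ, hψφ, -⟩ (rfl | rfl | rfl)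
    · exact hφ rfl
    · exact hψφ (mem_span_singleton_self _)
    · exact hψφ (mem_span_singleton_iff_signs.2 (Or.inr (Or.inr (neg_neg _).symm)))
  have hne : ψ ≠ -ψ := by
    intro h
    apply hψ
    have := three_add_eq_zero ψ
    rw [eq_neg_iff_add_eq_zero] at h
    rwa [h, zero_add] at this
  have hthree : ({0, ψ, -ψ} : Set (Dual (ZMod 3) V)).ncard = 3 := by
    rw [Set.ncard_eq_three]
    exact ⟨0, ψ, -ψ, hψ.symm, by simpa using hψ, hne, rfl⟩
  have h5 := Set.ncard_le_ncard hsub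
  rw [Set.ncard_union_eq hdisj, hthree] at h5
  have h6 : ((LinearMap.ker φ₀ ⊓ LinearMap.ker ψ).dualAnnihilator :
      Set (Dual (ZMod 3) V)).ncard = 3 ^ 2 := hann
  omega

end Coloring

end Counting

/-! ### Double counting and the numerical contradiction. -/

section DoubleCounting

set_option linter.unusedSectionVars false

theorem mul_ncard_le_of_double_count {ι : Type*} [Finite ι] {A B : Set ι} (r : ι → ι → Prop)
    {k l : ℕ} (h1 : ∀ x ∈ A, B.ncard ≤ {y | y ∈ B ∧ r x y}.ncard + k)
    (h2 : ∀ y ∈ B, {x | x ∈ A ∧ r x y}.ncard ≤ l) :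
    A.ncard * B.ncard ≤ B.ncard * l + A.ncard * k := by
  classical
  have := Fintype.ofFinite ι
  have h3 := Finset.sum_card_bipartiteAbove_eq_sum_card_bipartiteBelow r
    (s := A.toFinset) (t := B.toFinset)
  have h4 : A.toFinset.card * B.ncard ≤
      ∑ x ∈ A.toFinset, ((B.toFinset.bipartiteAbove r x).card + k) := by
    rw [← smul_eq_mul]
    refine Finset.card_nsmul_le_sum _ _ _ fun x hx => ?_
    refine (h1 x (Set.mem_toFinset.1 hx)).trans (Nat.add_le_add_right (le_of_eq ?_) k)
    rw [← Set.ncard_coe_finset]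
    congr 1
    ext y
    simp [Finset.bipartiteAbove]
  have h5 : ∑ y ∈ B.toFinset, (A.toFinset.bipartiteBelow r y).card ≤ B.toFinset.card * l := by
    rw [← smul_eq_mul]
    refine Finset.sum_le_card_nsmul _ _ _ fun y hy => ?_
    refine (le_of_eq ?_).trans (h2 y (Set.mem_toFinset.1 hy))
    rw [← Set.ncard_coe_finset]
    congr 1
    ext x
    simp [Finset.bipartiteBelow]
  rw [Finset.sum_add_distrib, Finset.sum_const, smul_eq_mul, h3] at h4
  rw [← Set.ncard_eq_toFinset_card'] at h4 h5
  omega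

/-- The last hypothesis reads (g - 6)(ρ - 33) ≤ 198. The second bound on g gives ρ ≤ 2g + 29, and g
+ ρ ≥ 80; together these bound ρ and then exclude all cases. -/
theorem false_of_counts {g ρ N : ℕ} (hN : 81 ≤ N) (hs : g + ρ + 1 = N) (hg : N ≤ 3 * g + 30)
    (hle : g ≤ ρ) (h : g * ρ ≤ ρ * 6 + g * 33) : False := by
  have h1 : ρ ≤ 51 := by nlinarith
  have h2 : g ≤ 51 := hle.trans h1
  have h3 : ρ ≤ 41 := by nlinarith
  nlinarith

variable {V : Type*} [AddCommGroup V] [Module (ZMod 3) V] [FiniteDimensional (ZMod 3) V]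

namespace Coloring

/-- The nonzero functionals whose kernel is connected. -/
def connFunctionals (S : Set V) : Set (Dual (ZMod 3) V) :=
  {φ | φ ≠ 0 ∧ ¬ Sep (ZMod 3) S (LinearMap.ker φ)}

/-- The functionals whose kernel meets the kernel of `φ` in a connected subspace of codimension
two. -/
def connAxes (S : Set V) (φ : Dual (ZMod 3) V) : Set (Dual (ZMod 3) V) :=
  {ψ | ψ ∉ span (ZMod 3) {φ} ∧ ¬ Sep (ZMod 3) S (LinearMap.ker φ ⊓ LinearMap.ker ψ)}

variable {G R : Set V}

theorem ne_neg_self {φ : Dual (ZMod 3) V} (hφ : φ ≠ 0) : φ ≠ -φ := by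
  intro h
  apply hφ
  have := three_add_eq_zero φ
  rw [eq_neg_iff_add_eq_zero] at h
  rwa [h, zero_add] at this

theorem ncard_zero_signs {φ : Dual (ZMod 3) V} (hφ : φ ≠ 0) :
    ({0, φ, -φ} : Set (Dual (ZMod 3) V)).ncard = 3 := by
  rw [Set.ncard_eq_three]
  exact ⟨0, φ, -φ, hφ.symm, by simpa using hφ, ne_neg_self hφ, rfl⟩

theorem ncard_add_ncard (h : Coloring G R) :
    (connFunctionals G).ncard + (connFunctionals R).ncard + 1 = 3 ^ finrank (ZMod 3) V := by
  have hfin : Finite (Dual (ZMod 3) V) := Module.finite_of_finite (ZMod 3)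
  have hd : Disjoint (connFunctionals G) (connFunctionals R) := by
    rw [Set.disjoint_left]
    rintro φ ⟨hφ, h1⟩ ⟨-, h2⟩
    exact h2 ((h.sep_iff hφ).2 h1)
  have hu : connFunctionals G ∪ connFunctionals R = {0}ᶜ := by
    ext φ
    constructor
    · rintro (h1 | h1) <;> exact h1.1
    · intro hφ
      by_cases h1 : Sep (ZMod 3) G (LinearMap.ker φ)
      · exact Or.inr ⟨hφ, fun h2 => (h.sep_iff hφ).1 h2 h1⟩
      · exact Or.inl ⟨hφ, h1⟩
  rw [← Set.ncard_union_eq hd, hu]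
  have h1 := Set.ncard_add_ncard_compl ({0} : Set (Dual (ZMod 3) V))
  rw [Set.ncard_singleton, natCard_eq_pow_finrank (K := ZMod 3), Nat.card_zmod,
    Subspace.dual_finrank_eq] at h1
  omega

theorem ncard_compl_connAxes_le (h : Coloring G R) {φ : Dual (ZMod 3) V}
    (hφ : φ ∈ connFunctionals G) : (connAxes G φ)ᶜ.ncard ≤ 36 := by
  convert h.ncard_sep_le hφ.1 hφ.2 using 2
  ext ψ
  simp only [connAxes, Set.mem_compl_iff, Set.mem_ofPred_eq]
  tauto

theorem neg_mem_connFunctionals {φ : Dual (ZMod 3) V} (hφ : φ ∈ connFunctionals G) :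
    -φ ∈ connFunctionals G := by
  refine ⟨neg_ne_zero.2 hφ.1, ?_⟩
  have : LinearMap.ker (-φ) = LinearMap.ker φ := by
    ext v
    simp
  rw [this]
  exact hφ.2

theorem signs_subset_compl_connAxes (S : Set V) (φ : Dual (ZMod 3) V) :
    {0, φ, -φ} ⊆ (connAxes S φ)ᶜ := fun _ hψ h => h.1 (mem_span_singleton_iff_signs.2 hψ)

/-- By `exists_not_sep` every connected axis functional becomes a connected one after adding one of
the three multiples of φ, so three translates of the intersection cover all of them. -/
theorem ncard_connAxes_le (h : Coloring G R) {φ : Dual (ZMod 3) V}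
    (hφ : φ ∈ connFunctionals G) :
    (connAxes G φ).ncard ≤ 3 * (connFunctionals G ∩ connAxes G φ).ncard := by
  have hfin : Finite (Dual (ZMod 3) V) := Module.finite_of_finite (ZMod 3)
  set X := connFunctionals G ∩ connAxes G φ with hX
  have hsub : connAxes G φ ⊆ ((fun ψ => ψ - (0 : ZMod 3) • φ) '' X ∪
      (fun ψ => ψ - (1 : ZMod 3) • φ) '' X) ∪ (fun ψ => ψ - (-1 : ZMod 3) • φ) '' X := by
    rintro ψ ⟨hψ, hW⟩
    obtain ⟨c, hc⟩ := h.exists_not_sep hφ.1 hφ.2 hψ hW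
    have hn := add_smul_notMem hψ c
    have hmem : ψ + c • φ ∈ X := by
      refine ⟨⟨fun h0 => hn (h0 ▸ zero_mem _), hc⟩, hn, ?_⟩
      rwa [ker_inf_ker_add]
    have hψc : ψ + c • φ - c • φ = ψ := add_sub_cancel_right _ _
    rcases zmod_three_cases c with rfl | rfl | rfl
    · exact Or.inl (Or.inl ⟨_, hmem, hψc⟩)
    · exact Or.inl (Or.inr ⟨_, hmem, hψc⟩)
    · exact Or.inr ⟨_, hmem, hψc⟩
  have h1 := (Set.ncard_le_ncard hsub).trans ((Set.ncard_union_le _ _).trans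
    (Nat.add_le_add_right (Set.ncard_union_le _ _) _))
  have h2 := Set.ncard_image_le (f := fun ψ => ψ - (0 : ZMod 3) • φ) X.toFinite
  have h3 := Set.ncard_image_le (f := fun ψ => ψ - (1 : ZMod 3) • φ) X.toFinite
  have h4 := Set.ncard_image_le (f := fun ψ => ψ - (-1 : ZMod 3) • φ) X.toFinite
  omega

/-- At most 36 functionals have no connected axis with φ, and ±φ are connected functionals not
counted among the axes: 36 - 3 · 2 = 30. -/
theorem pow_le (h : Coloring G R) {φ : Dual (ZMod 3) V} (hφ : φ ∈ connFunctionals G) :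
    3 ^ finrank (ZMod 3) V ≤ 3 * (connFunctionals G).ncard + 30 := by
  have hfin : Finite (Dual (ZMod 3) V) := Module.finite_of_finite (ZMod 3)
  have h1 := Set.ncard_add_ncard_compl (connAxes G φ)
  rw [natCard_eq_pow_finrank (K := ZMod 3), Nat.card_zmod, Subspace.dual_finrank_eq] at h1
  have h2 := h.ncard_compl_connAxes_le hφ
  have h3 := h.ncard_connAxes_le hφ
  have hd : Disjoint (connFunctionals G ∩ connAxes G φ) {φ, -φ} :=
    Set.disjoint_left.2 fun ψ hψ hψ' => signs_subset_compl_connAxes G φ (Or.inr hψ') hψ.2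
  have hsub : (connFunctionals G ∩ connAxes G φ) ∪ {φ, -φ} ⊆ connFunctionals G := by
    rintro ψ (hψ | rfl | rfl)
    · exact hψ.1
    · exact hφ
    · exact neg_mem_connFunctionals hφ
  have h4 := Set.ncard_le_ncard hsub
  rw [Set.ncard_union_eq hd, Set.ncard_pair (ne_neg_self hφ.1)] at h4
  omega

/-- The pairs counted consist of a G-connected φ and an R-connected ψ whose kernels meet in a
G-connected subspace. The 36 exceptions for φ include 0 and ±φ, which are not R-connected; this
leaves 33. -/
theorem ncard_mul_ncard_le (h : Coloring G R) :
    (connFunctionals G).ncard * (connFunctionals R).ncard ≤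
      (connFunctionals R).ncard * 6 + (connFunctionals G).ncard * 33 := by
  have hfin : Finite (Dual (ZMod 3) V) := Module.finite_of_finite (ZMod 3)
  refine mul_ncard_le_of_double_count (fun φ ψ => ψ ∈ connAxes G φ) (fun φ hφ => ?_)
    fun ψ hψ => ?_
  · have h1 := h.ncard_compl_connAxes_le hφ
    have hsub : connFunctionals R ∪ {0, φ, -φ} ⊆
        {ψ | ψ ∈ connFunctionals R ∧ ψ ∈ connAxes G φ} ∪ (connAxes G φ)ᶜ := by
      rintro ψ (hψ | hψ)
      · by_cases h2 : ψ ∈ connAxes G φ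
        · exact Or.inl ⟨hψ, h2⟩
        · exact Or.inr h2
      · exact Or.inr (signs_subset_compl_connAxes G φ hψ)
    have hd : Disjoint (connFunctionals R) {0, φ, -φ} := by
      rw [Set.disjoint_left]
      rintro ψ ⟨hψ, hψR⟩ (rfl | rfl | rfl)
      · exact hψ rfl
      · exact hψR ((h.sep_iff hψ).2 hφ.2)
      · exact hψR ((h.sep_iff hψ).2 (neg_mem_connFunctionals hφ).2)
    have h2 := (Set.ncard_le_ncard hsub).trans (Set.ncard_union_le _ _)
    rw [Set.ncard_union_eq hd, ncard_zero_signs hφ.1] at h2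
    omega
  · have hψG := (h.symm.sep_iff hψ.1).2 hψ.2
    refine (Set.ncard_le_ncard ?_).trans (h.ncard_not_sep_le hψ.1 hψG)
    rintro φ ⟨hφ, h1, h2⟩
    exact ⟨hφ.1, h1, h2⟩

theorem connFunctionals_nonempty (h : Coloring G R) : (connFunctionals G).Nonempty := by
  obtain ⟨H, hH, hHG⟩ := exists_connected_hyperplane h.zero_left h.neg_left
    (by have := h.four_le; omega) h.not_sep_left h.noSmall_left
  obtain ⟨φ, hφ, hle⟩ := H.exists_le_ker_of_lt_top hH.lt_top
  refine ⟨φ, hφ, ?_⟩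
  rwa [(hH.le_iff_eq (isCoatom_ker hφ).1).1 hle]

theorem false (h : Coloring G R) : False := by
  have hN : 3 ^ 4 ≤ 3 ^ finrank (ZMod 3) V := Nat.pow_le_pow_right (by norm_num) h.four_le
  obtain ⟨φ, hφ⟩ := h.connFunctionals_nonempty
  obtain ⟨ψ, hψ⟩ := h.symm.connFunctionals_nonempty
  have h1 := h.ncard_add_ncard
  rcases le_total (connFunctionals G).ncard (connFunctionals R).ncard with hle | hle
  · exact false_of_counts hN h1 (h.pow_le hφ) hle h.ncard_mul_ncard_le
  · exact false_of_counts hN (by omega) (h.symm.pow_le hψ) hle h.symm.ncard_mul_ncard_le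

end Coloring

end DoubleCounting

/-! ### Assembling the colouring and the final theorem. -/

theorem opposite_neg_mem {V : Type*} [AddCommGroup V] {S : Set V} (hS : ∀ v ∈ S, -v ∈ S) :
    ∀ v ∈ opposite S, -v ∈ opposite S := fun v hv =>
  ⟨neg_ne_zero.2 hv.1, fun h => hv.2 (neg_neg v ▸ hS _ h)⟩

theorem four_le_finrank_fin {r : ℕ} (hr4 : 4 ≤ r) : 4 ≤ finrank (ZMod 3) (Fin r → ZMod 3) := by
  rwa [finrank_fin_fun]

theorem finrank_add_one_of_isCoatom {V : Type*} [AddCommGroup V] [Module (ZMod 3) V]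
    [FiniteDimensional (ZMod 3) V] {H : Submodule (ZMod 3) V} (hH : IsCoatom H) :
    finrank (ZMod 3) H + 1 = finrank (ZMod 3) V := by
  obtain ⟨φ, hφ, hle⟩ := H.exists_le_ker_of_lt_top hH.lt_top
  rw [← (hH.le_iff_eq (isCoatom_ker hφ).1).1 hle]
  exact finrank_ker hφ

theorem IsMinimalNonComatroid.coloring {α : Type*} {β : Type*} {M : Matroid α} {Mc : Matroid β}
    {r : ℕ} (hM : IsMinimalNonComatroid (ZMod 3) M) (hr : M.eRank = r) (hr4 : 4 ≤ r)
    {T : Set (ℙ (ZMod 3) (Fin r → ZMod 3))} (hT : Iso M (projGeom (ZMod 3) r ↾ T))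
    (hTc : Iso Mc (projGeom (ZMod 3) r ↾ Tᶜ))
    (hC : ¬ ∃ C : Set α, M.IsCocircuit C ∧ C.encard < 4)
    (hCc : ¬ ∃ C : Set β, Mc.IsCocircuit C ∧ C.encard < 4) :
    Coloring (signedImage Projectivization.rep T)
      (opposite (signedImage Projectivization.rep T)) := by
  have hr4' := four_le_finrank_fin hr4
  obtain ⟨f, hf, hfT⟩ := hT.exists_rep (rep_projGeom_restrict T)
  obtain ⟨f', hf', hfT'⟩ := hTc.exists_rep (rep_projGeom_restrict Tᶜ)
  rw [Matroid.restrict_ground_eq] at hfT hfT'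
  rw [signedImage_rep_compl] at hfT'
  have hspan : span (ZMod 3) (f '' M.E) = ⊤ := hf.span_eq_top (by rw [hr, finrank_fin_fun])
  have hneg : ∀ v ∈ signedImage Projectivization.rep T, -v ∈ signedImage Projectivization.rep T :=
    fun v => neg_mem_signedImage
  have hnc : ¬ Sep (ZMod 3) (opposite (signedImage Projectivization.rep T)) ⊤ :=
    hfT ▸ hM.not_sep_opposite hf hspan hT hfT
  have hspan' := span_inter_eq_of_not_sep (by rw [finrank_top]; omega) hnc
  rw [top_coe, Set.inter_univ] at hspan'
  refine ⟨hfT ▸ hf.zero_notMem_signedImage hM.simple, fun h => h.1 rfl, hneg,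
    opposite_neg_mem hneg, fun v hv => ?_, fun H hH => ?_, hfT ▸ hM.not_sep hf hspan, hnc, ?_, ?_,
    hr4'⟩
  · by_cases h : v ∈ signedImage Projectivization.rep T
    · exact Or.inl h
    · exact Or.inr ⟨hv, h⟩
  · have := finrank_add_one_of_isCoatom hH
    exact hfT ▸ hM.sep_of_ne_top hf hspan hH.1 (by omega)
  · rw [← hfT]
    exact hf.noSmallCocircuit hM.simple (by rw [span_signedImage, hspan]) hC
  · rw [← hfT']
    exact hf'.noSmallCocircuit (hTc.isSimple (isSimple_projGeom_restrict _))
      (by rw [hfT', hspan']) hCc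

end Comatroid

theorem theorem5p3 {α : Type*} {β : Type*} (M : Matroid α) (Mc : Matroid β) (r : ℕ)
    (hM : Comatroid.IsMinimalNonComatroid (ZMod 3) M)
    (hr : M.eRank = r) (hr4 : 4 ≤ r)
    (hMc : Comatroid.IsComplement (ZMod 3) r M Mc) :
    (∃ C : Set α, M.IsCocircuit C ∧ C.encard < 4) ∨
      (∃ C : Set β, Mc.IsCocircuit C ∧ C.encard < 4) := by
  obtain ⟨T, hT, hTc⟩ := hMc
  by_contra! hcon
  refine (hM.coloring hr hr4 hT hTc ?_ ?_).false
  · rintro ⟨C, hC, hC4⟩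
    exact absurd hC4 (not_lt.2 (hcon.1 C hC))
  · rintro ⟨C, hC, hC4⟩
    exact absurd hC4 (not_lt.2 (hcon.2 C hC))
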